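/- **Setting.** Fix $d$ and a target point $x\in\mathcal X=[0,1]^d$. For every sample size $n$ there are $2n$ i.i.d. observations $Z_i=(Y_i,X_i,W_i)$ with $Y_i\in\mathbb R$, $X_i\in\mathcal X$ and $W_i$ in a (standard Borel) space $\mathcal W$; the law of the observations, the space $\mathcal W$ and the parameter dimension $d_\nu$ below may change with $n$, while the constants $\psi_{\max},L,L_h$ do not. Conditional expectations given $X=x'$ are taken with respect to a fixed regular version of the conditional law of $(Y,W)$ given $X$, and $\|g\|_{x'}^2=\mathbb E[g(X,W)^2\mid X=x']$. Let $m(z;g)$ be a moment functional of an observation $z$ and a function $g(x,w)$, and let $h(w,\nu)$, $\nu\in\mathbb R^{d_\nu}$, be a known function which is $L_h$-Lipschitz in $\nu$ for every $w$. The regression function has the form $g_0(x',w)=\mathbb E[Y\mid W=w,X=x']=h(w,\nu_g(x'))$, and $\alpha_0(x',w)=h(w,\nu_\alpha(x'))$ is the conditional Riesz representer: for all $x'$ and all $g$ of the form $g(\cdot,w)=h(w,\nu(\cdot))$ with $\|g\|_{x'}<\infty$, $m(Z;g)$ is integrable given $X=x'$ and $\mathbb E[m(Z;g)\mid X=x']=\mathbb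 E[\alpha_0(X,W)g(X,W)\mid X=x']$. The target is $\theta_0(x)=\mathbb E[m(Z;g_0)\mid X=x]$; put $\psi(Z;\alpha,g)=m(Z;g)+\alpha(X,W)(Y-g(X,W))$. From the second half $Z_{n+1},\dots,Z_{2n}$ (and possibly independent auxiliary randomness) one computes $\hat\nu_g,\hat\nu_\alpha$ and $\hat g(x',w)=h(w,\hat\nu_g(x'))$, $\hat\alpha(x',w)=h(w,\hat\nu_\alpha(x'))$. From the first half one computes $$\hat\theta(x)=\sum_{i=1}^n K(x,X_i,Z_{1:n},\xi)\,\psi(Z_i;\hat\alpha,\hat g),\qquad K(x,X_i,Z_{1:n},\xi)=\frac1B\sum_{b=1}^B\tilde K(x,X_i,Z_{S_b},\xi_b),$$ where $S_1,\dots,S_B$ are independent uniformly random subsets of $\{1,\dots,n\}$ of size $s=s(n)\le n$, the $\xi_b$ are i.i.d., and data, auxiliary randomness, $(S_b)$ and $(\xi_b)$ are independent. The base kernel $\tilde K(x,X_i,Z_S,\xi)$ is nonnegative, vanishes for $i\notin S$, satisfies $\sum_{i\in S}\tilde K(x,X_i,Z_S,\xi)=1$, and is symmetric: relabelling the data of the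 subsample relabels the weights without changing their distribution (over $\xi$). Let $S=\{1,\dots,s\}$ and $$\eta(s)=\mathrm{Var}\Big(\mathbb E\Big[\sum_{i=1}^s\tilde K(x,X_i,Z_S,\xi_S)\psi(Z_i;\alpha_0,g_0)\,\Big|\,Z_1\Big]\Big).$$ **Assumptions.** There is a class $\mathcal F$ of admissible nuisance functions (possibly depending on $n$), each with $\|g\|_{x'}<\infty$ for all $x'$, which contains $g_0,\alpha_0$ and, almost surely, $\hat g,\hat\alpha$, such that: 1. (Honesty) For almost every realization of the nuisance estimates, holding $\hat g,\hat\alpha$ fixed, for every size-$s$ subset $S$ and $i\in S$: $\tilde K(x,X_i,Z_S,\xi)\perp\!\!\!\perp\big(\psi(Z_i;\hat\alpha,\hat g),\psi(Z_i;\alpha_0,g_0)\big)\mid X_i,\{Z_j\}_{j\in S\setminus\{i\}}$. 2. (Kernel shrinkage) For every size-$s$ subset $S$, $\mathbb E\big[\max_i\{\|X_i-x\|:\tilde K(x,X_i,Z_S,\xi)>0\}\big]\le\epsilon(s)$. 3. (Boundedness and smoothness) For all $g,\alpha\in\mathcal F$ and all $x'\in\mathcal X$, $|\psi(Z;\alpha,g)|\le\psi_{\max}$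 almost surely given $X=x'$; and $x'\mapsto\mathbb E[\psi(Z;\alpha,g)\mid X=x']$ is $L$-Lipschitz. 4. (Local mean-squared continuity) For all $g,\alpha\in\mathcal F$ and all $x'\in\mathcal X$, $$\mathbb E[(\psi(Z;\alpha,g)-\psi(Z;\alpha_0,g_0))^2\mid X=x']\le L\,\mathbb E[(g(X,W)-g_0(X,W))^2+(\alpha(X,W)-\alpha_0(X,W))^2\mid X=x'].$$ **Theorem.** Suppose in addition that, as $n\to\infty$, $s\to\infty$, $s=o(n)$, $B\ge(n/s)^2$, $\epsilon(s)\to0$, $n\eta(s)\to\infty$ and $n\epsilon(s)^2/(s^2\eta(s))\to0$. Suppose that for every $x'\in\mathcal X$, every $n\ge 1$ and every $\delta\in(0,1)$, with probability at least $1-\delta$, $$\big(\|\hat\nu_g(x')-\nu_g(x')\|_2^2+\|\hat\nu_\alpha(x')-\nu_\alpha(x')\|_2^2\big)^{1/2}\le r_n(\delta),$$ and that there is a sequence $\delta_n>0$ with $\sqrt{n/(s^2\eta(s))}\,\delta_n\to0$ and $\sqrt{n/(s^2\eta(s))}\,r_n^2(\delta_n/n)\to0$. Then $$\sqrt{\frac{n}{s^2\eta(s)}}\,\big(\hat\theta(x)-\theta_0(x)\big)\xrightarrow{d}N(0,1).$$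 -/

import Mathlib

open MeasureTheory ProbabilityTheory Filter Topology Asymptotics
open scoped NNReal ENNReal

noncomputable section

namespace DoublyRobust

/-! ### Observations -/

/-- The space `[0,1]^d` of target features, with the Euclidean metric. -/
abbrev Cube (d : ℕ) : Type :=
  {x : EuclideanSpace ℝ (Fin d) // ∀ i, x i ∈ Set.Icc (0 : ℝ) 1}

theorem isClosed_cube (d : ℕ) :
    IsClosed {x : EuclideanSpace ℝ (Fin d) | ∀ i, x i ∈ Set.Icc (0 : ℝ) 1} := by
  have h : {x : EuclideanSpace ℝ (Fin d) | ∀ i, x i ∈ Set.Icc (0 : ℝ) 1} =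
      ⋂ i, (fun x : EuclideanSpace ℝ (Fin d) => x i) ⁻¹' Set.Icc (0 : ℝ) 1 := by
    ext x
    simp only [Set.mem_ofPred_eq, Set.mem_iInter, Set.mem_preimage]
  rw [h]
  exact isClosed_iInter fun i => isClosed_Icc.preimage (by fun_prop)

instance instStandardBorelCube (d : ℕ) : StandardBorelSpace (Cube d) :=
  (isClosed_cube d).measurableSet.standardBorel

/-- An observation `Z = (X, (Y, W))`: target features `X`, scalar outcome `Y`, further variables
`W`. -/
abbrev Obs (d : ℕ) (W : Type*) : Type _ := Cube d × (ℝ × W)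

namespace Obs

variable {d : ℕ} {W : Type*}

/-- The target features of an observation. -/
def feat (z : Obs d W) : Cube d := z.1

/-- The outcome of an observation. -/
def outcome (z : Obs d W) : ℝ := z.2.1

/-- The additional variables of an observation. -/
def extra (z : Obs d W) : W := z.2.2

end Obs

/-! ### The population -/

/-- The raw data of the estimation problem: the law of `X`, the conditional law of `(Y, W)` given
`X = x`, the moment functional `m(z; g)`, the known function `h(w, ν)`, the nuisance parameters
`ν_g`, `ν_α`, and a class of admissible nuisance functions `(x, w) ↦ g(x, w)`. -/
structure Model (d p : ℕ) (W : Type*) [MeasurableSpace W] where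
  /-- law of `X` -/
  lawX : Measure (Cube d)
  /-- law of `(Y, W)` given `X = x` -/
  condLaw : Kernel (Cube d) (ℝ × W)
  /-- moment functional `m(z; g)` -/
  moment : Obs d W → (Cube d → W → ℝ) → ℝ
  /-- the function `h(w, ν)` -/
  link : W → EuclideanSpace ℝ (Fin p) → ℝ
  /-- regression parameter `ν_g(x)` -/
  nuG : Cube d → EuclideanSpace ℝ (Fin p)
  /-- parameter `ν_α(x)` of the conditional Riesz representer -/
  nuA : Cube d → EuclideanSpace ℝ (Fin p)
  /-- class of admissible nuisance functions -/
  admissible : Set (Cube d → W → ℝ)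
  isProb : IsProbabilityMeasure lawX
  isMarkov : IsMarkovKernel condLaw

attribute [instance] Model.isProb Model.isMarkov

namespace Model

variable {d p : ℕ} {W : Type*} [MeasurableSpace W] (M : Model d p W)

/-- The law of one observation. -/
def obsLaw : Measure (Obs d W) := M.lawX ⊗ₘ M.condLaw

instance : IsProbabilityMeasure M.obsLaw := by unfold obsLaw; infer_instance

/-- The conditional expectation `E[f(Z) | X = x]`. -/
def condMean (f : Obs d W → ℝ) (x : Cube d) : ℝ := ∫ q, f (x, q) ∂(M.condLaw x)

/-- The function `(x, w) ↦ h(w, ν(x))`. -/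
def ofParam (ν : Cube d → EuclideanSpace ℝ (Fin p)) : Cube d → W → ℝ :=
  fun x w => M.link w (ν x)

/-- `g₀(x, w) = h(w, ν_g(x))`. -/
def g0 : Cube d → W → ℝ := M.ofParam M.nuG

/-- `α₀(x, w) = h(w, ν_α(x))`. -/
def a0 : Cube d → W → ℝ := M.ofParam M.nuA

/-- The target `θ₀(x) = E[m(Z; g₀) | X = x]`. -/
def theta0 (x : Cube d) : ℝ := M.condMean (fun z => M.moment z M.g0) x

/-- The debiased moment `ψ(z; α, g) = m(z; g) + α(X, W) (Y - g(X, W))`. -/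
def psi (a g : Cube d → W → ℝ) (z : Obs d W) : ℝ :=
  M.moment z g + a z.feat z.extra * (z.outcome - g z.feat z.extra)

/-- `‖g‖_x < ∞`, where `‖g‖_x² = E[g(x, W)² | X = x]`. -/
def MemG (x : Cube d) (g : Cube d → W → ℝ) : Prop :=
  MemLp (fun q : ℝ × W => g x q.2) 2 (M.condLaw x)

/-- Measurability of the ingredients, and finiteness of all the norms `‖g‖_x` of admissible
functions. -/
structure WellPosed : Prop where
  measurable_link : Measurable (Function.uncurry M.link)
  measurable_nuG : Measurable M.nuG
  measurable_nuA : Measurable M.nuA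
  g0_mem : M.g0 ∈ M.admissible
  a0_mem : M.a0 ∈ M.admissible
  measurable_admissible : ∀ g ∈ M.admissible, Measurable (Function.uncurry g)
  measurable_moment : ∀ g ∈ M.admissible, Measurable fun z => M.moment z g
  memG : ∀ g ∈ M.admissible, ∀ x, M.MemG x g

/-- `g₀(x, w) = E[Y | W = w, X = x]`. -/
def IsRegression : Prop :=
  ∀ x, Integrable (fun q : ℝ × W => q.1) (M.condLaw x) ∧
    (M.condLaw x)[fun q : ℝ × W => q.1 | MeasurableSpace.comap Prod.snd inferInstance]
      =ᵐ[M.condLaw x] fun q => M.g0 x q.2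

/-- `α₀` is the conditional Riesz representer in the space of functions `g(x, w) = h(w, ν(x))` with
`‖g‖_x < ∞`: for these, `E[m(Z; g) | X = x] = E[α₀(x, W) g(x, W) | X = x]`. -/
def IsRiesz : Prop :=
  ∀ x, ∀ ν : Cube d → EuclideanSpace ℝ (Fin p), Measurable ν → M.MemG x (M.ofParam ν) →
    Integrable (fun q => M.moment (x, q) (M.ofParam ν)) (M.condLaw x) ∧
    M.condMean (fun z => M.moment z (M.ofParam ν)) x =
      M.condMean (fun z => M.a0 z.feat z.extra * M.ofParam ν z.feat z.extra) x

/-- Boundedness of the debiased moment. -/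
def BoundedMoment (psiMax : ℝ) : Prop :=
  ∀ g ∈ M.admissible, ∀ a ∈ M.admissible, ∀ x, ∀ᵐ q ∂(M.condLaw x), |M.psi a g (x, q)| ≤ psiMax

/-- `x ↦ E[ψ(Z; α, g) | X = x]` is `L`-Lipschitz, uniformly over the admissible functions. -/
def SmoothMoment (L : ℝ≥0) : Prop :=
  ∀ g ∈ M.admissible, ∀ a ∈ M.admissible, LipschitzWith L (M.condMean (M.psi a g))

/-- Local mean-squared continuity. -/
def MeanSquareContinuous (L : ℝ≥0) : Prop :=
  ∀ g ∈ M.admissible, ∀ a ∈ M.admissible, ∀ x,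
    M.condMean (fun z => (M.psi a g z - M.psi M.a0 M.g0 z) ^ 2) x ≤
      L * M.condMean (fun z => (g z.feat z.extra - M.g0 z.feat z.extra) ^ 2
        + (a z.feat z.extra - M.a0 z.feat z.extra) ^ 2) x

end Model

/-! ### Sub-sampled kernels -/

/-- A size-`s` subset of the indices `1, …, n`. -/
def Subsample (n s : ℕ) : Type := {S : Finset (Fin n) // S.card = s}

namespace Subsample

variable {n s : ℕ}

instance : MeasurableSpace (Subsample n s) := ⊤

/-- The increasing enumeration of the subset. -/
def enum (S : Subsample n s) : Fin s ↪o Fin n := S.1.orderEmbOfFin S.2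

end Subsample

/-- A base kernel (at a given target point) on sub-samples of size `s`: for data `z` and internal
randomness `ξ`, the weight of the `j`-th point of the sub-sample is `weight z ξ j`. The weights are
nonnegative and sum to one. The kernel depends on the sub-sample as an unordered set, in the sense
that relabelling the data relabels the weights without changing their distribution. -/
structure BaseKernel (𝒵 Ξ : Type*) [MeasurableSpace 𝒵] [MeasurableSpace Ξ] (s : ℕ) where
  /-- law of the internal randomness -/
  law : Measure Ξ
  isProb : IsProbabilityMeasure law
  /-- the weights -/
  weight : (Fin s → 𝒵) → Ξ → Fin s → ℝ
  measurable_weight : Measurable fun ω : (Fin s → 𝒵) × Ξ => weight ω.1 ω.2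
  nonneg : ∀ z ξ j, 0 ≤ weight z ξ j
  sum_eq_one : ∀ z ξ, ∑ j, weight z ξ j = 1
  symmetric : ∀ (σ : Equiv.Perm (Fin s)) (z : Fin s → 𝒵),
    law.map (fun ξ j => weight (z ∘ σ) ξ j) = law.map (fun ξ j => weight z ξ (σ j))

attribute [instance] BaseKernel.isProb

namespace BaseKernel

variable {𝒵 Ξ : Type*} [MeasurableSpace 𝒵] [MeasurableSpace Ξ] {s : ℕ} (K : BaseKernel 𝒵 Ξ s)

/-- The joint law of `s` i.i.d. observations and the internal randomness of the kernel. -/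
def jointLaw (P : Measure 𝒵) : Measure ((Fin s → 𝒵) × Ξ) :=
  (Measure.pi fun _ => P).prod K.law

instance (P : Measure 𝒵) [IsProbabilityMeasure P] : IsProbabilityMeasure (K.jointLaw P) := by
  unfold jointLaw; infer_instance

/-- `η(s) = Var(E[∑_{i ≤ s} K̃_i f(Z_i) | Z_1])` for the sub-sample of the first `s`
observations. -/
def eta [NeZero s] (P : Measure 𝒵) (f : 𝒵 → ℝ) : ℝ :=
  Var[(K.jointLaw P)[fun ω => ∑ j, K.weight ω.1 ω.2 j * f (ω.1 j) |
    MeasurableSpace.comap (fun ω : (Fin s → 𝒵) × Ξ => ω.1 0) inferInstance]; K.jointLaw P]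

/-- The weight `K̃(x, X_i, Z_S, ξ)` of the `i`-th of `n` observations for the sub-sample `S`; it is
zero for `i ∉ S`. -/
def subWeight {n : ℕ} (z : Fin n → 𝒵) (S : Subsample n s) (ξ : Ξ) (i : Fin n) : ℝ :=
  ∑ j : Fin s, if S.enum j = i then K.weight (z ∘ S.enum) ξ j else 0

/-- The sub-sampled kernel `K(x, X_i, Z_{1:n}, ξ) = B⁻¹ ∑_b K̃(x, X_i, Z_{S_b}, ξ_b)`. -/
def avgWeight {n B : ℕ} (z : Fin n → 𝒵) (u : Fin B → Subsample n s × Ξ) (i : Fin n) : ℝ :=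
  (1 / (B : ℝ)) * ∑ b, K.subWeight z (u b).1 (u b).2 i

variable {d p : ℕ} {W : Type*} [MeasurableSpace W] (K : BaseKernel (Obs d W) Ξ s)

/-- Kernel shrinkage: `E[max {‖X_i - x‖ : K̃_i > 0}] ≤ e`. -/
def Shrinks (P : Measure (Obs d W)) (x : Cube d) (e : ℝ) : Prop :=
  ∫ ω, (⨆ j : Fin s, if 0 < K.weight ω.1 ω.2 j then dist (ω.1 j).feat x else 0) ∂(K.jointLaw P) ≤ e

/-- What is conditioned on in the honesty condition for the `j`-th point of the sub-sample: its
features, and all other observations of the sub-sample. -/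
def honestyInfo (j : Fin s) (ω : (Fin s → Obs d W) × Ξ) :
    Cube d × ({i : Fin s // i ≠ j} → Obs d W) :=
  ((ω.1 j).feat, fun i => ω.1 i)

theorem measurable_honestyInfo (j : Fin s) :
    Measurable (honestyInfo (Ξ := Ξ) (d := d) (W := W) j) := by
  unfold honestyInfo Obs.feat
  fun_prop

/-- Honesty for the (fixed) nuisance functions `a`, `g`: the weight of a point is independent of its
debiased moments `ψ(Z_i; a, g)` and `ψ(Z_i; α₀, g₀)`, given its features and the other points. -/
def Honest [StandardBorelSpace W] [StandardBorelSpace Ξ] (M : Model d p W)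
    (a g : Cube d → W → ℝ) : Prop :=
  ∀ j : Fin s, CondIndepFun
    (MeasurableSpace.comap (honestyInfo (Ξ := Ξ) (d := d) (W := W) j) inferInstance)
    (measurable_honestyInfo j).comap_le
    (fun ω : (Fin s → Obs d W) × Ξ => K.weight ω.1 ω.2 j)
    (fun ω : (Fin s → Obs d W) × Ξ => (M.psi a g (ω.1 j), M.psi M.a0 M.g0 (ω.1 j)))
    (K.jointLaw M.obsLaw)

end BaseKernel

/-! ### Nuisance estimators -/

/-- Estimators of `ν_g` and `ν_α`: functions of `n` observations and some auxiliary randomness. -/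
structure NuisanceEstimator (d p : ℕ) (W A : Type*) [MeasurableSpace W] [MeasurableSpace A]
    (n : ℕ) where
  /-- law of the auxiliary randomness -/
  law : Measure A
  isProb : IsProbabilityMeasure law
  /-- `ν̂_g` -/
  nuG : (Fin n → Obs d W) × A → Cube d → EuclideanSpace ℝ (Fin p)
  /-- `ν̂_α` -/
  nuA : (Fin n → Obs d W) × A → Cube d → EuclideanSpace ℝ (Fin p)
  measurable_nuG : Measurable (Function.uncurry nuG)
  measurable_nuA : Measurable (Function.uncurry nuA)

attribute [instance] NuisanceEstimator.isProb

namespace NuisanceEstimator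

variable {d p : ℕ} {W A : Type*} [MeasurableSpace W] [MeasurableSpace A] {n : ℕ}
  (N : NuisanceEstimator d p W A n) (M : Model d p W)

/-- `ĝ(x, w) = h(w, ν̂_g(x))`. -/
def gHat (t : (Fin n → Obs d W) × A) : Cube d → W → ℝ := M.ofParam (N.nuG t)

/-- `α̂(x, w) = h(w, ν̂_α(x))`. -/
def aHat (t : (Fin n → Obs d W) × A) : Cube d → W → ℝ := M.ofParam (N.nuA t)

/-- The law of the input of the estimators. -/
def trainLaw : Measure ((Fin n → Obs d W) × A) := (Measure.pi fun _ => M.obsLaw).prod N.law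

/-- The estimated nuisance functions are admissible, and the moment at the estimated regression
function is a measurable function of the observation and of the training data. -/
structure Admissible : Prop where
  gHat_mem : ∀ᵐ t ∂(N.trainLaw M), N.gHat M t ∈ M.admissible
  aHat_mem : ∀ᵐ t ∂(N.trainLaw M), N.aHat M t ∈ M.admissible
  measurable_moment : Measurable fun q : Obs d W × ((Fin n → Obs d W) × A) =>
    M.moment q.1 (N.gHat M q.2)

/-- The estimation error `(‖ν̂_g(x) - ν_g(x)‖² + ‖ν̂_α(x) - ν_α(x)‖²)^{1/2}`. -/
def error (t : (Fin n → Obs d W) × A) (x : Cube d) : ℝ :=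
  √(‖N.nuG t x - M.nuG x‖ ^ 2 + ‖N.nuA t x - M.nuA x‖ ^ 2)

end NuisanceEstimator

/-! ### The estimator -/

section Estimator

variable {d p : ℕ} {W A Ξ : Type*} [MeasurableSpace W] [MeasurableSpace A] [MeasurableSpace Ξ]
  {n s : ℕ}

/-- What is drawn at sample size `n`: the first half of the data; the second half, with the
auxiliary randomness of the nuisance estimators; and `B` sub-samples with their internal
randomness. -/
abbrev Draw (d : ℕ) (W A Ξ : Type*) (n s B : ℕ) : Type _ :=
  (Fin n → Obs d W) × ((Fin n → Obs d W) × A) × (Fin B → Subsample n s × Ξ)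

/-- The law of a draw: all `2 n` observations are i.i.d., the sub-samples are independent and uniform
among the subsets of size `s`, and everything is independent. -/
def drawLaw (M : Model d p W) (N : NuisanceEstimator d p W A n) (K : BaseKernel (Obs d W) Ξ s)
    (B : ℕ) : Measure (Draw d W A Ξ n s B) :=
  (Measure.pi fun _ => M.obsLaw).prod
    ((N.trainLaw M).prod (Measure.pi fun _ => (uniformOn Set.univ).prod K.law))

/-- The doubly robust estimator `θ̂(x) = ∑_i K(x, X_i, Z_{1:n}, ξ) ψ(Z_i; α̂, ĝ)`. -/
def thetaHat (M : Model d p W) (N : NuisanceEstimator d p W A n) (K : BaseKernel (Obs d W) Ξ s)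
    {B : ℕ} (D : Draw d W A Ξ n s B) : ℝ :=
  ∑ i, K.avgWeight D.1 D.2.2 i * M.psi (N.aHat M D.2.1) (N.gHat M D.2.1) (D.1 i)

end Estimator

end DoublyRobust

end

open DoublyRobust

/-! Write κ = √(n/(s²η)). The average of the weighted statistic over all subsets of size s
(`fullStat`) is a U-statistic of order s. Its projection on sums of functions of one observation is
the mean plus `leadingTerm`, that is, (s/n) ∑ (φ(Z_i) - E φ(Z_1)) with φ = `firstProj` and Var φ = η
(`eta_eq_variance`). Since κ s/n = (nη)^{-1/2}, the rescaled leading term is a standardized sum of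
i.i.d. variables bounded by `psiMax`. The variance nη of the sum before standardization tends to
infinity, so characteristic functions give the normal limit
(`tendsto_integral_exp_standardized_sum`). It remains to see that everything else is negligible in
L¹ at scale κ (`integral_abs_thetaHat_sub_le`).

Projection and resampling. In the orthogonal (Hoeffding) decomposition, a component of order at
least two sees only the subsets containing some given pair, a proportion at most (s/n)². So the
projection error is at most (s/n)² `psiMax`² in mean square, and finitely many sub-samples add a
term of order 1/B ≤ (s/n)². At scale κ both are O((nη)^{-1/2}).

Kernel bias. Honesty allows ψ to be replaced by its conditional mean given the features
(`integral_stat_of_honest`). This mean is Lipschitz, so shrinkage bounds the bias by L ε(s), and κ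
ε(s) → 0.

Nuisance bias. Given the second half of the data, the regression and Riesz identities collapse the
conditional mean of ψ(Z; α̂, ĝ) - ψ(Z; α₀, g₀) to -E[(ĝ - g₀)(α̂ - α₀) | X]. By the Lipschitz
property of h this is of second order in the parameter error (`abs_condMean_psi_sub_le`). The rate
is only pointwise in the features: at each of the s points of a sub-sample it fails with probability
at most δ_n/n, and the trivial bound used there costs a multiple of s δ_n/n ≤ δ_n in total.

Nuisance fluctuation. Each observation lies in a proportion s/n of the subsets, so the variance
given the second half is at most s/n times a second moment of order r² + δ_n. At scale κ this
becomes (κ s/n) · κ(r² + δ_n) → 0. -/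

noncomputable section

namespace DoublyRobust

/-! ### Orthogonal decompositions along commuting projections -/

section Hoeffding

open scoped IsMulCommutative

variable {ι V : Type*} [Fintype ι] [DecidableEq ι] [AddCommGroup V] [Module ℝ V]

/-- The components of the decomposition of a space along a finite family `e` of commuting
projections: `comp A` is the product of the `1 - e i` for `i ∈ A` and the `e i` for `i ∉ A`, and
`q i` is the product of the `e j` for `j ≠ i`. -/
structure HoeffdingComponents (e : ι → Module.End ℝ V) where
  /-- the components -/
  comp : Finset ι → Module.End ℝ V
  /-- the projection onto what depends on one index only -/
  q : ι → Module.End ℝ V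
  sum_comp : ∑ A, comp A = 1
  comp_mul_comp : ∀ A A', A ≠ A' → comp A * comp A' = 0
  comp_mem : ∀ A, comp A ∈ Algebra.adjoin ℝ (Set.range e)
  comp_apply_eq_zero : ∀ A i v, i ∈ A → e i v = v → comp A v = 0
  comp_empty_mem : comp ∅ ∈ Submonoid.closure (Set.range e)
  mul_comp_empty : ∀ i, e i * comp ∅ = comp ∅
  comp_singleton : ∀ i, comp {i} = q i - comp ∅
  q_mem : ∀ i, q i ∈ Submonoid.closure (e '' {j | j ≠ i})
  mul_q : ∀ i j, j ≠ i → e j * q i = q i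

/-- The `e i` generate a commutative subalgebra, in which products over finite sets make sense.
There (1 - e i) e i = 0 gives orthogonality, and expanding the product of the sums (1 - e i) + e i =
1 gives the resolution of the identity. -/
theorem nonempty_hoeffdingComponents (e : ι → Module.End ℝ V)
    (hcomm : ∀ i j, e i * e j = e j * e i) (hidem : ∀ i, e i * e i = e i) :
    Nonempty (HoeffdingComponents e) := by
  have hc : ∀ a ∈ Set.range e, ∀ b ∈ Set.range e, a * b = b * a := by
    rintro _ ⟨i, rfl⟩ _ ⟨j, rfl⟩
    exact hcomm i j
  have : IsMulCommutative (Algebra.adjoin ℝ (Set.range e)) := Algebra.isMulCommutative_adjoin ℝ hc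
  let φ : Algebra.adjoin ℝ (Set.range e) →+* Module.End ℝ V :=
    (Algebra.adjoin ℝ (Set.range e)).val.toRingHom
  let e' : ι → Algebra.adjoin ℝ (Set.range e) := fun i =>
    ⟨e i, Algebra.subset_adjoin ⟨i, rfl⟩⟩
  have hφe : ∀ i, φ (e' i) = e i := fun i => rfl
  have hid : ∀ i, e' i * e' i = e' i := fun i => Subtype.ext (hidem i)
  have hz : ∀ i, (1 - e' i) * e' i = 0 := fun i => by rw [sub_mul, one_mul, hid, sub_self]
  let c : Finset ι → Algebra.adjoin ℝ (Set.range e) := fun A =>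
    (∏ i ∈ A, (1 - e' i)) * ∏ i ∈ Aᶜ, e' i
  have hl : ∀ A i, i ∈ A → ∃ x, c A = x * (1 - e' i) := fun A i hi =>
    ⟨(∏ k ∈ A.erase i, (1 - e' k)) * ∏ k ∈ Aᶜ, e' k, by
      simp only [c]; rw [← Finset.prod_erase_mul A _ hi]; ring⟩
  have hr : ∀ A i, i ∉ A → ∃ x, c A = x * e' i := fun A i hi =>
    ⟨(∏ k ∈ A, (1 - e' k)) * ∏ k ∈ Aᶜ.erase i, e' k, by
      simp only [c]
      rw [← Finset.prod_erase_mul Aᶜ _ (Finset.mem_compl.2 hi)]; ring⟩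
  -- An index in exactly one of the two sets contributes the factor (1 - e i) e i = 0.
  have h0 : ∀ A A' i, i ∈ A → i ∉ A' → c A * c A' = 0 := by
    intro A A' i h1 h2
    obtain ⟨x, hx⟩ := hl A i h1
    obtain ⟨y, hy⟩ := hr A' i h2
    rw [hx, hy, show x * (1 - e' i) * (y * e' i) = x * y * ((1 - e' i) * e' i) by ring, hz,
      mul_zero]
  have hce : c ∅ = ∏ i, e' i := by simp [c]
  have habs : ∀ (s : Finset ι) i, i ∈ s → e' i * ∏ k ∈ s, e' k = ∏ k ∈ s, e' k := by
    intro s i hi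
    rw [← Finset.mul_prod_erase s _ hi, ← mul_assoc, hid]
  have hclos : ∀ (s : Finset ι) (T : Set ι), (∀ i ∈ s, i ∈ T) →
      φ (∏ k ∈ s, e' k) ∈ Submonoid.closure (e '' T) := by
    intro s T hs
    have : ∏ k ∈ s, e' k ∈ (Submonoid.closure (e '' T)).comap φ.toMonoidHom :=
      Submonoid.prod_mem _ fun i hi => Submonoid.subset_closure ⟨i, hs i hi, rfl⟩
    exact this
  refine ⟨⟨fun A => φ (c A), fun i => φ (∏ k ∈ Finset.univ.erase i, e' k), ?_, ?_, ?_, ?_, ?_, ?_,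
    ?_, ?_, ?_⟩⟩
  · rw [← map_sum, ← map_one φ]
    congr 1
    simp only [c]
    rw [← Fintype.prod_add]
    simp
  · intro A A' hne
    rw [← map_mul]
    have : ∃ i, (i ∈ A ∧ i ∉ A') ∨ (i ∈ A' ∧ i ∉ A) := by
      by_contra! h
      exact hne (Finset.ext fun i => ⟨(h i).1, (h i).2⟩)
    obtain ⟨i, h | h⟩ := this
    · rw [h0 A A' i h.1 h.2, map_zero]
    · rw [mul_comm, h0 A' A i h.1 h.2, map_zero]
  · exact fun A => (c A).2
  · intro A i v hi hv
    obtain ⟨x, hx⟩ := hl A i hi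
    rw [hx, map_mul, map_sub, map_one, hφe]
    simp [hv]
  · rw [hce]
    simpa using hclos Finset.univ Set.univ (by simp)
  · intro i
    rw [← hφe, ← map_mul, hce, habs _ _ (Finset.mem_univ i)]
  · intro i
    rw [← map_sub, hce, ← Finset.mul_prod_erase Finset.univ _ (Finset.mem_univ i)]
    congr 1
    simp only [c, Finset.prod_singleton]
    rw [show ({i} : Finset ι)ᶜ = Finset.univ.erase i by ext; simp]
    ring
  · exact fun i => hclos _ _ (by simp)
  · intro i j hj
    rw [← hφe, ← map_mul, habs _ _ (by simpa using hj)]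

variable {e : ι → Module.End ℝ V} (H : HoeffdingComponents e) (b : LinearMap.BilinForm ℝ V)

/-- Polynomials in commuting self-adjoint operators are self-adjoint, so one component moves across
the form and meets the other in a zero product. -/
theorem HoeffdingComponents.apply_comp_comp (hcomm : ∀ i j, e i * e j = e j * e i)
    (hself : ∀ i u v, b (e i u) v = b u (e i v)) {A A' : Finset ι} (h : A ≠ A') (u v : V) :
    b (H.comp A u) (H.comp A' v) = 0 := by
  have hc : ∀ a ∈ Set.range e, ∀ b ∈ Set.range e, a * b = b * a := by
    rintro _ ⟨i, rfl⟩ _ ⟨j, rfl⟩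
    exact hcomm i j
  have key : ∀ x ∈ Algebra.adjoin ℝ (Set.range e), ∀ u v, b (x u) v = b u (x v) := by
    intro x hx
    induction hx using Algebra.adjoin_induction with
    | mem x hx => obtain ⟨i, rfl⟩ := hx; exact hself i
    | algebraMap r => intro u v; simp [Module.algebraMap_end_apply]
    | add x y _ _ h1 h2 => intro u v; simp [h1, h2]
    | mul x y hx hy h1 h2 =>
      intro u v
      have : IsMulCommutative (Algebra.adjoin ℝ (Set.range e)) :=
        Algebra.isMulCommutative_adjoin ℝ hc
      have hxy : x * y = y * x :=
        congrArg Subtype.val (mul_comm (⟨x, hx⟩ : Algebra.adjoin ℝ (Set.range e)) ⟨y, hy⟩)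
      calc b ((x * y) u) v = b u ((y * x) v) := by simp [h1, h2]
        _ = b u ((x * y) v) := by rw [hxy]
  rw [key _ (H.comp_mem A), ← Module.End.mul_apply, H.comp_mul_comp _ _ h]
  simp

theorem HoeffdingComponents.apply_sum_comp (hcomm : ∀ i j, e i * e j = e j * e i)
    (hself : ∀ i u v, b (e i u) v = b u (e i v)) (T : Finset (Finset ι)) (u : V) :
    b (∑ A ∈ T, H.comp A u) (∑ A ∈ T, H.comp A u) = ∑ A ∈ T, b (H.comp A u) (H.comp A u) := by
  simp only [map_sum, LinearMap.sum_apply]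
  refine Finset.sum_congr rfl fun A hA => ?_
  rw [Finset.sum_eq_single A]
  · exact fun A' _ hne => H.apply_comp_comp b hcomm hself hne u u
  · exact fun h => (h hA).elim

/-- If each `v S` depends only on the coordinates in `S`, and a set `A ∈ T` lies in a proportion at
most `p` of the sets `S`, then the components in `T` of the average of the `v S` have size at most
`p` times the average size of the `v S`. -/
theorem HoeffdingComponents.apply_sum_comp_average_le (hcomm : ∀ i j, e i * e j = e j * e i)
    (hself : ∀ i u v, b (e i u) v = b u (e i v)) (hpos : ∀ u, 0 ≤ b u u)
    {σ : Type*} [Fintype σ] (supp : σ → Finset ι) (v : σ → V)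
    (hv : ∀ S i, i ∉ supp S → e i (v S) = v S) (T : Finset (Finset ι)) {p : ℝ}
    (hp : ∀ A ∈ T, (((Finset.univ : Finset σ).filter fun S => A ⊆ supp S).card : ℝ) ≤
      p * Fintype.card σ) (hp0 : 0 ≤ p)
    (hsymm : ∀ u v, b u v = b v u) :
    b (∑ A ∈ T, H.comp A ((Fintype.card σ : ℝ)⁻¹ • ∑ S, v S))
      (∑ A ∈ T, H.comp A ((Fintype.card σ : ℝ)⁻¹ • ∑ S, v S)) ≤
      p * ((Fintype.card σ : ℝ)⁻¹ * ∑ S, b (v S) (v S)) := by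
  set N : ℝ := (Fintype.card σ : ℝ) with hN
  have hN0 : 0 ≤ N := by positivity
  -- Cauchy–Schwarz for a positive form, from b(x, y) ≤ (b(x, x) + b(y, y))/2.
  have hcs : ∀ (F : Finset σ) (u : σ → V),
      b (∑ S ∈ F, u S) (∑ S ∈ F, u S) ≤ F.card * ∑ S ∈ F, b (u S) (u S) := by
    intro F u
    have h2 : ∀ x y, b x y ≤ (b x x + b y y) / 2 := by
      intro x y
      have := hpos (x - y)
      simp only [map_sub, LinearMap.sub_apply] at this
      have h3 := hsymm x y
      linarith
    calc b (∑ S ∈ F, u S) (∑ S ∈ F, u S) = ∑ S ∈ F, ∑ S' ∈ F, b (u S) (u S') := by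
          simp only [map_sum, LinearMap.sum_apply]
          rw [Finset.sum_comm]
      _ ≤ ∑ S ∈ F, ∑ S' ∈ F, (b (u S) (u S) + b (u S') (u S')) / 2 :=
          Finset.sum_le_sum fun S _ => Finset.sum_le_sum fun S' _ => h2 _ _
      _ = F.card * ∑ S ∈ F, b (u S) (u S) := by
          simp only [add_div, Finset.sum_add_distrib, Finset.sum_const, nsmul_eq_mul,
            ← Finset.mul_sum, ← Finset.sum_div]
          ring
  have hone : ∀ A ∈ T, b (H.comp A (N⁻¹ • ∑ S, v S)) (H.comp A (N⁻¹ • ∑ S, v S)) ≤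
      p * (N⁻¹ * ∑ S, b (H.comp A (v S)) (H.comp A (v S))) := by
    intro A hA
    -- Component `A` annihilates every `v S` that ignores some coordinate of `A`. At most p N terms
    -- survive, and with the prefactor N⁻² Cauchy–Schwarz leaves p N⁻¹.
    have h1 : H.comp A (∑ S, v S) =
        ∑ S ∈ (Finset.univ : Finset σ).filter fun S => A ⊆ supp S, H.comp A (v S) := by
      rw [map_sum, Finset.sum_filter]
      refine Finset.sum_congr rfl fun S _ => ?_
      split_ifs with h
      · rfl
      · obtain ⟨i, hi, hi'⟩ := Finset.not_subset.1 h
        exact H.comp_apply_eq_zero A i _ hi (hv S i hi')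
    have h2 : ∑ S ∈ (Finset.univ : Finset σ).filter fun S => A ⊆ supp S,
        b (H.comp A (v S)) (H.comp A (v S)) ≤ ∑ S, b (H.comp A (v S)) (H.comp A (v S)) :=
      Finset.sum_le_sum_of_subset_of_nonneg (Finset.filter_subset _ _) fun _ _ _ => hpos _
    have h3 : 0 ≤ ∑ S, b (H.comp A (v S)) (H.comp A (v S)) :=
      Finset.sum_nonneg fun _ _ => hpos _
    have h4 := hcs ((Finset.univ : Finset σ).filter fun S => A ⊆ supp S) fun S => H.comp A (v S)
    rw [map_smul, h1]
    simp only [map_smul, LinearMap.smul_apply, smul_eq_mul]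
    -- For an empty family the average carries the factor 0⁻¹ = 0 and both sides vanish.
    rcases hN0.eq_or_lt with hz | hz
    · simp [← hz]
    calc _ ≤ N⁻¹ * (N⁻¹ * ((p * N) * ∑ S, b (H.comp A (v S)) (H.comp A (v S)))) := by
          gcongr
          exact h4.trans (mul_le_mul (hp A hA) h2 (Finset.sum_nonneg fun _ _ => hpos _)
            (by positivity))
      _ = _ := by field_simp
  rw [H.apply_sum_comp b hcomm hself]
  calc _ ≤ ∑ A ∈ T, p * (N⁻¹ * ∑ S, b (H.comp A (v S)) (H.comp A (v S))) :=
        Finset.sum_le_sum hone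
    _ = p * (N⁻¹ * ∑ S, ∑ A ∈ T, b (H.comp A (v S)) (H.comp A (v S))) := by
        rw [← Finset.mul_sum, ← Finset.mul_sum, Finset.sum_comm]
    _ ≤ p * (N⁻¹ * ∑ S, b (v S) (v S)) := by
        gcongr with S _
        -- Bessel: a partial sum over components is at most the full sum, which is b(v S, v S) by
        -- orthogonality and the resolution of the identity.
        calc _ ≤ ∑ A, b (H.comp A (v S)) (H.comp A (v S)) :=
              Finset.sum_le_sum_of_subset_of_nonneg (Finset.subset_univ _) fun _ _ _ => hpos _
          _ = b (v S) (v S) := by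
              rw [← H.apply_sum_comp b hcomm hself, ← LinearMap.sum_apply, H.sum_comp]
              simp

end Hoeffding

/-! ### Projections of bounded functions of independent variables -/

section IntegrateOut

open Function

/-- Bounded measurable functions. -/
def bddMeas (α : Type*) [MeasurableSpace α] : Submodule ℝ (α → ℝ) where
  carrier := {f | Measurable f ∧ ∃ C, ∀ a, |f a| ≤ C}
  add_mem' := by
    rintro f g ⟨hf, C, hC⟩ ⟨hg, D, hD⟩
    exact ⟨hf.add hg, C + D, fun a => (abs_add_le _ _).trans (add_le_add (hC a) (hD a))⟩
  zero_mem' := ⟨measurable_const, 0, by simp⟩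
  smul_mem' := by
    rintro c f ⟨hf, C, hC⟩
    refine ⟨hf.const_smul c, |c| * C, fun a => ?_⟩
    rw [Pi.smul_apply, smul_eq_mul, abs_mul]
    exact mul_le_mul_of_nonneg_left (hC a) (abs_nonneg c)

theorem integrable_of_abs_le {α : Type*} [MeasurableSpace α] {μ : Measure α} [IsFiniteMeasure μ]
    {f : α → ℝ} (hf : Measurable f) {C : ℝ} (hC : ∀ a, |f a| ≤ C) : Integrable f μ :=
  Integrable.of_bound hf.aestronglyMeasurable C (ae_of_all _ fun a => hC a)

theorem abs_integral_le_of_abs_le {α : Type*} [MeasurableSpace α] {μ : Measure α}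
    [IsProbabilityMeasure μ] {f : α → ℝ} {C : ℝ} (hC : ∀ a, |f a| ≤ C) : |∫ a, f a ∂μ| ≤ C := by
  simpa using norm_integral_le_of_norm_le_const (μ := μ) (f := f) (ae_of_all μ fun a => hC a)

variable {α : Type*} [MeasurableSpace α]

theorem bddMeas.integrable {μ : Measure α} [IsFiniteMeasure μ] (f : bddMeas α) :
    Integrable f.1 μ := by
  obtain ⟨hf, C, hC⟩ := f.2
  exact integrable_of_abs_le hf hC

theorem bddMeas.integrable_mul {μ : Measure α} [IsFiniteMeasure μ] (f g : bddMeas α) :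
    Integrable (fun a => f.1 a * g.1 a) μ := by
  obtain ⟨hf, C, hC⟩ := f.2
  obtain ⟨hg, D, hD⟩ := g.2
  refine integrable_of_abs_le (hf.mul hg) (C := C * D) fun a => ?_
  rw [abs_mul]
  exact mul_le_mul (hC a) (hD a) (abs_nonneg _) ((abs_nonneg _).trans (hC a))

variable {ι 𝒵 : Type*} [Fintype ι] [DecidableEq ι] [MeasurableSpace 𝒵]
  (P : Measure 𝒵) [IsProbabilityMeasure P]

theorem measurable_update_prod (i : ι) :
    Measurable fun q : (ι → 𝒵) × 𝒵 => update q.1 i q.2 :=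
  measurable_update'

/-- Resampling one of several i.i.d. variables does not change their joint law. -/
theorem measurePreserving_update (i : ι) :
    MeasurePreserving (fun q : (ι → 𝒵) × 𝒵 => update q.1 i q.2)
      ((Measure.pi fun _ => P).prod P) (Measure.pi fun _ => P) := by
  refine ⟨measurable_update_prod i, Eq.symm (Measure.pi_eq fun s hs => ?_)⟩
  rw [Measure.map_apply (measurable_update_prod i) (MeasurableSet.univ_pi hs)]
  -- On boxes: the old coordinate `i` becomes unconstrained and the fresh variable takes over its
  -- side.
  have : (fun q : (ι → 𝒵) × 𝒵 => update q.1 i q.2) ⁻¹' (Set.univ.pi s) =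
      (Set.univ.pi (update s i Set.univ)) ×ˢ s i := by
    ext q
    simp only [Set.mem_preimage, Set.mem_pi, Set.mem_univ, true_implies, Set.mem_prod]
    constructor
    · intro h
      refine ⟨fun k => ?_, by simpa using h i⟩
      by_cases hk : k = i
      · subst hk; simp
      · simpa [hk] using h k
    · rintro ⟨h1, h2⟩ k
      by_cases hk : k = i
      · subst hk; simpa using h2
      · simpa [hk] using h1 k
  rw [this, Measure.prod_prod, Measure.pi_pi, ← Finset.mul_prod_erase _ _ (Finset.mem_univ i),
    ← Finset.mul_prod_erase _ (fun i => P (s i)) (Finset.mem_univ i), mul_comm]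
  simp only [update_self, measure_univ, one_mul]
  congr 1
  refine Finset.prod_congr rfl fun k hk => ?_
  rw [update_of_ne (Finset.ne_of_mem_erase hk)]

theorem integral_update {f : (ι → 𝒵) → ℝ} (hf : Integrable f (Measure.pi fun _ => P)) (i : ι) :
    ∫ z, ∫ a, f (update z i a) ∂P ∂(Measure.pi fun _ => P) = ∫ z, f z ∂(Measure.pi fun _ => P) := by
  have h := measurePreserving_update P i
  calc _ = ∫ q, f (update q.1 i q.2) ∂((Measure.pi fun _ => P).prod P) :=
        (integral_prod _ (h.integrable_comp_of_integrable hf)).symm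
    _ = _ := by
        rw [← integral_map h.measurable.aemeasurable (by rw [h.map_eq]; exact hf.1), h.map_eq]

/-- Integrating out one coordinate. -/
def integrateOut (i : ι) : Module.End ℝ (bddMeas (ι → 𝒵)) where
  toFun f := ⟨fun z => ∫ a, f.1 (update z i a) ∂P, by
    obtain ⟨hf, C, hC⟩ := f.2
    refine ⟨?_, C, fun z => abs_integral_le_of_abs_le fun a => hC _⟩
    exact (StronglyMeasurable.integral_prod_right (f := fun z a => f.1 (update z i a))
      (hf.comp (measurable_update_prod i)).stronglyMeasurable).measurable⟩
  map_add' f g := by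
    obtain ⟨hf, C, hC⟩ := f.2
    obtain ⟨hg, D, hD⟩ := g.2
    refine Subtype.ext (funext fun z => ?_)
    exact integral_add (integrable_of_abs_le (hf.comp (measurable_update z)) fun a => hC _)
      (integrable_of_abs_le (hg.comp (measurable_update z)) fun a => hD _)
  map_smul' c f := Subtype.ext (funext fun z => integral_const_mul c _)

theorem integrateOut_apply (i : ι) (f : bddMeas (ι → 𝒵)) (z : ι → 𝒵) :
    (integrateOut P i f).1 z = ∫ a, f.1 (update z i a) ∂P := rfl

theorem integrateOut_update (i : ι) (f : bddMeas (ι → 𝒵)) (z : ι → 𝒵) (a : 𝒵) :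
    (integrateOut P i f).1 (update z i a) = (integrateOut P i f).1 z := by
  simp [integrateOut_apply]

theorem integrateOut_eq_self (i : ι) (f : bddMeas (ι → 𝒵))
    (h : ∀ z a, f.1 (update z i a) = f.1 z) : integrateOut P i f = f :=
  Subtype.ext (funext fun z => by simp [integrateOut_apply, h])

theorem integrateOut_idem (i : ι) :
    integrateOut P i * integrateOut P i = integrateOut (ι := ι) P i :=
  LinearMap.ext fun f => integrateOut_eq_self P i _ (integrateOut_update P i f)

theorem integrateOut_comm (i j : ι) :
    integrateOut P i * integrateOut P j = integrateOut P j * integrateOut (ι := ι) P i := by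
  by_cases hij : i = j
  · rw [hij]
  refine LinearMap.ext fun f => Subtype.ext (funext fun z => ?_)
  obtain ⟨hf, C, hC⟩ := f.2
  simp only [Module.End.mul_apply, integrateOut_apply]
  rw [integral_integral_swap]
  · simp_rw [update_comm hij]
  · refine integrable_of_abs_le (C := C) ?_ fun a => hC _
    exact hf.comp ((measurable_update_prod j).comp
      (((measurable_update z).comp measurable_fst).prodMk measurable_snd))

theorem integral_integrateOut (i : ι) (f : bddMeas (ι → 𝒵)) :
    ∫ z, (integrateOut P i f).1 z ∂(Measure.pi fun _ => P) = ∫ z, f.1 z ∂(Measure.pi fun _ => P) :=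
  integral_update P (bddMeas.integrable f) i

/-- The `L²` inner product of bounded functions. -/
def innerForm (μ : Measure α) [IsFiniteMeasure μ] : LinearMap.BilinForm ℝ (bddMeas α) :=
  LinearMap.mk₂ ℝ (fun f g => ∫ a, f.1 a * g.1 a ∂μ)
    (fun f f' g => by
      rw [← integral_add (bddMeas.integrable_mul f g) (bddMeas.integrable_mul f' g)]
      exact integral_congr_ae (ae_of_all _ fun a => add_mul _ _ _))
    (fun c f g => by
      rw [smul_eq_mul, ← integral_const_mul]
      exact integral_congr_ae (ae_of_all _ fun a => mul_assoc _ _ _))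
    (fun f g g' => by
      rw [← integral_add (bddMeas.integrable_mul f g) (bddMeas.integrable_mul f g')]
      exact integral_congr_ae (ae_of_all _ fun a => mul_add _ _ _))
    (fun c f g => by
      rw [smul_eq_mul, ← integral_const_mul]
      exact integral_congr_ae (ae_of_all _ fun a => mul_left_comm _ _ _))

theorem innerForm_apply (μ : Measure α) [IsFiniteMeasure μ] (f g : bddMeas α) :
    innerForm μ f g = ∫ a, f.1 a * g.1 a ∂μ := rfl

theorem innerForm_self_nonneg (μ : Measure α) [IsFiniteMeasure μ] (f : bddMeas α) :
    0 ≤ innerForm μ f f :=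
  integral_nonneg fun a => mul_self_nonneg (f.1 a)

theorem innerForm_symm (μ : Measure α) [IsFiniteMeasure μ] (f g : bddMeas α) :
    innerForm μ f g = innerForm μ g f := by
  simp only [innerForm_apply, mul_comm]

/-- Self-adjointness: `integrateOut P i f` is constant in coordinate `i`, so integrating that
coordinate out also averages `g`. Both sides thus equal the inner product of the two projections. -/
theorem innerForm_integrateOut (i : ι) (f g : bddMeas (ι → 𝒵)) :
    innerForm (Measure.pi fun _ => P) (integrateOut P i f) g =
      innerForm (Measure.pi fun _ => P) f (integrateOut P i g) := by
  have key : ∀ f g : bddMeas (ι → 𝒵), innerForm (Measure.pi fun _ => P) (integrateOut P i f) g =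
      ∫ z, (integrateOut P i f).1 z * (integrateOut P i g).1 z ∂(Measure.pi fun _ => P) := by
    intro f g
    rw [innerForm_apply, ← integral_update P (bddMeas.integrable_mul _ _) i]
    simp only [integrateOut_update]
    simp only [integral_const_mul, integrateOut_apply]
  rw [key, innerForm_symm, key]
  simp only [mul_comm]

/-- Passes from invariance under single updates to dependence on the coordinates outside `J` only,
by replacing the coordinates in `J` one at a time. -/
theorem eq_of_update_eq {β : Type*} {g : (ι → 𝒵) → β} (J : Finset ι) :
    ∀ (_ : ∀ j ∈ J, ∀ z a, g (update z j a) = g z) {z z' : ι → 𝒵}, (∀ k ∉ J, z k = z' k) →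
      g z = g z' := by
  induction J using Finset.induction_on with
  | empty => exact fun _ z z' h => congrArg g (funext fun k => h k (by simp))
  | insert j J hj ih =>
    intro hg z z' h
    rw [← hg j (by simp) z (z' j)]
    refine ih (fun k hk => hg k (by simp [hk])) fun k hk => ?_
    by_cases hkj : k = j
    · subst hkj; simp
    · rw [update_of_ne hkj]; exact h k (by simp [hkj, hk])

variable {P} (H : HoeffdingComponents (V := bddMeas (ι → 𝒵)) fun i => integrateOut P i)

/-- Any product of the projections preserves the integral, and the output of `comp ∅` is constant in
every coordinate. A constant equals its own mean. -/
theorem HoeffdingComponents.comp_empty_apply [Nonempty 𝒵] (f : bddMeas (ι → 𝒵)) (z : ι → 𝒵) :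
    (H.comp ∅ f).1 z = ∫ z, f.1 z ∂(Measure.pi fun _ => P) := by
  have h1 : ∫ z, (H.comp ∅ f).1 z ∂(Measure.pi fun _ => P) =
      ∫ z, f.1 z ∂(Measure.pi fun _ => P) := by
    have := H.comp_empty_mem
    generalize H.comp ∅ = x at this
    induction this using Submonoid.closure_induction generalizing f with
    | mem x hx => obtain ⟨i, rfl⟩ := hx; exact integral_integrateOut P i f
    | one => rfl
    | mul x y _ _ hx hy => rw [Module.End.mul_apply, hx, hy]
  have h2 : ∀ z', (H.comp ∅ f).1 z' = (H.comp ∅ f).1 z := fun z' =>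
    eq_of_update_eq Finset.univ (fun j _ w a => by
      rw [← H.mul_comp_empty j]; exact integrateOut_update P j _ w a) (by simp)
  rw [← h1]
  simp [h2]

/-- The argument for `comp ∅`, with coordinate `i` frozen: projections along the other coordinates
preserve the integral over them, and `q i f` depends on coordinate `i` alone. -/
theorem HoeffdingComponents.q_apply (f : bddMeas (ι → 𝒵)) (i : ι) (z : ι → 𝒵) :
    (H.q i f).1 z = ∫ z', f.1 (update z' i (z i)) ∂(Measure.pi fun _ => P) := by
  have hm : Measurable fun z' : ι → 𝒵 => update z' i (z i) :=
    (measurable_update_prod i).comp (measurable_id.prodMk measurable_const)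
  have h1 : ∫ z', (H.q i f).1 (update z' i (z i)) ∂(Measure.pi fun _ => P) =
      ∫ z', f.1 (update z' i (z i)) ∂(Measure.pi fun _ => P) := by
    have := H.q_mem i
    generalize H.q i = x at this
    induction this using Submonoid.closure_induction generalizing f with
    | mem x hx =>
      obtain ⟨j, hj, rfl⟩ := hx
      obtain ⟨hf, C, hC⟩ := f.2
      refine Eq.trans ?_ (integral_update P (f := fun z' => f.1 (update z' i (z i)))
        (integrable_of_abs_le (hf.comp hm) fun _ => hC _) j)
      simp only [integrateOut_apply, update_comm hj]
    | one => rfl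
    | mul x y _ _ hx hy => rw [Module.End.mul_apply, hx, hy]
  have h2 : ∀ z', (H.q i f).1 (update z' i (z i)) = (H.q i f).1 z := fun z' =>
    eq_of_update_eq (Finset.univ.erase i) (fun j hj w a => by
      rw [← H.mul_q i j (Finset.ne_of_mem_erase hj)]
      exact integrateOut_update P j _ w a) (by
        intro k hk
        have : k = i := by simpa using hk
        subst this; simp)
  rw [← h1]
  simp [h2]

/-- Variance bound for averages of functions of few variables: if each variable occurs in a
proportion at most `p` of the functions, the variance of the average is at most `p` times the mean
second moment of the functions. -/
theorem integral_average_sub_sq_le [Nonempty 𝒵] {σ : Type*} [Fintype σ] (supp : σ → Finset ι)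
    (v : σ → bddMeas (ι → 𝒵)) (hv : ∀ S, ∀ i ∉ supp S, ∀ z a, (v S).1 (update z i a) = (v S).1 z)
    {p : ℝ} (hp0 : 0 ≤ p)
    (hp : ∀ i, (((Finset.univ : Finset σ).filter fun S => i ∈ supp S).card : ℝ) ≤
      p * Fintype.card σ)
    (U : bddMeas (ι → 𝒵)) (hU : U = (Fintype.card σ : ℝ)⁻¹ • ∑ S, v S) :
    ∫ z, (U.1 z - ∫ z, U.1 z ∂(Measure.pi fun _ => P)) ^ 2 ∂(Measure.pi fun _ => P) ≤
      p * ((Fintype.card σ : ℝ)⁻¹ * ∑ S, ∫ z, (v S).1 z ^ 2 ∂(Measure.pi fun _ => P)) := by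
  obtain ⟨H⟩ := nonempty_hoeffdingComponents (V := bddMeas (ι → 𝒵)) (fun i => integrateOut P i)
    (integrateOut_comm P) (integrateOut_idem P)
  have h := H.apply_sum_comp_average_le (innerForm (Measure.pi fun _ => P)) (integrateOut_comm P)
    (innerForm_integrateOut P) (innerForm_self_nonneg _) supp v
    (fun S i hi => integrateOut_eq_self P i _ (hv S i hi)) (Finset.univ.erase ∅) (p := p)
    -- A nonempty `A` has an element `i`, and the sets containing `A` are among those containing
    -- `i`.
    (fun A hA => by
      obtain ⟨i, hi⟩ := Finset.nonempty_iff_ne_empty.2 (Finset.ne_of_mem_erase hA)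
      refine le_trans ?_ (hp i)
      gcongr with S
      exact fun hS => hS hi) hp0 (innerForm_symm _)
  rw [← hU] at h
  have h2 : ∑ A ∈ Finset.univ.erase ∅, H.comp A U = U - H.comp ∅ U := by
    rw [eq_sub_iff_add_eq, Finset.sum_erase_add _ _ (Finset.mem_univ _), ← LinearMap.sum_apply,
      H.sum_comp]
    rfl
  rw [h2] at h
  simp only [innerForm_apply, ← pow_two] at h
  refine le_trans (le_of_eq ?_) h
  refine integral_congr_ae (ae_of_all _ fun z => ?_)
  simp only [AddSubgroupClass.coe_sub, Pi.sub_apply]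
  rw [H.comp_empty_apply]

/-- If each pair of variables occurs in a proportion at most `p` of the functions, the average
differs from the projection on sums of functions of one variable by at most `p` times the mean
second moment of the functions, in mean square. -/
theorem integral_average_sub_projection_sq_le [Nonempty 𝒵] {σ : Type*} [Fintype σ]
    (supp : σ → Finset ι) (v : σ → bddMeas (ι → 𝒵))
    (hv : ∀ S, ∀ i ∉ supp S, ∀ z a, (v S).1 (update z i a) = (v S).1 z) {p : ℝ} (hp0 : 0 ≤ p)
    (hp : ∀ i j, i ≠ j → (((Finset.univ : Finset σ).filter fun S =>
      i ∈ supp S ∧ j ∈ supp S).card : ℝ) ≤ p * Fintype.card σ)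
    (U : bddMeas (ι → 𝒵)) (hU : U = (Fintype.card σ : ℝ)⁻¹ • ∑ S, v S) :
    ∫ z, (U.1 z - ∫ z, U.1 z ∂(Measure.pi fun _ => P) -
      ∑ i, (∫ z', U.1 (update z' i (z i)) ∂(Measure.pi fun _ => P) -
        ∫ z, U.1 z ∂(Measure.pi fun _ => P))) ^ 2 ∂(Measure.pi fun _ => P) ≤
      p * ((Fintype.card σ : ℝ)⁻¹ * ∑ S, ∫ z, (v S).1 z ^ 2 ∂(Measure.pi fun _ => P)) := by
  obtain ⟨H⟩ := nonempty_hoeffdingComponents (V := bddMeas (ι → 𝒵)) (fun i => integrateOut P i)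
    (integrateOut_comm P) (integrateOut_idem P)
  have h := H.apply_sum_comp_average_le (innerForm (Measure.pi fun _ => P)) (integrateOut_comm P)
    (innerForm_integrateOut P) (innerForm_self_nonneg _) supp v
    (fun S i hi => integrateOut_eq_self P i _ (hv S i hi))
    (Finset.univ.filter fun A => 1 < A.card) (p := p)
    (fun A hA => by
      obtain ⟨i, hi, j, hj, hij⟩ := Finset.one_lt_card.1 (Finset.mem_filter.1 hA).2
      refine le_trans ?_ (hp i j hij)
      gcongr with S
      exact fun hS => ⟨hS hi, hS hj⟩) hp0 (innerForm_symm _)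
  rw [← hU] at h
  -- The components of order zero and one are the mean and the centered one-variable projections.
  -- Removing them from the identity leaves the orders at least two.
  have h2 : ∑ A ∈ Finset.univ.filter (fun A : Finset ι => 1 < A.card), H.comp A U =
      U - H.comp ∅ U - ∑ i, (H.q i U - H.comp ∅ U) := by
    have h3 : ∑ A ∈ Finset.univ.filter (fun A : Finset ι => ¬ 1 < A.card), H.comp A U =
        H.comp ∅ U + ∑ i, (H.q i U - H.comp ∅ U) := by
      have : Finset.univ.filter (fun A : Finset ι => ¬ 1 < A.card) =
          insert ∅ (Finset.univ.map ⟨singleton, Finset.singleton_injective⟩) := by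
        ext A
        simp only [not_lt, Finset.mem_filter, Finset.mem_univ, true_and, Finset.mem_insert,
          Finset.mem_map, Embedding.coeFn_mk]
        rw [Nat.le_one_iff_eq_zero_or_eq_one, Finset.card_eq_zero, Finset.card_eq_one]
        simp only [eq_comm]
      rw [this, Finset.sum_insert (by simp), Finset.sum_map]
      simp only [Embedding.coeFn_mk, H.comp_singleton, LinearMap.sub_apply]
    rw [sub_sub, ← h3, eq_sub_iff_add_eq, Finset.sum_filter_add_sum_filter_not,
      ← LinearMap.sum_apply, H.sum_comp]
    rfl
  rw [h2] at h
  simp only [innerForm_apply, ← pow_two] at h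
  refine le_trans (le_of_eq ?_) h
  refine integral_congr_ae (ae_of_all _ fun z => ?_)
  simp only [AddSubgroupClass.coe_sub, Pi.sub_apply, AddSubmonoidClass.coe_finsetSum,
    Finset.sum_apply]
  rw [H.comp_empty_apply]
  simp only [H.q_apply]

end IntegrateOut

/-! ### A central limit theorem for triangular arrays -/

section CentralLimit

/-- Second order expansion of the characteristic function of a small centered variable. -/
theorem norm_integral_exp_sub_le {α : Type*} [MeasurableSpace α] (P : Measure α)
    [IsProbabilityMeasure P] {y : α → ℝ} (hy : Measurable y) {b : ℝ} (hb : ∀ a, |y a| ≤ b)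
    (hb1 : b ≤ 1) (h0 : ∫ a, y a ∂P = 0) :
    ‖∫ a, Complex.exp (y a * Complex.I) ∂P - (1 - ((∫ a, y a ^ 2 ∂P : ℝ) : ℂ) / 2)‖ ≤
      b * ∫ a, y a ^ 2 ∂P := by
  have hy2 : Integrable (fun a => y a ^ 2) P :=
    integrable_of_abs_le (hy.pow_const 2) (C := b ^ 2) fun a => by
      rw [abs_pow]; exact pow_le_pow_left₀ (abs_nonneg _) (hb a) 2
  have hy1 : Integrable y P := integrable_of_abs_le hy hb
  have hmexp : Measurable fun a => Complex.exp (y a * Complex.I) := by fun_prop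
  have hexp : Integrable (fun a => Complex.exp (y a * Complex.I)) P :=
    Integrable.of_bound hmexp.aestronglyMeasurable 1
      (ae_of_all _ fun a => (Complex.norm_exp_ofReal_mul_I _).le)
  have hpoly : Integrable (fun a => (1 : ℂ) + (y a : ℂ) * Complex.I - ((y a ^ 2 : ℝ) : ℂ) / 2) P :=
    ((integrable_const _).add (hy1.ofReal.mul_const _)).sub (hy2.ofReal.div_const 2)
  have h1 : ∫ a, ((1 : ℂ) + (y a : ℂ) * Complex.I - ((y a ^ 2 : ℝ) : ℂ) / 2) ∂P =
      1 - ((∫ a, y a ^ 2 ∂P : ℝ) : ℂ) / 2 := by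
    rw [integral_sub ((integrable_const _).add (hy1.ofReal.mul_const _)) (hy2.ofReal.div_const 2),
      integral_add (integrable_const _) (hy1.ofReal.mul_const _), integral_mul_const,
      integral_div, integral_complex_ofReal, integral_complex_ofReal, h0]
    simp
  rw [← h1, ← integral_sub hexp hpoly, ← integral_const_mul]
  refine norm_integral_le_of_norm_le (hy2.const_mul b) (ae_of_all _ fun a => ?_)
  have hn : ‖(y a : ℂ) * Complex.I‖ = |y a| := by simp
  -- Third-order Taylor remainder, with constant 4/(3! · 3) = 2/9 ≤ 1. The cube |y|³ is then bounded
  -- by b y².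
  have h2 := Complex.exp_bound (x := (y a : ℂ) * Complex.I) (hn.trans_le ((hb a).trans hb1))
    (n := 3) (by norm_num)
  rw [hn] at h2
  simp only [Finset.sum_range_succ, Finset.sum_range_zero, Nat.factorial] at h2
  have h3 : (1 : ℂ) + (y a : ℂ) * Complex.I - ((y a ^ 2 : ℝ) : ℂ) / 2 =
      0 + ((y a : ℂ) * Complex.I) ^ 0 / ((1 : ℕ) : ℂ) +
        ((y a : ℂ) * Complex.I) ^ 1 / (((0 + 1) * 1 : ℕ) : ℂ) +
        ((y a : ℂ) * Complex.I) ^ 2 / (((1 + 1) * ((0 + 1) * 1) : ℕ) : ℂ) := by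
    rw [mul_pow _ _ 2, Complex.I_sq]
    push_cast
    ring
  rw [h3]
  refine h2.trans ?_
  have h4 : |y a| ^ 3 ≤ b * y a ^ 2 := by
    rw [pow_succ, sq_abs, mul_comm]
    exact mul_le_mul_of_nonneg_right (hb a) (sq_nonneg _)
  have h5 : 0 ≤ |y a| ^ 3 := by positivity
  norm_num
  linarith

/-- The characteristic functions of the standardized sums of the rows of a uniformly bounded
triangular array, with i.i.d. entries in each row, converge to that of the normal distribution if
the variances of the sums tend to infinity. -/
theorem tendsto_integral_exp_standardized_sum {𝒵 : ℕ → Type*} [∀ n, MeasurableSpace (𝒵 n)]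
    (P : ∀ n, Measure (𝒵 n)) [∀ n, IsProbabilityMeasure (P n)] (h : ∀ n, 𝒵 n → ℝ)
    (hm : ∀ n, Measurable (h n)) {C : ℝ} (hC : ∀ n a, |h n a| ≤ C) (v : ℕ → ℝ)
    (hv : ∀ n, v n = Var[h n; P n]) (hvar : Tendsto (fun n : ℕ => (n : ℝ) * v n) atTop atTop)
    (t : ℝ) :
    Tendsto (fun n : ℕ => ∫ z : Fin n → 𝒵 n, Complex.exp
        ((t * ((√((n : ℝ) * v n))⁻¹ * ∑ i, (h n (z i) - ∫ a, h n a ∂(P n))) : ℝ) * Complex.I)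
        ∂(Measure.pi fun _ => P n)) atTop (𝓝 (Complex.exp (-(t : ℂ) ^ 2 / 2))) := by
  set c : ℕ → ℝ := fun n => t * (√((n : ℝ) * v n))⁻¹ with hc
  set y : ∀ n, 𝒵 n → ℝ := fun n a => c n * (h n a - ∫ a, h n a ∂(P n)) with hy
  have hC0 : 0 ≤ C := by
    have := nonempty_of_isProbabilityMeasure (P 0)
    exact (abs_nonneg _).trans (hC 0 (Classical.arbitrary _))
  have hprod : ∀ n : ℕ, (∫ a, Complex.exp (y n a * Complex.I) ∂(P n)) ^ n =
      ∫ z : Fin n → 𝒵 n, Complex.exp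
        ((t * ((√((n : ℝ) * v n))⁻¹ * ∑ i, (h n (z i) - ∫ a, h n a ∂(P n))) : ℝ) * Complex.I)
        ∂(Measure.pi fun _ => P n) := by
    intro n
    have := integral_fintype_prod_eq_pow (ι := Fin n) (μ := P n)
      (fun a => Complex.exp (y n a * Complex.I))
    rw [Fintype.card_fin] at this
    rw [← this]
    refine integral_congr_ae (ae_of_all _ fun z => ?_)
    simp only [← Complex.exp_sum, hy, hc]
    congr 1
    push_cast
    rw [← mul_assoc, Finset.mul_sum, Finset.sum_mul]
  simp_rw [← hprod]
  -- By independence the characteristic function is an n-th power, so it suffices that one factor is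
  -- 1 + (-t²/2)/n + o(1/n).
  refine Complex.tendsto_pow_exp_of_isLittleO_sub_add_div _ ?_
  have hmean : ∀ n, ∫ a, y n a ∂(P n) = 0 := by
    intro n
    simp only [hy]
    rw [integral_const_mul, integral_sub (integrable_of_abs_le (hm n) (hC n)) (integrable_const _)]
    simp
  have hbd : ∀ n a, |y n a| ≤ |c n| * (2 * C) := by
    intro n a
    simp only [hy, abs_mul]
    gcongr
    refine (abs_sub _ _).trans ?_
    linarith [hC n a, abs_integral_le_of_abs_le (μ := P n) (hC n)]
  have hsq : ∀ᶠ n : ℕ in atTop, ∫ a, y n a ^ 2 ∂(P n) = t ^ 2 / n := by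
    filter_upwards [hvar.eventually_gt_atTop 0, eventually_gt_atTop 0] with n hn hn0
    have hv0 : v n ≠ 0 := by rintro h0; simp [h0] at hn
    have hn1 : (n : ℝ) ≠ 0 := by positivity
    simp only [hy, mul_pow]
    rw [integral_const_mul, ← variance_eq_integral (hm n).aemeasurable, ← hv]
    simp only [hc, mul_pow, inv_pow]
    rw [Real.sq_sqrt hn.le]
    field_simp
  -- The entries are uniformly bounded and the normalization diverges, so the summands are uniformly
  -- small and no separate Lindeberg condition is needed.
  have hb0 : Tendsto (fun n => |c n| * (2 * C)) atTop (𝓝 0) := by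
    have h1 : Tendsto c atTop (𝓝 (t * 0)) :=
      ((tendsto_inv_atTop_zero.comp (Real.tendsto_sqrt_atTop.comp hvar))).const_mul t
    simpa using h1.abs.mul_const (2 * C)
  rw [isLittleO_iff]
  intro ε hε
  have h3 : Tendsto (fun n => |c n| * (2 * C) * t ^ 2) atTop (𝓝 0) := by
    simpa using hb0.mul_const (t ^ 2)
  filter_upwards [hsq, hb0.eventually_le_const one_pos, h3.eventually_le_const hε,
    eventually_gt_atTop 0] with n hn1 hn2 hn3 hn4
  have h4 := norm_integral_exp_sub_le (P n) (y := y n) (by fun_prop) (hbd n) hn2 (hmean n)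
  rw [hn1] at h4
  have h5 : (1 : ℂ) + -(t : ℂ) ^ 2 / 2 / n = 1 - ((t ^ 2 / n : ℝ) : ℂ) / 2 := by
    push_cast; ring
  rw [h5]
  refine h4.trans ?_
  have hn5 : (0 : ℝ) < n := by positivity
  rw [norm_div, norm_one, Complex.norm_natCast, mul_div_assoc', mul_one_div]
  gcongr

/-- A sequence of random variables that differs in mean from a sequence of standardized variables
by a null sequence converges in distribution to the normal distribution. -/
theorem tendstoInDistribution_of_tendsto_integral_exp {Ω : ℕ → Type*}
    [∀ n, MeasurableSpace (Ω n)] (Pr : ∀ n, Measure (Ω n)) [∀ n, IsProbabilityMeasure (Pr n)]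
    (T G : ∀ n, Ω n → ℝ) (hT : ∀ n, AEMeasurable (T n) (Pr n))
    (hG : ∀ᶠ n in atTop, AEMeasurable (G n) (Pr n))
    (hTG : ∀ᶠ n in atTop, Integrable (fun ω => T n ω - G n ω) (Pr n))
    (hlim : Tendsto (fun n => ∫ ω, |T n ω - G n ω| ∂(Pr n)) atTop (𝓝 0))
    (hexp : ∀ t : ℝ, Tendsto (fun n => ∫ ω, Complex.exp ((t * G n ω : ℝ) * Complex.I) ∂(Pr n))
      atTop (𝓝 (Complex.exp (-(t : ℂ) ^ 2 / 2)))) :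
    TendstoInDistribution T atTop (id : ℝ → ℝ) Pr (gaussianReal 0 1) where
  forall_aemeasurable := hT
  tendsto := by
    -- By Lévy's continuity theorem only characteristic functions matter. As u ↦ exp(itu) is
    -- |t|-Lipschitz, those of `T` and `G` differ by at most |t| times the L¹ distance.
    refine ProbabilityMeasure.tendsto_iff_tendsto_charFun.2 fun t => ?_
    have h1 : charFun ((gaussianReal 0 1).map (id : ℝ → ℝ)) t = Complex.exp (-(t : ℂ) ^ 2 / 2) := by
      rw [Measure.map_id, charFun_gaussianReal]
      simp [neg_div]
    have h2 : ∀ n, charFun ((Pr n).map (T n)) t =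
        ∫ ω, Complex.exp ((t * T n ω : ℝ) * Complex.I) ∂(Pr n) := by
      intro n
      rw [charFun_apply_real, integral_map (hT n) (by fun_prop)]
      simp
    change Tendsto (fun n => charFun ((Pr n).map (T n)) t) atTop
      (𝓝 (charFun ((gaussianReal 0 1).map (id : ℝ → ℝ)) t))
    simp_rw [h1, h2]
    have h3 : Tendsto (fun n => ∫ ω, Complex.exp ((t * T n ω : ℝ) * Complex.I) ∂(Pr n) -
        ∫ ω, Complex.exp ((t * G n ω : ℝ) * Complex.I) ∂(Pr n)) atTop (𝓝 0) := by
      refine squeeze_zero_norm' ?_ (by simpa using hlim.const_mul |t|)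
      filter_upwards [hG, hTG] with n hGn hTGn
      have hint : ∀ {F : Ω n → ℝ}, AEMeasurable F (Pr n) →
          Integrable (fun ω => Complex.exp ((t * F ω : ℝ) * Complex.I)) (Pr n) := by
        intro F hF
        refine Integrable.of_bound (AEMeasurable.aestronglyMeasurable ?_) 1
          (ae_of_all _ fun a => (Complex.norm_exp_ofReal_mul_I _).le)
        fun_prop
      rw [← integral_sub (hint (hT n)) (hint hGn), ← integral_const_mul]
      refine norm_integral_le_of_norm_le (hTGn.abs.const_mul _) (ae_of_all _ fun ω => ?_)
      have h4 : Complex.exp ((t * T n ω : ℝ) * Complex.I) -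
          Complex.exp ((t * G n ω : ℝ) * Complex.I) =
          Complex.exp ((t * G n ω : ℝ) * Complex.I) *
            (Complex.exp (Complex.I * (t * (T n ω - G n ω) : ℝ)) - 1) := by
        rw [mul_sub, ← Complex.exp_add, mul_one]
        congr 2
        push_cast
        ring
      rw [h4, norm_mul, Complex.norm_exp_ofReal_mul_I, one_mul]
      refine (Real.norm_exp_I_mul_ofReal_sub_one_le).trans ?_
      rw [Real.norm_eq_abs, abs_mul]
    simpa using h3.add (hexp t)

end CentralLimit

/-! ### Counting sub-samples -/

namespace Subsample

variable {n s : ℕ}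

instance : Fintype (Subsample n s) := inferInstanceAs (Fintype {S : Finset (Fin n) // S.card = s})

instance : DiscreteMeasurableSpace (Subsample n s) := ⟨fun _ => trivial⟩

theorem card_filter (p : Finset (Fin n) → Prop) [DecidablePred p] :
    ((Finset.univ : Finset (Subsample n s)).filter fun S => p S.1).card =
      ((Finset.univ.powersetCard s).filter p).card := by
  refine Finset.card_bij (fun S _ => S.1) (fun S hS => ?_) (fun S _ S' _ h => Subtype.ext h)
    fun A hA => ?_
  · simpa [Finset.mem_powersetCard, S.2] using hS
  · simp only [Finset.mem_filter, Finset.mem_powersetCard, Finset.subset_univ, true_and] at hA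
    exact ⟨⟨A, hA.1⟩, Finset.mem_filter.2 ⟨Finset.mem_univ _, hA.2⟩, rfl⟩

theorem card_eq : Fintype.card (Subsample n s) = n.choose s := by
  have := card_filter (n := n) (s := s) fun _ => True
  simpa using this

theorem nonempty (h : s ≤ n) : Nonempty (Subsample n s) := by
  rw [← Fintype.card_pos_iff, card_eq]
  exact Nat.choose_pos h

theorem card_filter_subset (A : Finset (Fin n)) (hA : A.card ≤ s) :
    ((Finset.univ : Finset (Subsample n s)).filter fun S => A ⊆ S.1).card =
      (n - A.card).choose (s - A.card) := by
  rw [card_filter, Finset.card_filter_powersetCard_subset _ _ _ (Finset.subset_univ _) hA]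
  simp

/-- Absorption identity: C(n-1, s-1) = (s/n) C(n, s). -/
theorem card_filter_mem (hs : 0 < s) (i : Fin n) :
    (((Finset.univ : Finset (Subsample n s)).filter fun S => i ∈ S.1).card : ℝ) =
      (s : ℝ) / n * Fintype.card (Subsample n s) := by
  have h := card_filter_subset (s := s) {i} (by rw [Finset.card_singleton]; exact hs)
  simp only [Finset.singleton_subset_iff, Finset.card_singleton] at h
  rw [h, card_eq]
  obtain ⟨n, rfl⟩ : ∃ m, n = m + 1 := ⟨n - 1, by have := i.2; omega⟩
  obtain ⟨s, rfl⟩ : ∃ m, s = m + 1 := ⟨s - 1, by omega⟩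
  have h2 : ((n : ℝ) + 1) * n.choose s = (n + 1).choose (s + 1) * ((s : ℝ) + 1) := by
    exact_mod_cast Nat.add_one_mul_choose_eq n s
  have h3 : (n : ℝ) + 1 ≠ 0 := by positivity
  simp only [Nat.add_sub_cancel]
  push_cast
  field_simp
  linarith

/-- Absorbing twice gives the exact proportion s(s-1)/(n(n-1)), and (s-1)/(n-1) ≤ s/n because s ≤ n.
-/
theorem card_filter_pair_le (hsn : s ≤ n) {i j : Fin n} (hij : i ≠ j) :
    (((Finset.univ : Finset (Subsample n s)).filter fun S => i ∈ S.1 ∧ j ∈ S.1).card : ℝ) ≤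
      ((s : ℝ) / n) ^ 2 * Fintype.card (Subsample n s) := by
  -- The binomial formula with s - 2 needs s ≥ 2; below that no subset contains two points.
  rcases lt_or_ge s 2 with hs | hs
  · rw [Finset.filter_false_of_mem, Finset.card_empty]
    · push_cast; positivity
    · intro S _ h
      have : 1 < S.1.card := Finset.one_lt_card.2 ⟨i, h.1, j, h.2, hij⟩
      rw [S.2] at this
      omega
  have hc : ({i, j} : Finset (Fin n)).card = 2 := Finset.card_pair hij
  have h := card_filter_subset (s := s) {i, j} (by rw [hc]; exact hs)
  simp only [Finset.insert_subset_iff, Finset.singleton_subset_iff, hc] at h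
  rw [h, card_eq]
  obtain ⟨n, rfl⟩ : ∃ m, n = m + 2 := ⟨n - 2, by omega⟩
  obtain ⟨s, rfl⟩ : ∃ m, s = m + 2 := ⟨s - 2, by omega⟩
  simp only [Nat.add_sub_cancel]
  have h1 : ((n : ℝ) + 1) * n.choose s = (n + 1).choose (s + 1) * ((s : ℝ) + 1) := by
    exact_mod_cast Nat.add_one_mul_choose_eq n s
  have h2 : ((n : ℝ) + 2) * (n + 1).choose (s + 1) = (n + 2).choose (s + 2) * ((s : ℝ) + 2) := by
    have := Nat.add_one_mul_choose_eq (n + 1) (s + 1)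
    exact_mod_cast this
  have h3 : (s : ℝ) ≤ n := by exact_mod_cast (by omega : s ≤ n)
  have h4 : (n.choose s : ℝ) =
      ((s : ℝ) + 2) / (n + 2) * (((s : ℝ) + 1) / (n + 1)) * (n + 2).choose (s + 2) := by
    have h5 : (n : ℝ) + 1 ≠ 0 := by positivity
    have h6 : (n : ℝ) + 2 ≠ 0 := by positivity
    field_simp
    calc (n.choose s : ℝ) * (n + 2) * (n + 1) = (n + 2) * (((n : ℝ) + 1) * n.choose s) := by ring
      _ = ((n + 2) * (n + 1).choose (s + 1)) * ((s : ℝ) + 1) := by rw [h1]; ring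
      _ = _ := by rw [h2]; ring
  rw [h4]
  push_cast
  refine mul_le_mul_of_nonneg_right ?_ (by positivity)
  rw [pow_two]
  refine mul_le_mul_of_nonneg_left ?_ (by positivity)
  rw [div_le_div_iff₀ (by positivity) (by positivity)]
  linarith

theorem enum_mem (S : Subsample n s) (j : Fin s) : S.enum j ∈ S.1 :=
  Finset.orderEmbOfFin_mem _ _ _

theorem exists_enum_eq (S : Subsample n s) {i : Fin n} (hi : i ∈ S.1) : ∃ j, S.enum j = i := by
  have : i ∈ Set.range (S.1.orderEmbOfFin S.2) := by
    rw [Finset.range_orderEmbOfFin]; exact hi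
  exact this

theorem integral_uniformOn (φ : Subsample n s → ℝ) :
    ∫ S, φ S ∂(uniformOn Set.univ) = (Fintype.card (Subsample n s) : ℝ)⁻¹ * ∑ S, φ S := by
  rw [uniformOn, ProbabilityTheory.cond, integral_smul_measure, Measure.restrict_univ,
    integral_fintype Integrable.of_finite]
  simp [Measure.count_apply_finite, Set.finite_univ, Measure.real]

end Subsample

/-! ### Sub-sampled statistics -/

section Statistic

open Function

/-- Selecting some of several i.i.d. variables yields i.i.d. variables. -/
theorem measurePreserving_comp_injective {ι κ 𝒵 : Type*} [Fintype ι] [Fintype κ]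
    [MeasurableSpace 𝒵] (P : Measure 𝒵) [IsProbabilityMeasure P] {e : ι → κ}
    (he : Injective e) :
    MeasurePreserving (fun z : κ → 𝒵 => z ∘ e) (Measure.pi fun _ => P) (Measure.pi fun _ => P) := by
  classical
  have hm : Measurable fun z : κ → 𝒵 => z ∘ e := measurable_pi_lambda _ fun i => by fun_prop
  refine ⟨hm, Eq.symm (Measure.pi_eq fun s hs => ?_)⟩
  rw [Measure.map_apply hm (MeasurableSet.univ_pi hs)]
  have : (fun z : κ → 𝒵 => z ∘ e) ⁻¹' (Set.univ.pi s) =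
      Set.univ.pi (extend e s fun _ => Set.univ) := by
    ext z
    simp only [Set.mem_preimage, Set.mem_pi, Set.mem_univ, true_implies, comp_apply]
    constructor
    · intro h k
      by_cases hk : ∃ i, e i = k
      · obtain ⟨i, rfl⟩ := hk
        rw [he.extend_apply]; exact h i
      · rw [extend_apply' _ _ _ hk]; trivial
    · intro h i
      have := h (e i)
      rwa [he.extend_apply] at this
  rw [this, Measure.pi_pi]
  refine (Fintype.prod_of_injective e he _ _ (fun k hk => ?_) fun i => ?_).symm
  · rw [extend_apply' _ _ _ (by simpa using hk), measure_univ]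
  · rw [he.extend_apply]

theorem integral_comp_injective {ι κ 𝒵 : Type*} [Fintype ι] [Fintype κ]
    [MeasurableSpace 𝒵] (P : Measure 𝒵) [IsProbabilityMeasure P] {e : ι → κ}
    (he : Injective e) {f : (ι → 𝒵) → ℝ} (hf : Measurable f) :
    ∫ z : κ → 𝒵, f (z ∘ e) ∂(Measure.pi fun _ => P) = ∫ y, f y ∂(Measure.pi fun _ => P) := by
  have h := measurePreserving_comp_injective P he
  rw [← h.map_eq, integral_map h.measurable.aemeasurable hf.aestronglyMeasurable]

/-- The average of i.i.d. bounded variables is close to their mean in mean square. -/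
theorem integral_average_sub_mean_sq_le {α : Type*} [MeasurableSpace α] (Q : Measure α)
    [IsProbabilityMeasure Q] {g : α → ℝ} (hg : Measurable g) {C : ℝ} (hC : ∀ a, |g a| ≤ C) {B : ℕ}
    (hB : 0 < B) :
    ∫ u : Fin B → α, (1 / (B : ℝ) * ∑ b, g (u b) - ∫ a, g a ∂Q) ^ 2 ∂(Measure.pi fun _ => Q) ≤
      C ^ 2 / B := by
  have hB' : (B : ℝ) ≠ 0 := by positivity
  have hLp : MemLp g 2 Q := MemLp.of_bound hg.aestronglyMeasurable C (ae_of_all _ fun a => hC a)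
  set X : (Fin B → α) → ℝ := fun u => 1 / (B : ℝ) * ∑ b, g (u b) with hX
  have hXm : Measurable X := by fun_prop
  have hi : ∀ b : Fin B, ∫ u : Fin B → α, g (u b) ∂(Measure.pi fun _ => Q) = ∫ a, g a ∂Q := by
    intro b
    have h := measurePreserving_eval (fun _ : Fin B => Q) b
    conv_rhs => rw [← h.map_eq]
    rw [integral_map h.measurable.aemeasurable hg.aestronglyMeasurable]
  have hmean : ∫ u, X u ∂(Measure.pi fun _ => Q) = ∫ a, g a ∂Q := by
    simp only [hX]
    rw [integral_const_mul, integral_finsetSum]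
    · simp only [hi, Finset.sum_const, Finset.card_univ, Fintype.card_fin, nsmul_eq_mul]
      field_simp
    · exact fun b _ => integrable_of_abs_le (hg.comp (measurable_pi_apply b)) fun u => hC _
  rw [← hmean, ← variance_eq_integral hXm.aemeasurable]
  have h1 : Var[X; Measure.pi fun _ => Q] = (1 / (B : ℝ)) ^ 2 * (B * Var[g; Q]) := by
    simp only [hX]
    rw [variance_const_mul]
    congr 1
    have := variance_sum_pi (ι := Fin B) (μ := fun _ => Q) (X := fun _ => g) fun _ => hLp
    simp only [Finset.sum_const, Finset.card_univ, Fintype.card_fin, nsmul_eq_mul] at this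
    rw [← this]
    congr 1
    ext u
    simp
  have h2 : Var[g; Q] ≤ C ^ 2 := by
    refine (variance_le_expectation_sq hg.aestronglyMeasurable).trans ?_
    refine (le_abs_self _).trans (abs_integral_le_of_abs_le fun a => ?_)
    simp only [Pi.pow_apply, abs_pow]
    exact pow_le_pow_left₀ (abs_nonneg _) (hC a) 2
  rw [h1]
  calc (1 / (B : ℝ)) ^ 2 * (B * Var[g; Q]) ≤ (1 / (B : ℝ)) ^ 2 * (B * C ^ 2) := by gcongr
    _ = C ^ 2 / B := by field_simp

end Statistic

/-! ### The statistic of one sub-sample, its symmetry, and its projection on one observation -/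

namespace BaseKernel

open Function

variable {𝒵 Ξ : Type*} [MeasurableSpace 𝒵] [MeasurableSpace Ξ] {s : ℕ} (K : BaseKernel 𝒵 Ξ s)
  {P : Measure 𝒵} [IsProbabilityMeasure P] {f : 𝒵 → ℝ} {C : ℝ}

/-- The weighted average of the values of `f` over the sub-sample. -/
def stat (f : 𝒵 → ℝ) (y : Fin s → 𝒵) (ξ : Ξ) : ℝ := ∑ j, K.weight y ξ j * f (y j)

/-- The weighted average, averaged over the internal randomness. -/
def meanStat (f : 𝒵 → ℝ) (y : Fin s → 𝒵) : ℝ := ∫ ξ, K.stat f y ξ ∂K.law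

/-- The conditional mean of the weighted average given the first observation. -/
def firstProj [NeZero s] (P : Measure 𝒵) (f : 𝒵 → ℝ) (a : 𝒵) : ℝ :=
  ∫ y, K.meanStat f (update y 0 a) ∂(Measure.pi fun _ => P)

theorem measurable_stat (hf : Measurable f) :
    Measurable fun ω : (Fin s → 𝒵) × Ξ => K.stat f ω.1 ω.2 := by
  unfold stat
  refine Finset.measurable_fun_sum _ fun j _ => ?_
  exact ((measurable_pi_apply j).comp K.measurable_weight).mul
    (hf.comp ((measurable_pi_apply j).comp measurable_fst))

theorem measurable_weight_right (y : Fin s → 𝒵) : Measurable fun ξ => K.weight y ξ :=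
  K.measurable_weight.comp measurable_prodMk_left

theorem weight_le_one (y : Fin s → 𝒵) (ξ : Ξ) (j : Fin s) : K.weight y ξ j ≤ 1 := by
  rw [← K.sum_eq_one y ξ]
  exact Finset.single_le_sum (fun j _ => K.nonneg y ξ j) (Finset.mem_univ j)

theorem abs_stat_le (hC : ∀ a, |f a| ≤ C) (y : Fin s → 𝒵) (ξ : Ξ) : |K.stat f y ξ| ≤ C := by
  calc |K.stat f y ξ| ≤ ∑ j, |K.weight y ξ j * f (y j)| := Finset.abs_sum_le_sum_abs _ _
    _ ≤ ∑ j, K.weight y ξ j * C := by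
        refine Finset.sum_le_sum fun j _ => ?_
        rw [abs_mul, abs_of_nonneg (K.nonneg _ _ _)]
        exact mul_le_mul_of_nonneg_left (hC _) (K.nonneg _ _ _)
    _ = C := by rw [← Finset.sum_mul, K.sum_eq_one, one_mul]

/-- Jensen for the weights, which form a probability vector. -/
theorem stat_sq_le (f : 𝒵 → ℝ) (y : Fin s → 𝒵) (ξ : Ξ) :
    K.stat f y ξ ^ 2 ≤ K.stat (fun a => f a ^ 2) y ξ := by
  have := (Even.convexOn_pow (𝕜 := ℝ) (n := 2) even_two).map_sum_le (t := Finset.univ)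
    (w := K.weight y ξ) (p := fun j => f (y j)) (fun j _ => K.nonneg y ξ j) (K.sum_eq_one y ξ)
    (fun j _ => Set.mem_univ _)
  simpa [stat] using this

theorem measurable_meanStat (hf : Measurable f) : Measurable (K.meanStat f) :=
  (StronglyMeasurable.integral_prod_right (f := fun y ξ => K.stat f y ξ)
    (K.measurable_stat hf).stronglyMeasurable).measurable

theorem abs_meanStat_le (hC : ∀ a, |f a| ≤ C) (y : Fin s → 𝒵) : |K.meanStat f y| ≤ C :=
  abs_integral_le_of_abs_le fun ξ => K.abs_stat_le hC y ξ

theorem integrable_stat (hf : Measurable f) (hC : ∀ a, |f a| ≤ C) :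
    Integrable (fun ω : (Fin s → 𝒵) × Ξ => K.stat f ω.1 ω.2) (K.jointLaw P) :=
  integrable_of_abs_le (K.measurable_stat hf) fun ω => K.abs_stat_le hC ω.1 ω.2

theorem integral_meanStat (hf : Measurable f) (hC : ∀ a, |f a| ≤ C) :
    ∫ y, K.meanStat f y ∂(Measure.pi fun _ => P) = ∫ ω, K.stat f ω.1 ω.2 ∂(K.jointLaw P) :=
  (integral_prod _ (K.integrable_stat (P := P) hf hC)).symm

/-- Jensen twice: over the internal randomness, as nonnegativity of a variance, and then over the
weights. The result is again a weighted average, to which honesty applies. -/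
theorem meanStat_sq_le (hf : Measurable f) (hC : ∀ a, |f a| ≤ C) (y : Fin s → 𝒵) :
    K.meanStat f y ^ 2 ≤ K.meanStat (fun a => f a ^ 2) y := by
  have hm : ∀ {f : 𝒵 → ℝ}, Measurable f → Measurable fun ξ => K.stat f y ξ := fun hf =>
    (K.measurable_stat hf).comp measurable_prodMk_left
  have h1 : MemLp (fun ξ => K.stat f y ξ) 2 K.law :=
    MemLp.of_bound (hm hf).aestronglyMeasurable C (ae_of_all _ fun ξ => K.abs_stat_le hC y ξ)
  have h2 := variance_eq_sub h1
  have h3 := variance_nonneg (fun ξ => K.stat f y ξ) K.law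
  have h4 : ∫ ξ, K.stat f y ξ ^ 2 ∂K.law ≤ ∫ ξ, K.stat (fun a => f a ^ 2) y ξ ∂K.law := by
    refine integral_mono h1.integrable_sq (integrable_of_abs_le (hm (hf.pow_const 2)) (C := C ^ 2)
      fun ξ => K.abs_stat_le (fun a => ?_) y ξ) fun ξ => K.stat_sq_le f y ξ
    rw [abs_pow]
    exact pow_le_pow_left₀ (abs_nonneg _) (hC a) 2
  have h5 : K.meanStat f y ^ 2 ≤ ∫ ξ, K.stat f y ξ ^ 2 ∂K.law := by
    simp only [Pi.pow_apply] at h2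
    unfold meanStat
    linarith
  exact h5.trans h4

/-- The averaged statistic does not depend on the order of the observations. -/
theorem meanStat_comp_perm (f : 𝒵 → ℝ) (σ : Equiv.Perm (Fin s)) (y : Fin s → 𝒵) :
    K.meanStat f (y ∘ σ) = K.meanStat f y := by
  -- The averaged statistic depends on the randomness only through the law of the weight vector,
  -- which is what `symmetric` controls.
  have hφ : Measurable fun w : Fin s → ℝ => ∑ j, w j * f (y (σ j)) := by fun_prop
  have h1 : Measurable fun ξ => fun j => K.weight (y ∘ σ) ξ j := K.measurable_weight_right _
  have h2 : Measurable fun ξ => fun j => K.weight y ξ (σ j) :=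
    measurable_pi_lambda _ fun j => (measurable_pi_apply _).comp (K.measurable_weight_right y)
  calc K.meanStat f (y ∘ σ)
      = ∫ w, ∑ j, w j * f (y (σ j)) ∂(K.law.map fun ξ j => K.weight (y ∘ σ) ξ j) := by
        rw [integral_map h1.aemeasurable hφ.aestronglyMeasurable]; rfl
    _ = ∫ ξ, ∑ j, K.weight y ξ (σ j) * f (y (σ j)) ∂K.law := by
        rw [K.symmetric, integral_map h2.aemeasurable hφ.aestronglyMeasurable]
    _ = K.meanStat f y := by
        refine integral_congr_ae (ae_of_all _ fun ξ => ?_)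
        exact Equiv.sum_comp σ fun j => K.weight y ξ j * f (y j)

theorem stat_ae_congr {f g : 𝒵 → ℝ} (h : f =ᵐ[P] g) :
    ∀ᵐ ω ∂(K.jointLaw P), K.stat f ω.1 ω.2 = K.stat g ω.1 ω.2 := by
  have h1 : ∀ᵐ ω ∂(K.jointLaw P), ∀ j, f (ω.1 j) = g (ω.1 j) := by
    refine ae_all_iff.2 fun j => ?_
    exact ((measurePreserving_eval (fun _ : Fin s => P) j).comp
      measurePreserving_fst).quasiMeasurePreserving.ae h
  filter_upwards [h1] with ω hω
  simp only [stat, hω]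

variable [NeZero s]

theorem measurable_firstProj (hf : Measurable f) : Measurable (K.firstProj P f) := by
  refine (StronglyMeasurable.integral_prod_right
    (f := fun a (y : Fin s → 𝒵) => K.meanStat f (update y 0 a)) ?_).measurable
  exact ((K.measurable_meanStat hf).comp ((measurable_update_prod (0 : Fin s)).comp
    measurable_swap)).stronglyMeasurable

theorem abs_firstProj_le (hC : ∀ a, |f a| ≤ C) (a : 𝒵) : |K.firstProj P f a| ≤ C :=
  abs_integral_le_of_abs_le fun _ => K.abs_meanStat_le hC _

theorem integral_firstProj (hf : Measurable f) (hC : ∀ a, |f a| ≤ C) :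
    ∫ a, K.firstProj P f a ∂P = ∫ y, K.meanStat f y ∂(Measure.pi fun _ => P) := by
  rw [← integral_update P (integrable_of_abs_le (K.measurable_meanStat hf)
    fun y => K.abs_meanStat_le hC y) 0]
  refine integral_integral_swap (f := fun a (y : Fin s → 𝒵) => K.meanStat f (update y 0 a)) ?_
  exact integrable_of_abs_le ((K.measurable_meanStat hf).comp
    ((measurable_update_prod (0 : Fin s)).comp measurable_swap)) fun _ => K.abs_meanStat_le hC _

/-- By symmetry, the projections on all the observations agree. -/
theorem integral_meanStat_update (hf : Measurable f) (j : Fin s) (a : 𝒵) :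
    ∫ y, K.meanStat f (update y j a) ∂(Measure.pi fun _ => P) = K.firstProj P f a := by
  set σ : Equiv.Perm (Fin s) := Equiv.swap 0 j with hσ
  have h1 : ∀ y : Fin s → 𝒵, update y j a ∘ σ = update (y ∘ σ) 0 a := by
    intro y
    ext k
    by_cases hk : k = 0
    · subst hk; simp [hσ]
    · have : σ k ≠ j := by
        intro h
        exact hk (σ.injective (h.trans (Equiv.swap_apply_left 0 j).symm))
      simp [update_of_ne hk, update_of_ne this]
  calc _ = ∫ y : Fin s → 𝒵, K.meanStat f (update (y ∘ σ) 0 a) ∂(Measure.pi fun _ => P) := by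
        refine integral_congr_ae (ae_of_all _ fun y => ?_)
        simp only []
        rw [← K.meanStat_comp_perm f σ (update y j a), h1]
    _ = _ := integral_comp_injective P σ.injective (f := fun y => K.meanStat f (update y 0 a))
        ((K.measurable_meanStat hf).comp
          ((measurable_update_prod (0 : Fin s)).comp (measurable_id.prodMk measurable_const)))

/-- `η(s)` is the variance of the conditional mean given the first observation. -/
theorem eta_eq_variance (hf : Measurable f) (hC : ∀ a, |f a| ≤ C) :
    K.eta P f = Var[K.firstProj P f; P] := by
  have hX : Measurable fun ω : (Fin s → 𝒵) × Ξ => ω.1 0 := by fun_prop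
  have hpres : MeasurePreserving (fun ω : (Fin s → 𝒵) × Ξ => ω.1 0) (K.jointLaw P) P :=
    (measurePreserving_eval (fun _ : Fin s => P) 0).comp measurePreserving_fst
  have hstat : Integrable (fun ω : (Fin s → 𝒵) × Ξ => ∑ j, K.weight ω.1 ω.2 j * f (ω.1 j))
    (K.jointLaw P) := K.integrable_stat hf hC
  -- `firstProj` at the first observation is a version of the conditional expectation in `eta`: test
  -- it on events determined by that observation, and resample coordinate 0.
  have hce : (fun ω : (Fin s → 𝒵) × Ξ => K.firstProj P f (ω.1 0)) =ᵐ[K.jointLaw P]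
      (K.jointLaw P)[fun ω => ∑ j, K.weight ω.1 ω.2 j * f (ω.1 j) |
        MeasurableSpace.comap (fun ω : (Fin s → 𝒵) × Ξ => ω.1 0) inferInstance] := by
    refine ae_eq_condExp_of_forall_setIntegral_eq hX.comap_le hstat ?_ ?_ ?_
    · exact fun A _ _ => (integrable_of_abs_le ((K.measurable_firstProj hf).comp hX)
        fun ω => K.abs_firstProj_le hC _).integrableOn
    · rintro _ ⟨A, hA, rfl⟩ -
      have hA' : MeasurableSet ((fun ω : (Fin s → 𝒵) × Ξ => ω.1 0) ⁻¹' A) := hX hA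
      have hi1 : Integrable (fun ω : (Fin s → 𝒵) × Ξ => A.indicator (fun _ => (1 : ℝ)) (ω.1 0) *
          K.stat f ω.1 ω.2) (K.jointLaw P) := by
        refine (K.integrable_stat hf hC).bdd_mul (c := 1) ?_ (ae_of_all _ fun ω => ?_)
        · exact ((measurable_const.indicator hA).comp hX).aestronglyMeasurable
        · rw [Real.norm_eq_abs]
          by_cases h : ω.1 0 ∈ A <;> simp [h]
      have hC0 : 0 ≤ C := by
        have := nonempty_of_isProbabilityMeasure P
        exact (abs_nonneg _).trans (hC (Classical.arbitrary _))
      have hmg : Measurable fun y : Fin s → 𝒵 =>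
          A.indicator (fun _ => (1 : ℝ)) (y 0) * K.meanStat f y :=
        ((measurable_const.indicator hA).comp (measurable_pi_apply 0)).mul
          (K.measurable_meanStat hf)
      have hbg : ∀ y : Fin s → 𝒵,
          |A.indicator (fun _ => (1 : ℝ)) (y 0) * K.meanStat f y| ≤ C := by
        intro y
        by_cases h : y 0 ∈ A <;> simp [h, K.abs_meanStat_le hC, hC0]
      calc ∫ ω in (fun ω : (Fin s → 𝒵) × Ξ => ω.1 0) ⁻¹' A, K.firstProj P f (ω.1 0) ∂(K.jointLaw P)
          = ∫ a in A, K.firstProj P f a ∂P := by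
            have := setIntegral_map (μ := K.jointLaw P) hA
              (K.measurable_firstProj (P := P) hf).aestronglyMeasurable hX.aemeasurable
            rw [hpres.map_eq] at this
            exact this.symm
        _ = ∫ a, ∫ y, A.indicator (fun _ => (1 : ℝ)) ((update y 0 a : Fin s → 𝒵) 0) *
              K.meanStat f (update y 0 a) ∂(Measure.pi fun _ => P) ∂P := by
            rw [← integral_indicator hA]
            refine integral_congr_ae (ae_of_all _ fun a => ?_)
            simp only [update_self]
            rw [integral_const_mul]
            by_cases h : a ∈ A <;> simp [h, firstProj]
        _ = ∫ y, A.indicator (fun _ => (1 : ℝ)) (y 0) * K.meanStat f y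
              ∂(Measure.pi fun _ : Fin s => P) := by
            rw [← integral_update P (integrable_of_abs_le hmg hbg) 0]
            refine integral_integral_swap (f := fun a (y : Fin s → 𝒵) =>
              A.indicator (fun _ => (1 : ℝ)) ((update y 0 a : Fin s → 𝒵) 0) *
                K.meanStat f (update y 0 a)) ?_
            exact integrable_of_abs_le (hmg.comp ((measurable_update_prod (0 : Fin s)).comp
              measurable_swap)) fun _ => hbg _
        _ = ∫ ω, A.indicator (fun _ => (1 : ℝ)) (ω.1 0) * K.stat f ω.1 ω.2 ∂(K.jointLaw P) := by
            refine Eq.trans ?_ (integral_prod _ hi1).symm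
            refine integral_congr_ae (ae_of_all _ fun y => ?_)
            simp only [integral_const_mul, meanStat]
        _ = _ := by
            rw [← integral_indicator hA']
            refine integral_congr_ae (ae_of_all _ fun ω => ?_)
            by_cases h : ω.1 0 ∈ A <;> simp [h, stat]
    · exact (((K.measurable_firstProj hf).comp
        (comap_measurable _)).stronglyMeasurable).aestronglyMeasurable
  unfold eta
  rw [← variance_congr hce]
  exact hpres.variance_fun_comp (K.measurable_firstProj hf).aemeasurable

/-- Lets the debiased moment be replaced by its truncation, with which it agrees only almost
everywhere. -/
theorem eta_congr {f g : 𝒵 → ℝ} (h : f =ᵐ[P] g) : K.eta P f = K.eta P g :=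
  variance_congr (condExp_congr_ae (K.stat_ae_congr h))

end BaseKernel

/-! ### Resampled averages as incomplete U-statistics -/

namespace BaseKernel

open Function

variable {𝒵 Ξ : Type*} [MeasurableSpace 𝒵] [MeasurableSpace Ξ] {s : ℕ} (K : BaseKernel 𝒵 Ξ s)
  {P : Measure 𝒵} [IsProbabilityMeasure P] {f : 𝒵 → ℝ} {C : ℝ} {n B : ℕ}

/-- The law of a random sub-sample with its internal randomness. -/
def subLaw (n : ℕ) : Measure (Subsample n s × Ξ) := (uniformOn Set.univ).prod K.law

theorem isProbabilityMeasure_subLaw (hsn : s ≤ n) : IsProbabilityMeasure (K.subLaw n) := by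
  have := Subsample.nonempty hsn
  have : IsProbabilityMeasure (uniformOn (Set.univ : Set (Subsample n s))) :=
    isProbabilityMeasure_uniformOn Set.finite_univ Set.univ_nonempty
  unfold subLaw
  infer_instance

/-- The weighted average of the values of `f`, for the sub-sampled kernel. -/
def resampled (f : 𝒵 → ℝ) (z : Fin n → 𝒵) (u : Fin B → Subsample n s × Ξ) : ℝ :=
  ∑ i, K.avgWeight z u i * f (z i)

/-- The average of the statistic over all sub-samples. -/
def fullStat (f : 𝒵 → ℝ) (z : Fin n → 𝒵) : ℝ :=
  (Fintype.card (Subsample n s) : ℝ)⁻¹ * ∑ S : Subsample n s, K.meanStat f (z ∘ S.enum)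

theorem sum_subWeight_mul (f : 𝒵 → ℝ) (z : Fin n → 𝒵) (S : Subsample n s) (ξ : Ξ) :
    ∑ i, K.subWeight z S ξ i * f (z i) = K.stat f (z ∘ S.enum) ξ := by
  simp only [subWeight, Finset.sum_mul, stat]
  rw [Finset.sum_comm]
  refine Finset.sum_congr rfl fun j _ => ?_
  rw [Finset.sum_eq_single (S.enum j)]
  · simp
  · intro i _ hi
    rw [if_neg (Ne.symm hi), zero_mul]
  · simp

theorem resampled_eq (f : 𝒵 → ℝ) (z : Fin n → 𝒵) (u : Fin B → Subsample n s × Ξ) :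
    K.resampled f z u = 1 / (B : ℝ) * ∑ b, K.stat f (z ∘ (u b).1.enum) (u b).2 := by
  simp only [resampled, avgWeight, mul_assoc, ← K.sum_subWeight_mul]
  rw [← Finset.mul_sum, Finset.sum_comm]
  simp only [Finset.sum_mul]

theorem abs_resampled_le (hC : ∀ a, |f a| ≤ C) (hB : 0 < B) (z : Fin n → 𝒵)
    (u : Fin B → Subsample n s × Ξ) : |K.resampled f z u| ≤ C := by
  rw [resampled_eq, abs_mul, abs_of_nonneg (by positivity : (0 : ℝ) ≤ 1 / B)]
  calc 1 / (B : ℝ) * |∑ b, K.stat f (z ∘ (u b).1.enum) (u b).2| ≤ 1 / (B : ℝ) * ∑ _b : Fin B, C := by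
        gcongr
        exact (Finset.abs_sum_le_sum_abs _ _).trans
          (Finset.sum_le_sum fun b _ => K.abs_stat_le hC _ _)
    _ = C := by
        simp only [Finset.sum_const, Finset.card_univ, Fintype.card_fin, nsmul_eq_mul]
        field_simp

theorem abs_fullStat_le (hC : ∀ a, |f a| ≤ C) (hsn : s ≤ n) (z : Fin n → 𝒵) :
    |K.fullStat f z| ≤ C := by
  have := Subsample.nonempty hsn
  have hc : (0 : ℝ) < Fintype.card (Subsample n s) := by exact_mod_cast Fintype.card_pos
  rw [fullStat, abs_mul, abs_of_nonneg (inv_nonneg.2 hc.le)]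
  calc _ ≤ (Fintype.card (Subsample n s) : ℝ)⁻¹ * ∑ _S : Subsample n s, C := by
        gcongr
        exact (Finset.abs_sum_le_sum_abs _ _).trans
          (Finset.sum_le_sum fun S _ => K.abs_meanStat_le hC _)
    _ = C := by
        simp only [Finset.sum_const, Finset.card_univ, nsmul_eq_mul]
        field_simp

theorem measurable_comp_enum (S : Subsample n s) :
    Measurable fun z : Fin n → 𝒵 => z ∘ S.enum :=
  measurable_pi_lambda _ fun _ => measurable_pi_apply _

theorem measurable_fullStat (hf : Measurable f) : Measurable (K.fullStat (n := n) f) := by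
  unfold fullStat
  refine Measurable.const_mul (Finset.measurable_fun_sum _ fun S _ => ?_) _
  exact (K.measurable_meanStat hf).comp (measurable_comp_enum S)

/-- Joint measurability of the weights in the data, the sub-samples and the randomness. -/
theorem measurable_avgWeight (i : Fin n) :
    Measurable fun ω : (Fin n → 𝒵) × (Fin B → Subsample n s × Ξ) => K.avgWeight ω.1 ω.2 i := by
  have h1 : Measurable fun q : ((Fin n → 𝒵) × Ξ) × Subsample n s =>
      K.subWeight q.1.1 q.2 q.1.2 i := by
    refine measurable_from_prod_countable_left fun S => ?_
    unfold subWeight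
    refine Finset.measurable_fun_sum _ fun j _ => ?_
    by_cases h : S.enum j = i <;> simp only [h, if_true, if_false]
    · exact (measurable_pi_apply j).comp (K.measurable_weight.comp
        (((measurable_comp_enum S).comp measurable_fst).prodMk measurable_snd))
    · exact measurable_const
  unfold avgWeight
  refine Measurable.const_mul (Finset.measurable_fun_sum _ fun b _ => ?_) _
  exact h1.comp (f := fun ω : (Fin n → 𝒵) × (Fin B → Subsample n s × Ξ) =>
    ((ω.1, (ω.2 b).2), (ω.2 b).1)) (by fun_prop)

theorem measurable_resampled (hf : Measurable f) :
    Measurable fun ω : (Fin n → 𝒵) × (Fin B → Subsample n s × Ξ) => K.resampled f ω.1 ω.2 := by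
  unfold resampled
  exact Finset.measurable_fun_sum _ fun i _ => (K.measurable_avgWeight i).mul
    (hf.comp ((measurable_pi_apply i).comp measurable_fst))

theorem measurable_stat_sub (hf : Measurable f) (z : Fin n → 𝒵) :
    Measurable fun q : Subsample n s × Ξ => K.stat f (z ∘ q.1.enum) q.2 := by
  refine measurable_from_prod_countable_right fun S => ?_
  exact (K.measurable_stat hf).comp (measurable_prodMk_left (x := z ∘ S.enum))

theorem integral_stat_sub (hf : Measurable f) (hC : ∀ a, |f a| ≤ C) (hsn : s ≤ n)
    (z : Fin n → 𝒵) :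
    ∫ q, K.stat f (z ∘ q.1.enum) q.2 ∂(K.subLaw n) = K.fullStat f z := by
  have := Subsample.nonempty hsn
  have : IsProbabilityMeasure (uniformOn (Set.univ : Set (Subsample n s))) :=
    isProbabilityMeasure_uniformOn Set.finite_univ Set.univ_nonempty
  rw [subLaw, integral_prod, Subsample.integral_uniformOn]
  · rfl
  · exact integrable_of_abs_le (K.measurable_stat_sub hf z) fun q => K.abs_stat_le hC _ _

/-- The error from using finitely many sub-samples. -/
theorem integral_resampled_sub_sq_le (hf : Measurable f) (hC : ∀ a, |f a| ≤ C) (hsn : s ≤ n)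
    (hB : 0 < B) {a : (Fin n → 𝒵) → ℝ} (ha : Measurable a) {D : ℝ} (hD : ∀ z, |a z| ≤ D) :
    ∫ ω, (K.resampled f ω.1 ω.2 - a ω.1) ^ 2
        ∂((Measure.pi fun _ => P).prod (Measure.pi fun _ : Fin B => K.subLaw n)) ≤
      2 * (C ^ 2 / B + ∫ z, (K.fullStat f z - a z) ^ 2 ∂(Measure.pi fun _ => P)) := by
  have := K.isProbabilityMeasure_subLaw hsn
  have hmR := K.measurable_resampled (n := n) (B := B) hf
  have hmU := K.measurable_fullStat (n := n) hf
  have hsq : ∀ {x y c e : ℝ}, |x| ≤ c → |y| ≤ e → |(x - y) ^ 2| ≤ (c + e) ^ 2 := by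
    intro x y c e hx hy
    rw [abs_pow]
    exact pow_le_pow_left₀ (abs_nonneg _) ((abs_sub _ _).trans (add_le_add hx hy)) 2
  have hi1 : Integrable (fun ω : (Fin n → 𝒵) × (Fin B → Subsample n s × Ξ) =>
      (K.resampled f ω.1 ω.2 - K.fullStat f ω.1) ^ 2)
      ((Measure.pi fun _ => P).prod (Measure.pi fun _ : Fin B => K.subLaw n)) :=
    integrable_of_abs_le ((hmR.sub (hmU.comp measurable_fst)).pow_const 2) fun ω =>
      hsq (K.abs_resampled_le hC hB _ _) (K.abs_fullStat_le hC hsn _)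
  have hi2 : Integrable (fun z : Fin n → 𝒵 => (K.fullStat f z - a z) ^ 2)
      (Measure.pi fun _ => P) :=
    integrable_of_abs_le ((hmU.sub ha).pow_const 2) fun z =>
      hsq (K.abs_fullStat_le hC hsn _) (hD z)
  -- Given the data, the `B` sub-sample statistics are i.i.d. with mean `fullStat` and bounded by
  -- `C`.
  have h1 : ∫ ω, (K.resampled f ω.1 ω.2 - K.fullStat f ω.1) ^ 2
      ∂((Measure.pi fun _ => P).prod (Measure.pi fun _ : Fin B => K.subLaw n)) ≤ C ^ 2 / B := by
    rw [integral_prod _ hi1]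
    have h2 : ∀ z : Fin n → 𝒵, ∫ u, (K.resampled f z u - K.fullStat f z) ^ 2
        ∂(Measure.pi fun _ : Fin B => K.subLaw n) ≤ C ^ 2 / B := by
      intro z
      have := integral_average_sub_mean_sq_le (K.subLaw n) (K.measurable_stat_sub hf z)
        (fun q => K.abs_stat_le hC _ _) hB
      rw [K.integral_stat_sub hf hC hsn] at this
      simpa only [resampled_eq] using this
    calc _ ≤ ∫ _z, C ^ 2 / B ∂(Measure.pi fun _ : Fin n => P) :=
          integral_mono hi1.integral_prod_left (integrable_const _) h2
      _ = C ^ 2 / B := by simp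
  have h3 : Integrable (fun ω : (Fin n → 𝒵) × (Fin B → Subsample n s × Ξ) =>
      (K.fullStat f ω.1 - a ω.1) ^ 2)
      ((Measure.pi fun _ => P).prod (Measure.pi fun _ : Fin B => K.subLaw n)) := hi2.comp_fst _
  calc _ ≤ ∫ ω, 2 * ((K.resampled f ω.1 ω.2 - K.fullStat f ω.1) ^ 2 +
        (K.fullStat f ω.1 - a ω.1) ^ 2)
        ∂((Measure.pi fun _ => P).prod (Measure.pi fun _ : Fin B => K.subLaw n)) := by
        refine integral_mono ?_ ((hi1.add h3).const_mul 2) fun ω => ?_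
        · exact integrable_of_abs_le ((hmR.sub (ha.comp measurable_fst)).pow_const 2) fun ω =>
            hsq (K.abs_resampled_le hC hB _ _) (hD ω.1)
        · simp only []
          nlinarith [sq_nonneg (K.resampled f ω.1 ω.2 - K.fullStat f ω.1 -
            (K.fullStat f ω.1 - a ω.1))]
    _ = 2 * (∫ ω, (K.resampled f ω.1 ω.2 - K.fullStat f ω.1) ^ 2
          ∂((Measure.pi fun _ => P).prod (Measure.pi fun _ : Fin B => K.subLaw n)) +
        ∫ z, (K.fullStat f z - a z) ^ 2 ∂(Measure.pi fun _ => P)) := by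
        rw [integral_const_mul, integral_add hi1 h3,
          integral_fun_fst (fun z => (K.fullStat f z - a z) ^ 2)]
        simp
    _ ≤ _ := by gcongr

/-- The statistic of a sub-sample as a bounded function of all observations. -/
def subStat (hf : Measurable f) (hC : ∀ a, |f a| ≤ C) (S : Subsample n s) :
    bddMeas (Fin n → 𝒵) :=
  ⟨fun z => K.meanStat f (z ∘ S.enum),
    (K.measurable_meanStat hf).comp (measurable_comp_enum S), C, fun _ => K.abs_meanStat_le hC _⟩

theorem comp_enum_update_of_notMem (S : Subsample n s) {i : Fin n} (hi : i ∉ S.1)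
    (z : Fin n → 𝒵) (a : 𝒵) : update z i a ∘ S.enum = z ∘ S.enum := by
  ext j
  have : S.enum j ≠ i := fun h => hi (h ▸ S.enum_mem j)
  simp [update_of_ne this]

theorem comp_enum_update (S : Subsample n s) (j : Fin s) (z : Fin n → 𝒵) (a : 𝒵) :
    update z (S.enum j) a ∘ S.enum = update (z ∘ S.enum) j a :=
  update_comp_eq_of_injective z S.enum.injective j a

theorem integral_meanStat_enum (hf : Measurable f) (S : Subsample n s) :
    ∫ z : Fin n → 𝒵, K.meanStat f (z ∘ S.enum) ∂(Measure.pi fun _ => P) =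
      ∫ y, K.meanStat f y ∂(Measure.pi fun _ => P) :=
  integral_comp_injective P S.enum.injective (K.measurable_meanStat hf)

theorem integral_fullStat (hf : Measurable f) (hC : ∀ a, |f a| ≤ C) (hsn : s ≤ n) :
    ∫ z : Fin n → 𝒵, K.fullStat f z ∂(Measure.pi fun _ => P) =
      ∫ y, K.meanStat f y ∂(Measure.pi fun _ => P) := by
  have := Subsample.nonempty hsn
  have hc : (Fintype.card (Subsample n s) : ℝ) ≠ 0 := by exact_mod_cast Fintype.card_ne_zero
  simp only [fullStat]
  rw [integral_const_mul, integral_finsetSum]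
  · simp only [K.integral_meanStat_enum hf, Finset.sum_const, Finset.card_univ, nsmul_eq_mul]
    field_simp
  · exact fun S _ => bddMeas.integrable (K.subStat hf hC S)

theorem fullStat_eq_subStat (hf : Measurable f) (hC : ∀ a, |f a| ≤ C) :
    K.fullStat (n := n) f =
      ((Fintype.card (Subsample n s) : ℝ)⁻¹ • ∑ S, K.subStat (n := n) hf hC S).1 := by
  ext z
  simp [fullStat, subStat, AddSubmonoidClass.coe_finsetSum, Finset.sum_apply]

theorem average_integral_subStat_sq (hf : Measurable f) (hC : ∀ a, |f a| ≤ C) (hsn : s ≤ n) :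
    (Fintype.card (Subsample n s) : ℝ)⁻¹ *
      ∑ S, ∫ z, (K.subStat (n := n) hf hC S).1 z ^ 2 ∂(Measure.pi fun _ => P) =
    ∫ y, K.meanStat f y ^ 2 ∂(Measure.pi fun _ => P) := by
  have := Subsample.nonempty hsn
  have hc : (Fintype.card (Subsample n s) : ℝ) ≠ 0 := by exact_mod_cast Fintype.card_ne_zero
  have h : ∀ S : Subsample n s, ∫ z, (K.subStat (n := n) hf hC S).1 z ^ 2 ∂(Measure.pi fun _ => P) =
      ∫ y, K.meanStat f y ^ 2 ∂(Measure.pi fun _ => P) := fun S =>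
    integral_comp_injective P S.enum.injective ((K.measurable_meanStat hf).pow_const 2)
  simp only [h, Finset.sum_const, Finset.card_univ, nsmul_eq_mul]
  field_simp

/-- The factor s/n is the proportion of subsets containing a given observation. Keeping the second
moment instead of `C ^ 2` makes the bound small when `f` is a small nuisance effect. -/
theorem integral_fullStat_sub_mean_sq_le (hf : Measurable f) (hC : ∀ a, |f a| ≤ C) (hs : 0 < s)
    (hsn : s ≤ n) :
    ∫ z : Fin n → 𝒵, (K.fullStat f z - ∫ y, K.meanStat f y ∂(Measure.pi fun _ => P)) ^ 2
        ∂(Measure.pi fun _ => P) ≤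
      (s : ℝ) / n * ∫ y, K.meanStat f y ^ 2 ∂(Measure.pi fun _ => P) := by
  have := nonempty_of_isProbabilityMeasure P
  have h := integral_average_sub_sq_le (P := P) (fun S : Subsample n s => S.1)
    (K.subStat (n := n) hf hC)
    (fun S i hi z a => congrArg (K.meanStat f) (comp_enum_update_of_notMem S hi z a))
    (p := (s : ℝ) / n) (by positivity) (fun i => (Subsample.card_filter_mem hs i).le) _ rfl
  rwa [← K.fullStat_eq_subStat hf hC, K.average_integral_subStat_sq hf hC hsn,
    K.integral_fullStat hf hC hsn] at h

variable [NeZero s]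

/-- Fixing observation `i` changes only the terms of subsets containing it, a proportion s/n. By
symmetry each of them has conditional mean `firstProj`, whatever the position of `i` in the subset.
-/
theorem integral_fullStat_update (hf : Measurable f) (hC : ∀ a, |f a| ≤ C) (hsn : s ≤ n)
    (i : Fin n) (a : 𝒵) :
    ∫ z : Fin n → 𝒵, K.fullStat f (update z i a) ∂(Measure.pi fun _ => P) -
        ∫ y, K.meanStat f y ∂(Measure.pi fun _ => P) =
      (s : ℝ) / n * (K.firstProj P f a - ∫ y, K.meanStat f y ∂(Measure.pi fun _ => P)) := by
  have := Subsample.nonempty hsn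
  have hc : (Fintype.card (Subsample n s) : ℝ) ≠ 0 := by exact_mod_cast Fintype.card_ne_zero
  set m := ∫ y, K.meanStat f y ∂(Measure.pi fun _ => P) with hm
  have hu : Measurable fun z : Fin n → 𝒵 => update z i a :=
    (measurable_update_prod i).comp (measurable_id.prodMk measurable_const)
  have h1 : ∀ S : Subsample n s, ∫ z : Fin n → 𝒵, K.meanStat f (update z i a ∘ S.enum)
      ∂(Measure.pi fun _ => P) = m + if i ∈ S.1 then K.firstProj P f a - m else 0 := by
    intro S
    split_ifs with hi
    · obtain ⟨j, rfl⟩ := S.exists_enum_eq hi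
      simp only [comp_enum_update]
      rw [add_sub_cancel, ← K.integral_meanStat_update hf j a]
      exact integral_comp_injective P S.enum.injective (f := fun y => K.meanStat f (update y j a))
        ((K.measurable_meanStat hf).comp
          ((measurable_update_prod j).comp (measurable_id.prodMk measurable_const)))
    · simp only [comp_enum_update_of_notMem S hi, K.integral_meanStat_enum hf, add_zero, hm]
  simp only [fullStat]
  rw [integral_const_mul, integral_finsetSum]
  · simp only [h1, Finset.sum_add_distrib, ← Finset.sum_filter, Finset.sum_const, Finset.card_univ,
      nsmul_eq_mul]
    rw [Subsample.card_filter_mem (Nat.pos_of_ne_zero (NeZero.ne s)) i]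
    field_simp
    ring
  · exact fun S _ => integrable_of_abs_le (((K.measurable_meanStat hf).comp
      (measurable_comp_enum S)).comp hu) fun _ => K.abs_meanStat_le hC _

/-- The average over all sub-samples is close to a sum of independent variables. -/
theorem integral_fullStat_sub_projection_sq_le (hf : Measurable f) (hC : ∀ a, |f a| ≤ C)
    (hsn : s ≤ n) :
    ∫ z : Fin n → 𝒵, (K.fullStat f z - (∫ y, K.meanStat f y ∂(Measure.pi fun _ => P) +
        (s : ℝ) / n * ∑ i, (K.firstProj P f (z i) - ∫ a, K.firstProj P f a ∂P))) ^ 2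
        ∂(Measure.pi fun _ => P) ≤
      ((s : ℝ) / n) ^ 2 * ∫ y, K.meanStat f y ^ 2 ∂(Measure.pi fun _ => P) := by
  have := nonempty_of_isProbabilityMeasure P
  have h := integral_average_sub_projection_sq_le (P := P) (fun S : Subsample n s => S.1)
    (K.subStat (n := n) hf hC)
    (fun S i hi z a => congrArg (K.meanStat f) (comp_enum_update_of_notMem S hi z a))
    (p := ((s : ℝ) / n) ^ 2) (by positivity)
    (fun i j hij => Subsample.card_filter_pair_le hsn hij) _ rfl
  rw [← K.fullStat_eq_subStat hf hC, K.average_integral_subStat_sq hf hC hsn,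
    K.integral_fullStat hf hC hsn] at h
  simp only [K.integral_fullStat_update hf hC hsn, ← Finset.mul_sum] at h
  simpa only [K.integral_firstProj hf hC, ← sub_sub] using h

end BaseKernel

/-! ### Honesty -/

/-- Under conditional independence, conditional expectations of products factorize. -/
theorem condExp_mul_comp_of_condIndepFun {Ω β : Type*} {m m₀ : MeasurableSpace Ω}
    [StandardBorelSpace Ω] [MeasurableSpace β] [MeasurableSpace.CountablyGenerated β]
    (hm : m ≤ m₀) {μ : Measure Ω} [IsProbabilityMeasure μ] {X : Ω → ℝ} {Y : Ω → β}
    (hX : Measurable X) (hY : Measurable Y) (h : CondIndepFun m hm X Y μ) {φ : β → ℝ}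
    (hφ : Measurable φ) (hXi : Integrable X μ) (hφi : Integrable (fun ω => φ (Y ω)) μ)
    (hXφ : Integrable (fun ω => X ω * φ (Y ω)) μ) :
    μ[fun ω => X ω * φ (Y ω) | m] =ᵐ[μ] fun ω => (μ[X | m]) ω * (μ[fun ω => φ (Y ω) | m]) ω := by
  -- Almost surely the conditional joint law of `X` and `Y` is a product, so Fubini factorizes the
  -- integral.
  have h1 := ae_of_ae_trim hm ((condIndepFun_iff_map_prod_eq_prod_map_map hX hY).1 h)
  filter_upwards [h1, condExp_ae_eq_integral_condExpKernel hm hXφ,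
    condExp_ae_eq_integral_condExpKernel hm hXi,
    condExp_ae_eq_integral_condExpKernel hm hφi] with ω h2 h3 h4 h5
  rw [h3, h4, h5]
  have hXY : Measurable fun ω => (X ω, Y ω) := hX.prodMk hY
  rw [Kernel.map_apply _ hXY, Kernel.prod_apply, Kernel.map_apply _ hX, Kernel.map_apply _ hY] at h2
  have hmul : Measurable fun p : ℝ × β => p.1 * φ p.2 :=
    measurable_fst.mul (hφ.comp measurable_snd)
  have : IsProbabilityMeasure (condExpKernel μ m ω) := inferInstance
  have i1 : IsProbabilityMeasure ((condExpKernel μ m ω).map X) :=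
    Measure.isProbabilityMeasure_map hX.aemeasurable
  have i2 : IsProbabilityMeasure ((condExpKernel μ m ω).map Y) :=
    Measure.isProbabilityMeasure_map hY.aemeasurable
  calc ∫ y, X y * φ (Y y) ∂condExpKernel μ m ω
      = ∫ p, p.1 * φ p.2 ∂((condExpKernel μ m ω).map fun ω => (X ω, Y ω)) := by
        rw [integral_map hXY.aemeasurable hmul.aestronglyMeasurable]
    _ = (∫ u, u ∂((condExpKernel μ m ω).map X)) * ∫ v, φ v ∂((condExpKernel μ m ω).map Y) := by
        rw [h2]
        exact integral_prod_mul (fun u : ℝ => u) φ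
    _ = _ := by
        rw [integral_map hX.aemeasurable (by fun_prop),
          integral_map hY.aemeasurable hφ.aestronglyMeasurable]

namespace Model

variable {d p : ℕ} {W : Type*} [MeasurableSpace W] (M : Model d p W) {F : Obs d W → ℝ} {C : ℝ}

theorem measurable_feat : Measurable (Obs.feat : Obs d W → Cube d) := measurable_fst

theorem measurable_condMean (hF : Measurable F) : Measurable (M.condMean F) := by
  unfold condMean
  exact (StronglyMeasurable.integral_kernel_prod_right' (κ := M.condLaw)
    hF.stronglyMeasurable).measurable

theorem abs_condMean_le (hC : ∀ z, |F z| ≤ C) (x : Cube d) : |M.condMean F x| ≤ C :=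
  abs_integral_le_of_abs_le fun _ => hC _

theorem integral_mul_condMean (hF : Measurable F) (hC : ∀ z, |F z| ≤ C) {k : Cube d → ℝ}
    (hk : Measurable k) {D : ℝ} (hD : ∀ x, |k x| ≤ D) :
    ∫ z, k z.feat * F z ∂M.obsLaw = ∫ z, k z.feat * M.condMean F z.feat ∂M.obsLaw := by
  have hb : ∀ {u v : ℝ}, |u| ≤ D → |v| ≤ C → |u * v| ≤ D * C := by
    intro u v hu hv
    rw [abs_mul]
    exact mul_le_mul hu hv (abs_nonneg _) ((abs_nonneg _).trans hu)
  have h1 : Integrable (fun z : Obs d W => k z.feat * F z) M.obsLaw :=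
    integrable_of_abs_le ((hk.comp measurable_feat).mul hF) fun z => hb (hD _) (hC z)
  have h2 : Integrable (fun z : Obs d W => k z.feat * M.condMean F z.feat) M.obsLaw :=
    integrable_of_abs_le ((hk.comp measurable_feat).mul
      ((M.measurable_condMean hF).comp measurable_feat)) fun z => hb (hD _) (M.abs_condMean_le hC _)
  unfold obsLaw at h1 h2 ⊢
  rw [Measure.integral_compProd h1, Measure.integral_compProd h2]
  simp only [Obs.feat, condMean, integral_const_mul, integral_const, probReal_univ, smul_eq_mul,
    one_mul]

theorem measurable_psi {a g : Cube d → W → ℝ} (ha : Measurable (Function.uncurry a))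
    (hg : Measurable (Function.uncurry g)) (hm : Measurable fun z => M.moment z g) :
    Measurable (M.psi a g) := by
  have h : ∀ {b : Cube d → W → ℝ}, Measurable (Function.uncurry b) →
      Measurable fun z : Obs d W => b z.feat z.extra := fun hb =>
    hb.comp (measurable_fst.prodMk (measurable_snd.comp measurable_snd))
  exact hm.add ((h ha).mul ((measurable_fst.comp measurable_snd).sub (h hg)))

end Model

namespace BaseKernel

open Function

variable {d p : ℕ} {W Ξ : Type*} [MeasurableSpace W] [StandardBorelSpace W] [MeasurableSpace Ξ]
  [StandardBorelSpace Ξ] {s : ℕ} (K : BaseKernel (Obs d W) Ξ s) {M : Model d p W}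

/-- The information that is conditioned on in the honesty condition. -/
abbrev honestySigma (d : ℕ) (W Ξ : Type*) [MeasurableSpace W] [MeasurableSpace Ξ] {s : ℕ}
    (j : Fin s) : MeasurableSpace ((Fin s → Obs d W) × Ξ) :=
  MeasurableSpace.comap (honestyInfo (Ξ := Ξ) (d := d) (W := W) j) inferInstance

/-- Under honesty, in averages against the weight of a point, a function of its debiased moments may
be replaced by its conditional mean given the features of the point. -/
theorem integral_weight_mul_of_honest {a g : Cube d → W → ℝ} (hH : K.Honest M a g)
    (h1 : Measurable (M.psi a g)) (h0 : Measurable (M.psi M.a0 M.g0)) {φ : ℝ × ℝ → ℝ}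
    (hφ : Measurable φ) {C : ℝ} (hC : ∀ v, |φ v| ≤ C) (j : Fin s) :
    ∫ ω, K.weight ω.1 ω.2 j * φ (M.psi a g (ω.1 j), M.psi M.a0 M.g0 (ω.1 j)) ∂(K.jointLaw M.obsLaw) =
      ∫ ω, K.weight ω.1 ω.2 j *
        M.condMean (fun z => φ (M.psi a g z, M.psi M.a0 M.g0 z)) (ω.1 j).feat
          ∂(K.jointLaw M.obsLaw) := by
  set F : Obs d W → ℝ := fun z => φ (M.psi a g z, M.psi M.a0 M.g0 z) with hF
  set J := K.jointLaw M.obsLaw with hJ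
  have hFm : Measurable F := hφ.comp (h1.prodMk h0)
  have hFC : ∀ z, |F z| ≤ C := fun z => hC _
  have hC0 : 0 ≤ C := (abs_nonneg _).trans (hC 0)
  set X : (Fin s → Obs d W) × Ξ → ℝ := fun ω => K.weight ω.1 ω.2 j with hX
  set Y : (Fin s → Obs d W) × Ξ → ℝ × ℝ :=
    fun ω => (M.psi a g (ω.1 j), M.psi M.a0 M.g0 (ω.1 j)) with hY
  have hmle : honestySigma d W Ξ j ≤ _ := (measurable_honestyInfo (Ξ := Ξ) (d := d) (W := W) j).comap_le
  have hXm : Measurable X := (measurable_pi_apply j).comp K.measurable_weight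
  have hev : Measurable fun ω : (Fin s → Obs d W) × Ξ => ω.1 j := by fun_prop
  have hYm : Measurable Y := (h1.comp hev).prodMk (h0.comp hev)
  have hX1 : ∀ ω, |X ω| ≤ 1 := fun ω => by
    rw [abs_of_nonneg (K.nonneg _ _ _)]; exact K.weight_le_one _ _ _
  have hprod : ∀ {α : Type _} {u v : α → ℝ} {A B : ℝ}, (∀ ω, |u ω| ≤ A) → (∀ ω, |v ω| ≤ B) →
      ∀ ω, |u ω * v ω| ≤ A * B := by
    intro α u v A B hu hv ω
    rw [abs_mul]
    exact mul_le_mul (hu ω) (hv ω) (abs_nonneg _) ((abs_nonneg _).trans (hu ω))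
  have hXi : Integrable X J := integrable_of_abs_le hXm hX1
  have hFi : Integrable (fun ω => F (ω.1 j)) J :=
    integrable_of_abs_le (hFm.comp hev) fun ω => hFC _
  have hXF : Integrable (fun ω => X ω * F (ω.1 j)) J :=
    integrable_of_abs_le (hXm.mul (hFm.comp hev)) (hprod hX1 fun ω => hFC _)
  -- a version of the conditional mean of the weight
  obtain ⟨k₀, hk₀, hk₀'⟩ : ∃ k₀, Measurable k₀ ∧ J[X | honestySigma d W Ξ j] = k₀ ∘ honestyInfo j :=
    Measurable.exists_eq_measurable_comp (f := honestyInfo (Ξ := Ξ) (d := d) (W := W) j)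
      stronglyMeasurable_condExp.measurable
  -- The conditional mean lies in [0, 1] only almost surely; clamping makes the bound hold
  -- everywhere.
  set k : Cube d × ({i : Fin s // i ≠ j} → Obs d W) → ℝ := fun v => max 0 (min 1 (k₀ v)) with hk
  have hkm : Measurable k := measurable_const.max (measurable_const.min hk₀)
  have hk1 : ∀ v, |k v| ≤ 1 := fun v => by
    rw [abs_of_nonneg (le_max_left _ _)]
    exact max_le zero_le_one (min_le_left _ _)
  have hkX : J[X | honestySigma d W Ξ j] =ᵐ[J] fun ω => k (honestyInfo j ω) := by
    have hge : 0 ≤ᵐ[J] J[X | honestySigma d W Ξ j] := condExp_nonneg (ae_of_all _ fun ω => K.nonneg _ _ _)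
    have hle : J[X | honestySigma d W Ξ j] ≤ᵐ[J] J[fun _ => (1 : ℝ) | honestySigma d W Ξ j] :=
      condExp_mono hXi (integrable_const _) (ae_of_all _ fun ω => K.weight_le_one _ _ _)
    rw [condExp_const hmle] at hle
    filter_upwards [hge, hle] with ω h2 h3
    have h4 : (J[X | honestySigma d W Ξ j]) ω = k₀ (honestyInfo j ω) := congrFun hk₀' ω
    simp only [Pi.zero_apply] at h2
    rw [h4] at h2 h3
    rw [h4]
    simp only [hk]
    rw [min_eq_right h3, max_eq_right h2]
  have hinfo : Measurable[honestySigma d W Ξ j] (honestyInfo (Ξ := Ξ) (d := d) (W := W) j) := comap_measurable _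
  have hinfo' := measurable_honestyInfo (Ξ := Ξ) (d := d) (W := W) j
  -- With the other points fixed, `k` is a function of the features of point `j` alone. Integrating
  -- out that point reduces the claim to the disintegration of its law.
  have hmain : ∫ ω, k (honestyInfo j ω) * F (ω.1 j) ∂J =
      ∫ ω, k (honestyInfo j ω) * M.condMean F (ω.1 j).feat ∂J := by
    have hsplit : ∀ {G : Obs d W → ℝ} (_ : Measurable G) (_ : ∀ z, |G z| ≤ C),
        ∫ ω, k (honestyInfo j ω) * G (ω.1 j) ∂J = ∫ y : Fin s → Obs d W,
          ∫ b : Obs d W, k (b.feat, fun i : {i : Fin s // i ≠ j} => y i) * G b ∂M.obsLaw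
            ∂(Measure.pi fun _ => M.obsLaw) := by
      intro G hG hGC
      have hn : Measurable fun y : Fin s → Obs d W =>
          k ((y j).feat, fun i : {i : Fin s // i ≠ j} => y i) * G (y j) := by
        refine (hkm.comp ((Model.measurable_feat.comp (measurable_pi_apply j)).prodMk
          (measurable_pi_lambda _ fun i => measurable_pi_apply _))).mul
          (hG.comp (measurable_pi_apply j))
      have h3 := integral_fun_fst (μ := Measure.pi fun _ : Fin s => M.obsLaw) (ν := K.law)
        (fun y : Fin s → Obs d W => k ((y j).feat, fun i : {i : Fin s // i ≠ j} => y i) * G (y j))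
      rw [probReal_univ, one_smul] at h3
      refine h3.trans ?_
      rw [← integral_update M.obsLaw
        (integrable_of_abs_le hn (C := 1 * C) fun y => by
          rw [abs_mul]; exact mul_le_mul (hk1 _) (hGC _) (abs_nonneg _) zero_le_one) j]
      refine integral_congr_ae (ae_of_all _ fun y => integral_congr_ae (ae_of_all _ fun b => ?_))
      simp only [update_self]
      congr 3
      funext i
      rw [update_of_ne i.2]
    rw [hsplit hFm hFC, hsplit (G := fun z => M.condMean F z.feat)
      ((M.measurable_condMean hFm).comp Model.measurable_feat) fun z => M.abs_condMean_le hFC _]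
    refine integral_congr_ae (ae_of_all _ fun y => ?_)
    exact M.integral_mul_condMean hFm hFC
      (k := fun x => k (x, fun i : {i : Fin s // i ≠ j} => y i))
      (hkm.comp measurable_prodMk_right) fun x => hk1 _
  have hpull : ∀ {G : (Fin s → Obs d W) × Ξ → ℝ} {U V : (Fin s → Obs d W) × Ξ → ℝ},
      J[G | honestySigma d W Ξ j] =ᵐ[J] V → J[U | honestySigma d W Ξ j] =ᵐ[J] V → ∫ ω, G ω ∂J = ∫ ω, U ω ∂J := by
    intro G U V hG hU
    rw [← integral_condExp hmle (f := G), ← integral_condExp hmle (f := U)]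
    exact integral_congr_ae (hG.trans hU.symm)
  -- Honesty trades the weight for its conditional mean, after which `F` can be averaged given the
  -- features. The result is known given the conditioning information, so the weight can be put
  -- back.
  calc ∫ ω, X ω * F (ω.1 j) ∂J = ∫ ω, k (honestyInfo j ω) * F (ω.1 j) ∂J := by
        refine hpull (V := fun ω => k (honestyInfo j ω) * (J[fun ω => F (ω.1 j) | honestySigma d W Ξ j]) ω) ?_ ?_
        · have := condExp_mul_comp_of_condIndepFun hmle hXm hYm (hH j) hφ hXi hFi hXF
          refine this.trans ?_
          filter_upwards [hkX] with ω hω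
          rw [hω]
        · exact condExp_mul_of_stronglyMeasurable_left (hkm.comp hinfo).stronglyMeasurable
            (integrable_of_abs_le ((hkm.comp hinfo').mul (hFm.comp hev))
              (hprod (fun _ => hk1 _) fun ω => hFC _)) hFi
    _ = ∫ ω, k (honestyInfo j ω) * M.condMean F (ω.1 j).feat ∂J := hmain
    _ = ∫ ω, (J[X | honestySigma d W Ξ j]) ω * M.condMean F (ω.1 j).feat ∂J := by
        refine integral_congr_ae ?_
        filter_upwards [hkX] with ω hω
        rw [hω]
    _ = ∫ ω, X ω * M.condMean F (ω.1 j).feat ∂J := by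
        have hfm : Measurable[honestySigma d W Ξ j] fun ω : (Fin s → Obs d W) × Ξ => (ω.1 j).feat :=
          Measurable.comp (g := Prod.fst) (f := honestyInfo j) measurable_fst hinfo
        have := condExp_mul_of_stronglyMeasurable_right (m := honestySigma d W Ξ j) (μ := J) (f := X)
          (g := fun ω => M.condMean F (ω.1 j).feat)
          ((M.measurable_condMean hFm).comp hfm).stronglyMeasurable
          (integrable_of_abs_le (hXm.mul ((M.measurable_condMean hFm).comp
            (Model.measurable_feat.comp hev))) (hprod hX1 fun ω => M.abs_condMean_le hFC _)) hXi
        rw [← integral_condExp hmle (f := fun ω => X ω * M.condMean F (ω.1 j).feat)]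
        exact (integral_congr_ae this).symm

/-- Applied with `φ` the truncated difference of the two moments, its square, and the truncated true
moment alone. -/
theorem integral_stat_of_honest {a g : Cube d → W → ℝ} (hH : K.Honest M a g)
    (h1 : Measurable (M.psi a g)) (h0 : Measurable (M.psi M.a0 M.g0)) {φ : ℝ × ℝ → ℝ}
    (hφ : Measurable φ) {C : ℝ} (hC : ∀ v, |φ v| ≤ C) :
    ∫ ω, K.stat (fun z => φ (M.psi a g z, M.psi M.a0 M.g0 z)) ω.1 ω.2 ∂(K.jointLaw M.obsLaw) =
      ∫ ω, K.stat (fun z => M.condMean (fun z => φ (M.psi a g z, M.psi M.a0 M.g0 z)) z.feat)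
        ω.1 ω.2 ∂(K.jointLaw M.obsLaw) := by
  have hFm : Measurable fun z => φ (M.psi a g z, M.psi M.a0 M.g0 z) := hφ.comp (h1.prodMk h0)
  have hi : ∀ {G : Obs d W → ℝ} (_ : Measurable G) (_ : ∀ z, |G z| ≤ C) (j : Fin s),
      Integrable (fun ω : (Fin s → Obs d W) × Ξ => K.weight ω.1 ω.2 j * G (ω.1 j))
        (K.jointLaw M.obsLaw) := by
    intro G hG hGC j
    refine integrable_of_abs_le (C := 1 * C) (((measurable_pi_apply j).comp
      K.measurable_weight).mul (hG.comp ((measurable_pi_apply j).comp measurable_fst))) fun ω => ?_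
    rw [abs_mul]
    refine mul_le_mul ?_ (hGC _) (abs_nonneg _) zero_le_one
    rw [abs_of_nonneg (K.nonneg _ _ _)]
    exact K.weight_le_one _ _ _
  simp only [stat]
  rw [integral_finsetSum, integral_finsetSum]
  · exact Finset.sum_congr rfl fun j _ => K.integral_weight_mul_of_honest hH h1 h0 hφ hC j
  · exact fun j _ => hi ((M.measurable_condMean hFm).comp Model.measurable_feat)
      (fun z => M.abs_condMean_le (fun _ => hC _) _) j
  · exact fun j _ => hi hFm (fun z => hC _) j

end BaseKernel

/-! ### Truncation, and double robustness of the conditional moment -/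

/-- Truncation to `[-C, C]`. -/
def clamp (C v : ℝ) : ℝ := max (-C) (min C v)

theorem measurable_clamp (C : ℝ) : Measurable (clamp C) :=
  measurable_const.max (measurable_const.min measurable_id)

theorem abs_clamp_le {C : ℝ} (hC : 0 ≤ C) (v : ℝ) : |clamp C v| ≤ C :=
  abs_le.2 ⟨le_max_left _ _, max_le (by linarith) (min_le_left _ _)⟩

theorem clamp_eq_self {C v : ℝ} (h : |v| ≤ C) : clamp C v = v := by
  obtain ⟨h1, h2⟩ := abs_le.1 h
  rw [clamp, min_eq_right h2, max_eq_right h1]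

namespace Model

open Function

variable {d p : ℕ} {W : Type*} [MeasurableSpace W] {M : Model d p W}

theorem measurable_psi_of_mem (hw : M.WellPosed) {a g : Cube d → W → ℝ} (ha : a ∈ M.admissible)
    (hg : g ∈ M.admissible) : Measurable (M.psi a g) :=
  M.measurable_psi (hw.measurable_admissible a ha) (hw.measurable_admissible g hg)
    (hw.measurable_moment g hg)

theorem BoundedMoment.nonneg (hw : M.WellPosed) {psiMax : ℝ} (hb : M.BoundedMoment psiMax)
    (x : Cube d) : 0 ≤ psiMax := by
  obtain ⟨q, hq⟩ := (hb _ hw.g0_mem _ hw.a0_mem x).exists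
  exact (abs_nonneg _).trans hq

theorem BoundedMoment.ae_obsLaw {psiMax : ℝ} (hw : M.WellPosed) (hb : M.BoundedMoment psiMax)
    {a g : Cube d → W → ℝ} (ha : a ∈ M.admissible) (hg : g ∈ M.admissible) :
    ∀ᵐ z ∂M.obsLaw, clamp psiMax (M.psi a g z) = M.psi a g z := by
  have hm := measurable_psi_of_mem hw ha hg
  have : ∀ᵐ z ∂M.obsLaw, |M.psi a g z| ≤ psiMax := by
    rw [obsLaw, Measure.ae_compProd_iff (measurableSet_le hm.abs measurable_const)]
    exact ae_of_all _ fun x => hb g hg a ha x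
  filter_upwards [this] with z hz
  exact clamp_eq_self hz

variable {νg νa : Cube d → EuclideanSpace ℝ (Fin p)} {psiMax : ℝ} {L Lh : ℝ≥0}

theorem integrable_psi (hw : M.WellPosed) (hb : M.BoundedMoment psiMax) {a g : Cube d → W → ℝ}
    (ha : a ∈ M.admissible) (hg : g ∈ M.admissible) (x : Cube d) :
    Integrable (fun q => M.psi a g (x, q)) (M.condLaw x) :=
  Integrable.of_bound ((measurable_psi_of_mem hw ha hg).comp
    measurable_prodMk_left).aestronglyMeasurable psiMax (hb g hg a ha x)

/-- The conditional mean of the debiased moment. -/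
theorem condMean_psi (hw : M.WellPosed) (hreg : M.IsRegression) (hriesz : M.IsRiesz)
    (hb : M.BoundedMoment psiMax) (hνg : Measurable νg)
    (hg : M.ofParam νg ∈ M.admissible) {a : Cube d → W → ℝ} (ha : a ∈ M.admissible)
    (x : Cube d) :
    M.condMean (M.psi a (M.ofParam νg)) x =
      ∫ q, (M.a0 x q.2 * M.ofParam νg x q.2 +
        a x q.2 * (M.g0 x q.2 - M.ofParam νg x q.2)) ∂(M.condLaw x) := by
  set g := M.ofParam νg with hgdef
  obtain ⟨hm, hm'⟩ := hriesz x νg hνg (hw.memG _ hg x)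
  have hψ := integrable_psi hw hb ha hg x
  have hag : Integrable (fun q => a x q.2 * g x q.2) (M.condLaw x) :=
    (hw.memG a ha x).integrable_mul (hw.memG g hg x)
  have hag0 : Integrable (fun q => a x q.2 * M.g0 x q.2) (M.condLaw x) :=
    (hw.memG a ha x).integrable_mul (hw.memG _ hw.g0_mem x)
  have ha0g : Integrable (fun q => M.a0 x q.2 * g x q.2) (M.condLaw x) :=
    (hw.memG _ hw.a0_mem x).integrable_mul (hw.memG g hg x)
  -- Integrability of α Y comes from solving the definition of ψ for it: ψ is bounded, m(Z; g) is
  -- integrable by the Riesz property, and α g is a product of square-integrable functions.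
  have haY : Integrable (fun q : ℝ × W => a x q.2 * q.1) (M.condLaw x) := by
    have := (hψ.sub hm).add hag
    refine this.congr (ae_of_all _ fun q => ?_)
    simp only [psi, Obs.feat, Obs.extra, Obs.outcome, Pi.add_apply, Pi.sub_apply, ← hgdef]
    ring
  have hax : Measurable fun w => a x w :=
    (hw.measurable_admissible a ha).comp measurable_prodMk_left
  -- Conditioning on `W` as well turns `Y` into the regression function.
  have hEY : ∫ q, a x q.2 * q.1 ∂(M.condLaw x) = ∫ q, a x q.2 * M.g0 x q.2 ∂(M.condLaw x) := by
    have hle : MeasurableSpace.comap (Prod.snd : ℝ × W → W) inferInstance ≤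
      (inferInstance : MeasurableSpace (ℝ × W)) := measurable_snd.comap_le
    have h1 := condExp_mul_of_stronglyMeasurable_left
      (m := MeasurableSpace.comap (Prod.snd : ℝ × W → W) inferInstance) (μ := M.condLaw x)
      (f := fun q : ℝ × W => a x q.2) (g := fun q => q.1)
      (hax.comp (comap_measurable _)).stronglyMeasurable haY (hreg x).1
    rw [← integral_condExp hle (f := fun q : ℝ × W => a x q.2 * q.1)]
    refine integral_congr_ae ?_
    filter_upwards [h1, (hreg x).2] with q h2 h3
    refine h2.trans ?_
    rw [Pi.mul_apply, h3]
  calc M.condMean (M.psi a g) x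
      = ∫ q, (M.moment (x, q) g + (a x q.2 * q.1 - a x q.2 * g x q.2)) ∂(M.condLaw x) := by
        refine integral_congr_ae (ae_of_all _ fun q => ?_)
        simp only [psi, Obs.feat, Obs.extra, Obs.outcome]
        ring
    _ = ∫ q, M.a0 x q.2 * g x q.2 ∂(M.condLaw x) +
        (∫ q, a x q.2 * M.g0 x q.2 ∂(M.condLaw x) - ∫ q, a x q.2 * g x q.2 ∂(M.condLaw x)) := by
        have h : Integrable (fun q : ℝ × W => a x q.2 * q.1 - a x q.2 * g x q.2) (M.condLaw x) :=
          haY.sub hag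
        rw [integral_add hm h, integral_sub haY hag, hEY]
        exact congrArg (· + _) hm'
    _ = _ := by
        have h : Integrable (fun q => a x q.2 * M.g0 x q.2 - a x q.2 * g x q.2) (M.condLaw x) :=
          hag0.sub hag
        rw [← integral_sub hag0 hag, ← integral_add ha0g h]
        refine integral_congr_ae (ae_of_all _ fun q => ?_)
        ring

/-- At the true nuisances the correction term has conditional mean zero. -/
theorem condMean_psi_zero (hw : M.WellPosed) (hreg : M.IsRegression) (hriesz : M.IsRiesz)
    (hb : M.BoundedMoment psiMax) (x : Cube d) :
    M.condMean (M.psi M.a0 M.g0) x = M.theta0 x := by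
  have h := condMean_psi hw hreg hriesz hb hw.measurable_nuG hw.g0_mem hw.a0_mem x
  obtain ⟨_, hm'⟩ := hriesz x M.nuG hw.measurable_nuG (hw.memG _ hw.g0_mem x)
  refine h.trans ?_
  refine Eq.trans ?_ hm'.symm
  refine integral_congr_ae (ae_of_all _ fun q => ?_)
  simp [g0, Obs.feat, Obs.extra]

theorem abs_ofParam_sub_le (hlink : ∀ w, LipschitzWith Lh (M.link w))
    (ν ν' : Cube d → EuclideanSpace ℝ (Fin p)) (x : Cube d) (w : W) :
    |M.ofParam ν x w - M.ofParam ν' x w| ≤ Lh * ‖ν x - ν' x‖ := by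
  have := (hlink w).dist_le_mul (ν x) (ν' x)
  rwa [Real.dist_eq, dist_eq_norm] at this

/-- Double robustness: the bias of the debiased moment is of second order in the estimation
errors of the nuisance parameters. -/
theorem abs_condMean_psi_sub_le (hw : M.WellPosed) (hreg : M.IsRegression) (hriesz : M.IsRiesz)
    (hb : M.BoundedMoment psiMax) (hlink : ∀ w, LipschitzWith Lh (M.link w))
    (hνg : Measurable νg) (hg : M.ofParam νg ∈ M.admissible) (ha : M.ofParam νa ∈ M.admissible)
    (x : Cube d) :
    |M.condMean (M.psi (M.ofParam νa) (M.ofParam νg)) x - M.condMean (M.psi M.a0 M.g0) x| ≤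
      Lh ^ 2 * (‖νg x - M.nuG x‖ ^ 2 + ‖νa x - M.nuA x‖ ^ 2) := by
  rw [condMean_psi hw hreg hriesz hb hνg hg ha x, g0,
    condMean_psi hw hreg hriesz hb hw.measurable_nuG hw.g0_mem hw.a0_mem x]
  set g := M.ofParam νg
  set a := M.ofParam νa
  have hmul : ∀ {u v : Cube d → W → ℝ}, u ∈ M.admissible → v ∈ M.admissible →
      Integrable (fun q => u x q.2 * v x q.2) (M.condLaw x) := fun hu hv =>
    (hw.memG _ hu x).integrable_mul (hw.memG _ hv x)
  rw [← integral_sub]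
  · have h : ∀ q : ℝ × W, ‖M.a0 x q.2 * g x q.2 + a x q.2 * (M.g0 x q.2 - g x q.2) -
        (M.a0 x q.2 * M.ofParam M.nuG x q.2 +
          M.a0 x q.2 * (M.g0 x q.2 - M.ofParam M.nuG x q.2))‖ ≤
        Lh ^ 2 * (‖νg x - M.nuG x‖ ^ 2 + ‖νa x - M.nuA x‖ ^ 2) := by
      intro q
      have h1 := abs_ofParam_sub_le hlink νg M.nuG x q.2
      have h2 := abs_ofParam_sub_le hlink νa M.nuA x q.2
      -- All first-order terms cancel and only the product of the two nuisance errors is left.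
      have h3 : M.a0 x q.2 * g x q.2 + a x q.2 * (M.g0 x q.2 - g x q.2) -
          (M.a0 x q.2 * M.ofParam M.nuG x q.2 +
            M.a0 x q.2 * (M.g0 x q.2 - M.ofParam M.nuG x q.2)) =
          -((g x q.2 - M.ofParam M.nuG x q.2) * (a x q.2 - M.ofParam M.nuA x q.2)) := by
        simp only [g0, a0]
        ring
      rw [h3, norm_neg, norm_mul, Real.norm_eq_abs, Real.norm_eq_abs]
      calc _ ≤ (Lh * ‖νg x - M.nuG x‖) * (Lh * ‖νa x - M.nuA x‖) :=
            mul_le_mul h1 h2 (abs_nonneg _) (by positivity)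
        _ = Lh ^ 2 * (‖νg x - M.nuG x‖ * ‖νa x - M.nuA x‖) := by ring
        _ ≤ _ := by
            gcongr
            nlinarith [sq_nonneg (‖νg x - M.nuG x‖ - ‖νa x - M.nuA x‖),
              sq_nonneg ‖νg x - M.nuG x‖, sq_nonneg ‖νa x - M.nuA x‖]
    exact abs_integral_le_of_abs_le h
  · have : Integrable (fun q => M.a0 x q.2 * g x q.2 +
        (a x q.2 * M.ofParam M.nuG x q.2 - a x q.2 * g x q.2)) (M.condLaw x) :=
      (hmul hw.a0_mem hg).add ((hmul ha hw.g0_mem).sub (hmul ha hg))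
    simpa only [mul_sub] using this
  · have : Integrable (fun q => M.a0 x q.2 * M.ofParam M.nuG x q.2 +
        (M.a0 x q.2 * M.g0 x q.2 - M.a0 x q.2 * M.ofParam M.nuG x q.2)) (M.condLaw x) :=
      (hmul hw.a0_mem hw.g0_mem).add ((hmul hw.a0_mem hw.g0_mem).sub (hmul hw.a0_mem hw.g0_mem))
    simpa only [mul_sub] using this

/-- The bound holds almost surely under every conditional law, so truncation changes no conditional
mean at any feature value. -/
theorem condMean_clamp (hb : M.BoundedMoment psiMax) {a g a' g' : Cube d → W → ℝ}
    (ha : a ∈ M.admissible) (hg : g ∈ M.admissible) (ha' : a' ∈ M.admissible)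
    (hg' : g' ∈ M.admissible) (φ : ℝ × ℝ → ℝ) (x : Cube d) :
    M.condMean (fun z => φ (clamp psiMax (M.psi a g z), clamp psiMax (M.psi a' g' z))) x =
      M.condMean (fun z => φ (M.psi a g z, M.psi a' g' z)) x := by
  refine integral_congr_ae ?_
  filter_upwards [hb g hg a ha x, hb g' hg' a' ha' x] with q h1 h2
  rw [clamp_eq_self h1, clamp_eq_self h2]

theorem abs_condMean_clamp_sub_le (hw : M.WellPosed) (hreg : M.IsRegression)
    (hriesz : M.IsRiesz) (hb : M.BoundedMoment psiMax)
    (hlink : ∀ w, LipschitzWith Lh (M.link w)) (hνg : Measurable νg)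
    (hg : M.ofParam νg ∈ M.admissible) (ha : M.ofParam νa ∈ M.admissible) (x : Cube d) :
    |M.condMean (fun z => clamp psiMax (M.psi (M.ofParam νa) (M.ofParam νg) z) -
        clamp psiMax (M.psi M.a0 M.g0 z)) x| ≤
      Lh ^ 2 * (‖νg x - M.nuG x‖ ^ 2 + ‖νa x - M.nuA x‖ ^ 2) := by
  rw [condMean_clamp hb ha hg hw.a0_mem hw.g0_mem (fun v => v.1 - v.2)]
  refine le_trans (le_of_eq ?_) (abs_condMean_psi_sub_le hw hreg hriesz hb hlink hνg hg ha x)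
  congr 1
  exact integral_sub (integrable_psi hw hb ha hg x) (integrable_psi hw hb hw.a0_mem hw.g0_mem x)

/-- Mean-squared continuity passes to the nuisance functions, whose differences the Lipschitz link
bounds pointwise in `w`. -/
theorem condMean_clamp_sub_sq_le (hw : M.WellPosed) (hb : M.BoundedMoment psiMax)
    (hmsc : M.MeanSquareContinuous L) (hlink : ∀ w, LipschitzWith Lh (M.link w))
    (hg : M.ofParam νg ∈ M.admissible) (ha : M.ofParam νa ∈ M.admissible) (x : Cube d) :
    M.condMean (fun z => (clamp psiMax (M.psi (M.ofParam νa) (M.ofParam νg) z) -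
        clamp psiMax (M.psi M.a0 M.g0 z)) ^ 2) x ≤
      L * (Lh ^ 2 * (‖νg x - M.nuG x‖ ^ 2 + ‖νa x - M.nuA x‖ ^ 2)) := by
  rw [condMean_clamp hb ha hg hw.a0_mem hw.g0_mem (fun v => (v.1 - v.2) ^ 2)]
  refine (hmsc _ hg _ ha x).trans ?_
  gcongr
  refine (le_abs_self _).trans (abs_integral_le_of_abs_le fun q => ?_)
  rw [abs_of_nonneg (by positivity), mul_add]
  have h : ∀ ν ν' : Cube d → EuclideanSpace ℝ (Fin p),
      (M.ofParam ν x q.2 - M.ofParam ν' x q.2) ^ 2 ≤ Lh ^ 2 * ‖ν x - ν' x‖ ^ 2 := by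
    intro ν ν'
    rw [← mul_pow, ← sq_abs]
    exact pow_le_pow_left₀ (abs_nonneg _) (abs_ofParam_sub_le hlink ν ν' x q.2) 2
  exact add_le_add (h νg M.nuG) (h νa M.nuA)

end Model

/-! ### Kernel bias and bounds on mean kernel averages -/

/-- Makes the maximal distance in `Shrinks` integrable, so that its Bochner integral is a genuine
mean and not the default value zero. -/
theorem exists_dist_le (d : ℕ) (x : Cube d) : ∃ R, ∀ y : Cube d, dist y x ≤ R := by
  have hb : Bornology.IsBounded (Set.univ : Set (Cube d)) := by
    have hc : IsCompact {x : EuclideanSpace ℝ (Fin d) | ∀ i, x i ∈ Set.Icc (0 : ℝ) 1} := by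
      refine Metric.isCompact_of_isClosed_isBounded (isClosed_cube d) ?_
      refine (Metric.isBounded_closedBall (x := (0 : EuclideanSpace ℝ (Fin d))) (r := √d)).subset
        fun y hy => ?_
      rw [mem_closedBall_zero_iff, EuclideanSpace.norm_eq]
      refine Real.sqrt_le_sqrt ?_
      calc ∑ i, ‖y i‖ ^ 2 ≤ ∑ _i : Fin d, (1 : ℝ) := by
            refine Finset.sum_le_sum fun i _ => ?_
            rw [Real.norm_eq_abs, sq_abs]
            have := hy i
            nlinarith [this.1, this.2]
        _ = d := by simp
    have : CompactSpace (Cube d) := isCompact_iff_compactSpace.1 hc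
    exact isCompact_univ.isBounded
  obtain ⟨R, hR⟩ := (Metric.isBounded_iff_subset_closedBall x).1 hb
  exact ⟨R, fun y => hR (Set.mem_univ y)⟩

namespace BaseKernel

variable {d p : ℕ} {W Ξ : Type*} [MeasurableSpace W] [MeasurableSpace Ξ] {s : ℕ}
  (K : BaseKernel (Obs d W) Ξ s) {P : Measure (Obs d W)} [IsProbabilityMeasure P]

/-- Kernel shrinkage bounds the bias of the average of a Lipschitz function of the features. -/
theorem abs_integral_stat_feat_sub_le [NeZero s] {x : Cube d} {e : ℝ} (hsh : K.Shrinks P x e)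
    {L : ℝ≥0} {c : Cube d → ℝ} (hc : LipschitzWith L c) {C : ℝ} (hC : ∀ y, |c y| ≤ C) :
    |∫ ω, K.stat (fun z => c z.feat) ω.1 ω.2 ∂(K.jointLaw P) - c x| ≤ L * e := by
  obtain ⟨R, hR⟩ := exists_dist_le d x
  set D : (Fin s → Obs d W) × Ξ → ℝ :=
    fun ω => ⨆ j : Fin s, if 0 < K.weight ω.1 ω.2 j then dist (ω.1 j).feat x else 0 with hD
  have hR0 : 0 ≤ R := dist_nonneg.trans (hR x)
  have hterm : ∀ (ω : (Fin s → Obs d W) × Ξ) (j : Fin s),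
      (if 0 < K.weight ω.1 ω.2 j then dist (ω.1 j).feat x else 0) ≤ R := by
    intro ω j
    split_ifs
    · exact hR _
    · exact hR0
  have hle : ∀ (ω : (Fin s → Obs d W) × Ξ) (j : Fin s),
      (if 0 < K.weight ω.1 ω.2 j then dist (ω.1 j).feat x else 0) ≤ D ω := fun ω j =>
    le_ciSup (f := fun j => if 0 < K.weight ω.1 ω.2 j then dist (ω.1 j).feat x else 0)
      (Set.finite_range _).bddAbove j
  have hD0 : ∀ ω, 0 ≤ D ω := fun ω => by
    refine le_trans ?_ (hle ω 0)
    split_ifs <;> simp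
  have hDR : ∀ ω, |D ω| ≤ R := fun ω => by
    rw [abs_of_nonneg (hD0 ω)]
    exact ciSup_le fun j => hterm ω j
  have hDm : Measurable D := by
    refine Measurable.iSup fun j => ?_
    refine Measurable.ite ?_ ?_ measurable_const
    · exact measurableSet_lt measurable_const ((measurable_pi_apply j).comp K.measurable_weight)
    · exact (Model.measurable_feat.comp ((measurable_pi_apply j).comp measurable_fst)).dist
        measurable_const
  have hcm : Measurable fun z : Obs d W => c z.feat :=
    hc.continuous.measurable.comp Model.measurable_feat
  have hi : Integrable (fun ω : (Fin s → Obs d W) × Ξ => K.stat (fun z => c z.feat) ω.1 ω.2)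
      (K.jointLaw P) := K.integrable_stat hcm fun z => hC _
  have hDi : Integrable D (K.jointLaw P) := integrable_of_abs_le hDm hDR
  have hpt : ∀ ω : (Fin s → Obs d W) × Ξ,
      ‖K.stat (fun z => c z.feat) ω.1 ω.2 - c x‖ ≤ L * D ω := by
    intro ω
    have h1 : K.stat (fun z => c z.feat) ω.1 ω.2 - c x =
        ∑ j, K.weight ω.1 ω.2 j * (c (ω.1 j).feat - c x) := by
      simp only [stat, mul_sub, Finset.sum_sub_distrib, ← Finset.sum_mul, K.sum_eq_one, one_mul]
    rw [h1]
    calc _ ≤ ∑ j, ‖K.weight ω.1 ω.2 j * (c (ω.1 j).feat - c x)‖ := norm_sum_le _ _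
      _ ≤ ∑ j, K.weight ω.1 ω.2 j * (L * D ω) := by
          refine Finset.sum_le_sum fun j _ => ?_
          rw [norm_mul, Real.norm_eq_abs, abs_of_nonneg (K.nonneg _ _ _), ← dist_eq_norm]
          -- Points of zero weight may be far from `x`, but they drop out; the others are within `D
          -- ω`.
          rcases (K.nonneg ω.1 ω.2 j).eq_or_lt with h0 | h0
          · rw [← h0, zero_mul, zero_mul]
          · have h2 := hle ω j
            rw [if_pos h0] at h2
            refine mul_le_mul_of_nonneg_left ?_ h0.le
            exact (hc.dist_le_mul _ _).trans (mul_le_mul_of_nonneg_left h2 L.2)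
      _ = L * D ω := by rw [← Finset.sum_mul, K.sum_eq_one, one_mul]
  have h2 : ∫ ω, K.stat (fun z => c z.feat) ω.1 ω.2 ∂(K.jointLaw P) - c x =
      ∫ ω, (K.stat (fun z => c z.feat) ω.1 ω.2 - c x) ∂(K.jointLaw P) := by
    rw [integral_sub hi (integrable_const _)]
    simp
  rw [h2]
  refine (norm_integral_le_of_norm_le (hDi.const_mul (L : ℝ)) (ae_of_all _ hpt)).trans ?_
  rw [integral_const_mul]
  exact mul_le_mul_of_nonneg_left hsh L.2

end BaseKernel

/-- Nonnegativity of the variance of |X|. -/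
theorem integral_abs_le_sqrt {α : Type*} [MeasurableSpace α] {μ : Measure α}
    [IsProbabilityMeasure μ] {X : α → ℝ} (hX : Measurable X) {C : ℝ} (hC : ∀ a, |X a| ≤ C) {V : ℝ}
    (hV : ∫ a, X a ^ 2 ∂μ ≤ V) : ∫ a, |X a| ∂μ ≤ √V := by
  refine Real.le_sqrt_of_sq_le ?_
  have hLp : MemLp (fun a => |X a|) 2 μ :=
    MemLp.of_bound hX.abs.aestronglyMeasurable C (ae_of_all _ fun a => by simpa using hC a)
  have h1 := variance_eq_sub hLp
  have h2 := variance_nonneg (fun a => |X a|) μ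
  simp only [Pi.pow_apply, sq_abs] at h1
  linarith

namespace BaseKernel

variable {𝒵 Ξ : Type*} [MeasurableSpace 𝒵] [MeasurableSpace Ξ] {s : ℕ} (K : BaseKernel 𝒵 Ξ s)
  {P : Measure 𝒵} [IsProbabilityMeasure P]

/-- The weights depend on the data and may concentrate where `b` is large, so against `b` they are
bounded by 1. This costs the factor `s`, which the level δ_n/n of the nuisance rate absorbs. -/
theorem abs_integral_stat_le {c b : 𝒵 → ℝ} (hb : Measurable b) (hb0 : ∀ z, 0 ≤ b z) (hb1 : ∀ z, b z ≤ 1) {a e : ℝ} (he : 0 ≤ e)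
    (h : ∀ z, |c z| ≤ a + e * b z) :
    |∫ ω, K.stat c ω.1 ω.2 ∂(K.jointLaw P)| ≤ a + e * (s * ∫ z, b z ∂P) := by
  have hev : ∀ j : Fin s, MeasurePreserving (fun ω : (Fin s → 𝒵) × Ξ => ω.1 j) (K.jointLaw P) P :=
    fun j => (measurePreserving_eval (fun _ : Fin s => P) j).comp measurePreserving_fst
  have hbi : ∀ j : Fin s, Integrable (fun ω : (Fin s → 𝒵) × Ξ => b (ω.1 j)) (K.jointLaw P) :=
    fun j => integrable_of_abs_le (hb.comp (hev j).measurable) (C := 1) fun ω => by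
      rw [abs_of_nonneg (hb0 _)]; exact hb1 _
  have hbint : ∀ j : Fin s, ∫ ω, b (ω.1 j) ∂(K.jointLaw P) = ∫ z, b z ∂P := by
    intro j
    conv_rhs => rw [← (hev j).map_eq]
    rw [integral_map (hev j).measurable.aemeasurable hb.aestronglyMeasurable]
  have hpt : ∀ ω : (Fin s → 𝒵) × Ξ, ‖K.stat c ω.1 ω.2‖ ≤ a + e * ∑ j, b (ω.1 j) := by
    intro ω
    calc ‖K.stat c ω.1 ω.2‖ ≤ ∑ j, ‖K.weight ω.1 ω.2 j * c (ω.1 j)‖ := norm_sum_le _ _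
      _ ≤ ∑ j, (K.weight ω.1 ω.2 j * a + e * b (ω.1 j)) := by
          refine Finset.sum_le_sum fun j _ => ?_
          rw [norm_mul, Real.norm_eq_abs, Real.norm_eq_abs, abs_of_nonneg (K.nonneg _ _ _)]
          calc _ ≤ K.weight ω.1 ω.2 j * (a + e * b (ω.1 j)) :=
                mul_le_mul_of_nonneg_left (h _) (K.nonneg _ _ _)
            _ = K.weight ω.1 ω.2 j * a + K.weight ω.1 ω.2 j * (e * b (ω.1 j)) := mul_add _ _ _
            _ ≤ _ := by
                exact add_le_add le_rfl
                  (mul_le_of_le_one_left (mul_nonneg he (hb0 _)) (K.weight_le_one _ _ _))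
      _ = a + e * ∑ j, b (ω.1 j) := by
          rw [Finset.sum_add_distrib, ← Finset.sum_mul, K.sum_eq_one, one_mul, Finset.mul_sum]
  have hsum : Integrable (fun ω : (Fin s → 𝒵) × Ξ => ∑ j, b (ω.1 j)) (K.jointLaw P) :=
    integrable_finsetSum _ fun j _ => hbi j
  refine (norm_integral_le_of_norm_le ((integrable_const a).add (hsum.const_mul e))
    (ae_of_all _ hpt)).trans (le_of_eq ?_)
  simp only [Pi.add_apply]
  rw [integral_add (integrable_const a) (hsum.const_mul e), integral_const_mul,
    integral_finsetSum _ fun j _ => hbi j]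
  simp [hbint]

end BaseKernel

/-! ### The nuisance error at independent evaluation points -/

namespace NuisanceEstimator

variable {d p : ℕ} {W A : Type*} [MeasurableSpace W] [MeasurableSpace A] {n : ℕ}
  (N : NuisanceEstimator d p W A n) {M : Model d p W}

instance : IsProbabilityMeasure (N.trainLaw M) := by unfold trainLaw; infer_instance

theorem measurable_param {ν : (Fin n → Obs d W) × A → Cube d → EuclideanSpace ℝ (Fin p)}
    (hw : M.WellPosed) (hν : Measurable (Function.uncurry ν)) :
    Measurable fun q : ((Fin n → Obs d W) × A) × Obs d W =>
      M.ofParam (ν q.1) q.2.feat q.2.extra :=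
  hw.measurable_link.comp ((measurable_snd.comp (measurable_snd.comp measurable_snd)).prodMk
    (hν.comp (measurable_fst.prodMk (measurable_fst.comp measurable_snd))))

theorem measurable_psiHat (hw : M.WellPosed) (hadm : N.Admissible M) :
    Measurable fun q : ((Fin n → Obs d W) × A) × Obs d W =>
      M.psi (N.aHat M q.1) (N.gHat M q.1) q.2 :=
  (hadm.measurable_moment.comp measurable_swap).add
    ((measurable_param hw N.measurable_nuA).mul
      ((measurable_fst.comp (measurable_snd.comp measurable_snd)).sub
        (measurable_param hw N.measurable_nuG)))

theorem measurable_error (hw : M.WellPosed) :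
    Measurable fun q : ((Fin n → Obs d W) × A) × Cube d => N.error M q.1 q.2 := by
  have h1 : Measurable fun q : ((Fin n → Obs d W) × A) × Cube d => N.nuG q.1 q.2 :=
    N.measurable_nuG
  have h2 : Measurable fun q : ((Fin n → Obs d W) × A) × Cube d => N.nuA q.1 q.2 :=
    N.measurable_nuA
  have h3 := hw.measurable_nuG
  have h4 := hw.measurable_nuA
  unfold error
  fun_prop

theorem error_sq (t : (Fin n → Obs d W) × A) (x : Cube d) :
    N.error M t x ^ 2 = ‖N.nuG t x - M.nuG x‖ ^ 2 + ‖N.nuA t x - M.nuA x‖ ^ 2 :=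
  Real.sq_sqrt (by positivity)

theorem error_nonneg (t : (Fin n → Obs d W) × A) (x : Cube d) : 0 ≤ N.error M t x :=
  Real.sqrt_nonneg _

/-- The indicator of a large estimation error at the features of an observation. -/
def largeError (M : Model d p W) (r : ℝ) (t : (Fin n → Obs d W) × A) (z : Obs d W) : ℝ :=
  if r < N.error M t z.feat then 1 else 0

variable {r : ℝ}

theorem measurable_largeError (hw : M.WellPosed) :
    Measurable fun q : ((Fin n → Obs d W) × A) × Obs d W => N.largeError M r q.1 q.2 := by
  refine Measurable.ite (measurableSet_lt measurable_const ?_) measurable_const measurable_const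
  have h : Measurable fun q : ((Fin n → Obs d W) × A) × Obs d W => (q.1, q.2.feat) :=
    measurable_fst.prodMk (Model.measurable_feat.comp measurable_snd)
  have h' := (N.measurable_error hw).comp h
  exact h'

theorem measurable_error_left (hw : M.WellPosed) (x : Cube d) :
    Measurable fun t => N.error M t x := by
  have h : Measurable fun t : (Fin n → Obs d W) × A => (t, x) :=
    measurable_id.prodMk measurable_const
  have h' := (N.measurable_error hw).comp h
  exact h'

theorem measurable_largeError_right (hw : M.WellPosed) (t : (Fin n → Obs d W) × A) :
    Measurable (N.largeError M r t) := by
  have h : Measurable fun z : Obs d W => (t, z) := measurable_const.prodMk measurable_id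
  have h' := (N.measurable_largeError hw (r := r)).comp h
  exact h'

theorem largeError_nonneg (t : (Fin n → Obs d W) × A) (z : Obs d W) :
    0 ≤ N.largeError M r t z := by
  unfold largeError; split_ifs <;> simp

theorem largeError_le_one (t : (Fin n → Obs d W) × A) (z : Obs d W) :
    N.largeError M r t z ≤ 1 := by
  unfold largeError; split_ifs <;> simp

theorem abs_largeError_le_one (t : (Fin n → Obs d W) × A) (z : Obs d W) :
    |N.largeError M r t z| ≤ 1 := by
  rw [abs_of_nonneg (N.largeError_nonneg t z)]; exact N.largeError_le_one t z

/-- A pointwise bound on the probability of a large error bounds its probability at the features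
of an independent observation. -/
theorem integral_integral_largeError_le (hw : M.WellPosed) {δ : ℝ}
    (h : ∀ x, (N.trainLaw M).real {t | r < N.error M t x} ≤ δ) :
    ∫ t, ∫ z, N.largeError M r t z ∂M.obsLaw ∂(N.trainLaw M) ≤ δ := by
  -- The evaluation point is independent of the training data: by Fubini it can be held fixed, where
  -- the pointwise bound applies.
  rw [integral_integral_swap (integrable_of_abs_le (N.measurable_largeError hw)
    fun q => N.abs_largeError_le_one q.1 q.2)]
  have h1 : ∀ z : Obs d W, ∫ t, N.largeError M r t z ∂(N.trainLaw M) ≤ δ := by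
    intro z
    have hs : MeasurableSet {t | r < N.error M t z.feat} :=
      measurableSet_lt measurable_const (N.measurable_error_left hw z.feat)
    refine le_trans (le_of_eq ?_) (h z.feat)
    rw [← integral_indicator_one hs]
    refine integral_congr_ae (ae_of_all _ fun t => ?_)
    simp [largeError, Set.indicator]
  have hδ : 0 ≤ δ := le_trans measureReal_nonneg
    (h (Classical.choice (nonempty_of_isProbabilityMeasure M.lawX)))
  have hi : Integrable (fun z => ∫ t, N.largeError M r t z ∂(N.trainLaw M)) M.obsLaw :=
    (integrable_of_abs_le (μ := (N.trainLaw M).prod M.obsLaw) (N.measurable_largeError hw)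
      fun q => N.abs_largeError_le_one q.1 q.2).integral_prod_right
  calc _ ≤ ∫ _z, δ ∂M.obsLaw := integral_mono hi (integrable_const _) h1
    _ = δ := by simp

/-- The truncated difference of the estimated and the true debiased moment. -/
def psiDiff (M : Model d p W) (C : ℝ) (t : (Fin n → Obs d W) × A) (z : Obs d W) : ℝ :=
  clamp C (M.psi (N.aHat M t) (N.gHat M t) z) - clamp C (M.psi M.a0 M.g0 z)

theorem measurable_psiDiff (hw : M.WellPosed) (hadm : N.Admissible M) (C : ℝ) :
    Measurable fun q : ((Fin n → Obs d W) × A) × Obs d W => N.psiDiff M C q.1 q.2 :=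
  ((measurable_clamp C).comp (N.measurable_psiHat hw hadm)).sub ((measurable_clamp C).comp
    ((Model.measurable_psi_of_mem hw hw.a0_mem hw.g0_mem).comp measurable_snd))

theorem measurable_psiDiff_right (hw : M.WellPosed) (hadm : N.Admissible M) (C : ℝ)
    (t : (Fin n → Obs d W) × A) : Measurable (N.psiDiff M C t) := by
  have h : Measurable fun z : Obs d W => (t, z) := measurable_const.prodMk measurable_id
  exact (N.measurable_psiDiff hw hadm C).comp h

theorem abs_psiDiff_le {C : ℝ} (hC : 0 ≤ C) (t : (Fin n → Obs d W) × A) (z : Obs d W) :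
    |N.psiDiff M C t z| ≤ 2 * C := by
  refine (abs_sub _ _).trans ?_
  linarith [abs_clamp_le hC (M.psi (N.aHat M t) (N.gHat M t) z),
    abs_clamp_le hC (M.psi M.a0 M.g0 z)]

/-- Dichotomy replacing a uniform rate: where the error is at most `r` the quadratic bound is used,
elsewhere the trivial bound `C`. -/
theorem le_add_largeError {c C Q : ℝ} (hQ : 0 ≤ Q) (hC : c ≤ C)
    (t : (Fin n → Obs d W) × A) (z : Obs d W) (hc : c ≤ Q * N.error M t z.feat ^ 2) :
    c ≤ Q * r ^ 2 + C * N.largeError M r t z := by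
  unfold largeError
  split_ifs with h
  · have : 0 ≤ Q * r ^ 2 := by positivity
    linarith
  · rw [not_lt] at h
    have : Q * N.error M t z.feat ^ 2 ≤ Q * r ^ 2 := by
      gcongr
      exact N.error_nonneg t _
    linarith

variable {Ξ : Type*} [MeasurableSpace Ξ] [StandardBorelSpace W] [StandardBorelSpace Ξ] {s : ℕ}
  (K : BaseKernel (Obs d W) Ξ s) {psiMax : ℝ} {L Lh : ℝ≥0}

/-- Bounds on the mean and second moment of the effect of the nuisance estimation error. -/
theorem moments_psiDiff_le (hw : M.WellPosed) (hreg : M.IsRegression) (hriesz : M.IsRiesz)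
    (hadm : N.Admissible M) (hb : M.BoundedMoment psiMax) (hmsc : M.MeanSquareContinuous L)
    (hlink : ∀ w, LipschitzWith Lh (M.link w)) (hC : 0 ≤ psiMax) {t : (Fin n → Obs d W) × A}
    (hg : N.gHat M t ∈ M.admissible) (ha : N.aHat M t ∈ M.admissible)
    (hH : K.Honest M (N.aHat M t) (N.gHat M t)) (r : ℝ) :
    |∫ y, K.meanStat (N.psiDiff M psiMax t) y ∂(Measure.pi fun _ => M.obsLaw)| ≤
        Lh ^ 2 * r ^ 2 + 2 * psiMax * (s * ∫ z, N.largeError M r t z ∂M.obsLaw) ∧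
    ∫ y, K.meanStat (N.psiDiff M psiMax t) y ^ 2 ∂(Measure.pi fun _ => M.obsLaw) ≤
        L * Lh ^ 2 * r ^ 2 + (2 * psiMax) ^ 2 * (s * ∫ z, N.largeError M r t z ∂M.obsLaw) := by
  have hm1 : Measurable (M.psi (N.aHat M t) (N.gHat M t)) := Model.measurable_psi_of_mem hw ha hg
  have hm0 : Measurable (M.psi M.a0 M.g0) := Model.measurable_psi_of_mem hw hw.a0_mem hw.g0_mem
  have hf := N.measurable_psiDiff_right hw hadm psiMax t
  have hfb := N.abs_psiDiff_le (M := M) hC t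
  have hνg : Measurable (N.nuG t) := N.measurable_nuG.comp (measurable_const.prodMk measurable_id)
  have hφ : Measurable fun v : ℝ × ℝ => clamp psiMax v.1 - clamp psiMax v.2 :=
    ((measurable_clamp _).comp measurable_fst).sub ((measurable_clamp _).comp measurable_snd)
  have hφb : ∀ v : ℝ × ℝ, |clamp psiMax v.1 - clamp psiMax v.2| ≤ 2 * psiMax := fun v => by
    refine (abs_sub _ _).trans ?_
    linarith [abs_clamp_le hC v.1, abs_clamp_le hC v.2]
  have hsqb : ∀ {u : ℝ}, |u| ≤ 2 * psiMax → |u ^ 2| ≤ (2 * psiMax) ^ 2 := fun hu => by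
    rw [abs_pow]; exact pow_le_pow_left₀ (abs_nonneg _) hu 2
  have hbm : Measurable (N.largeError M r t) := N.measurable_largeError_right hw t
  constructor
  · rw [K.integral_meanStat hf hfb]
    have h1 := K.integral_stat_of_honest hH hm1 hm0 hφ hφb
    refine (congrArg abs h1).trans_le ?_
    refine K.abs_integral_stat_le hbm (N.largeError_nonneg t) (N.largeError_le_one t)
      (by positivity) fun z => ?_
    refine N.le_add_largeError (by positivity) (M.abs_condMean_le hfb _) t z ?_
    rw [N.error_sq]
    exact Model.abs_condMean_clamp_sub_le hw hreg hriesz hb hlink hνg hg ha z.feat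
  · have h1 := K.integral_stat_of_honest hH hm1 hm0 (hφ.pow_const 2) fun v => hsqb (hφb v)
    have hf2 : Measurable fun z => N.psiDiff M psiMax t z ^ 2 := hf.pow_const 2
    have hf2b : ∀ z, |N.psiDiff M psiMax t z ^ 2| ≤ (2 * psiMax) ^ 2 := fun z => hsqb (hfb z)
    calc ∫ y, K.meanStat (N.psiDiff M psiMax t) y ^ 2 ∂(Measure.pi fun _ => M.obsLaw)
        ≤ ∫ y, K.meanStat (fun z => N.psiDiff M psiMax t z ^ 2) y
            ∂(Measure.pi fun _ => M.obsLaw) :=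
          integral_mono
            (integrable_of_abs_le ((K.measurable_meanStat hf).pow_const 2)
              fun y => hsqb (K.abs_meanStat_le hfb y))
            (integrable_of_abs_le (K.measurable_meanStat hf2)
              fun y => K.abs_meanStat_le hf2b y)
            fun y => K.meanStat_sq_le hf hfb y
      _ = ∫ ω, K.stat (fun z => N.psiDiff M psiMax t z ^ 2) ω.1 ω.2 ∂(K.jointLaw M.obsLaw) :=
          K.integral_meanStat hf2 hf2b
      _ ≤ |∫ ω, K.stat (fun z => N.psiDiff M psiMax t z ^ 2) ω.1 ω.2 ∂(K.jointLaw M.obsLaw)| :=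
          le_abs_self _
      _ ≤ _ := by
          refine (congrArg abs h1).trans_le ?_
          refine K.abs_integral_stat_le hbm (N.largeError_nonneg t)
            (N.largeError_le_one t) (by positivity) fun z => ?_
          have h0 : ∀ x, 0 ≤ M.condMean (fun z => N.psiDiff M psiMax t z ^ 2) x := fun x =>
            integral_nonneg fun q => sq_nonneg _
          refine (abs_of_nonneg (h0 z.feat)).trans_le ?_
          refine N.le_add_largeError (by positivity)
            ((le_abs_self _).trans (M.abs_condMean_le hf2b _)) t z ?_
          rw [N.error_sq, mul_assoc]
          exact Model.condMean_clamp_sub_sq_le hw hb hmsc hlink hg ha z.feat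

end NuisanceEstimator

/-! ### `L¹` bounds for the resampled average -/

namespace BaseKernel

open Function

variable {𝒵 Ξ : Type*} [MeasurableSpace 𝒵] [MeasurableSpace Ξ] {s : ℕ} (K : BaseKernel 𝒵 Ξ s)
  {P : Measure 𝒵} [IsProbabilityMeasure P] {f : 𝒵 → ℝ} {C : ℝ} {n B : ℕ}

theorem integral_meanStat_sq_le (hC : ∀ a, |f a| ≤ C) :
    ∫ y, K.meanStat f y ^ 2 ∂(Measure.pi fun _ => P) ≤ C ^ 2 := by
  refine (le_abs_self _).trans (abs_integral_le_of_abs_le fun y => ?_)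
  rw [abs_pow]
  exact pow_le_pow_left₀ (abs_nonneg _) (K.abs_meanStat_le hC y) 2

/-- The leading term of the resampled average. -/
def leadingTerm [NeZero s] (P : Measure 𝒵) (f : 𝒵 → ℝ) (z : Fin n → 𝒵) : ℝ :=
  (s : ℝ) / n * ∑ i, (K.firstProj P f (z i) - ∫ a, K.firstProj P f a ∂P)

section

variable [NeZero s]

theorem measurable_leadingTerm (hf : Measurable f) :
    Measurable (K.leadingTerm (n := n) P f) := by
  unfold leadingTerm
  refine Measurable.const_mul (Finset.measurable_fun_sum _ fun i _ => ?_) _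
  exact ((K.measurable_firstProj hf).comp (measurable_pi_apply i)).sub_const _

theorem abs_leadingTerm_le (hC : ∀ a, |f a| ≤ C) (z : Fin n → 𝒵) :
    |K.leadingTerm P f z| ≤ (s : ℝ) / n * (n * (2 * C)) := by
  rw [leadingTerm, abs_mul, abs_of_nonneg (by positivity)]
  gcongr
  calc _ ≤ ∑ i, |K.firstProj P f (z i) - ∫ a, K.firstProj P f a ∂P| :=
        Finset.abs_sum_le_sum_abs _ _
    _ ≤ ∑ _i : Fin n, 2 * C := by
        refine Finset.sum_le_sum fun i _ => (abs_sub _ _).trans ?_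
        linarith [K.abs_firstProj_le (P := P) hC (z i),
          abs_integral_le_of_abs_le (μ := P) fun a => K.abs_firstProj_le (P := P) hC a]
    _ = _ := by simp

/-- The resampled average is close to a sum of independent variables. -/
theorem integral_abs_resampled_sub_leadingTerm_le (hf : Measurable f) (hC : ∀ a, |f a| ≤ C)
    (hsn : s ≤ n) (hB : 0 < B) :
    ∫ ω, |K.resampled f ω.1 ω.2 -
        (∫ y, K.meanStat f y ∂(Measure.pi fun _ => P) + K.leadingTerm P f ω.1)|
        ∂((Measure.pi fun _ => P).prod (Measure.pi fun _ : Fin B => K.subLaw n)) ≤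
      √(2 * (C ^ 2 / B + ((s : ℝ) / n) ^ 2 * C ^ 2)) := by
  have := K.isProbabilityMeasure_subLaw hsn
  have ha : Measurable fun z : Fin n → 𝒵 =>
      ∫ y, K.meanStat f y ∂(Measure.pi fun _ => P) + K.leadingTerm P f z :=
    (K.measurable_leadingTerm hf).const_add _
  have hD : ∀ z : Fin n → 𝒵,
      |∫ y, K.meanStat f y ∂(Measure.pi fun _ => P) + K.leadingTerm P f z| ≤
        C + (s : ℝ) / n * (n * (2 * C)) := fun z =>
    (abs_add_le _ _).trans (add_le_add
      (abs_integral_le_of_abs_le fun y => K.abs_meanStat_le hC y) (K.abs_leadingTerm_le hC z))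
  refine integral_abs_le_sqrt ((K.measurable_resampled hf).sub (ha.comp measurable_fst))
    (C := C + (C + (s : ℝ) / n * (n * (2 * C)))) (fun ω => ?_) ?_
  · exact (abs_sub _ _).trans (add_le_add (K.abs_resampled_le hC hB _ _) (hD _))
  · refine (K.integral_resampled_sub_sq_le hf hC hsn hB ha hD).trans ?_
    gcongr
    refine (K.integral_fullStat_sub_projection_sq_le hf hC hsn).trans ?_
    gcongr
    exact K.integral_meanStat_sq_le hC

end

variable {T : Type*} [MeasurableSpace T] {τ : Measure T} [IsProbabilityMeasure τ]
  {F : T → 𝒵 → ℝ}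

theorem measurable_integral_stat (hF : Measurable (uncurry F)) :
    Measurable fun t => ∫ ω, K.stat (F t) ω.1 ω.2 ∂(K.jointLaw P) := by
  have hm : Measurable fun q : T × ((Fin s → 𝒵) × Ξ) => K.stat (F q.1) q.2.1 q.2.2 := by
    unfold stat
    refine Finset.measurable_fun_sum _ fun j _ => ?_
    have h1 : Measurable fun q : T × ((Fin s → 𝒵) × Ξ) => (q.1, q.2.1 j) := by fun_prop
    have h2 := hF.comp h1
    exact ((measurable_pi_apply j).comp (K.measurable_weight.comp measurable_snd)).mul h2
  exact (StronglyMeasurable.integral_prod_right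
    (f := fun t (ω : (Fin s → 𝒵) × Ξ) => K.stat (F t) ω.1 ω.2) hm.stronglyMeasurable).measurable

theorem measurable_resampled_prod (hF : Measurable (uncurry F)) :
    Measurable fun q : T × ((Fin n → 𝒵) × (Fin B → Subsample n s × Ξ)) =>
      K.resampled (F q.1) q.2.1 q.2.2 := by
  unfold resampled
  refine Finset.measurable_fun_sum _ fun i _ => ?_
  have h1 : Measurable fun q : T × ((Fin n → 𝒵) × (Fin B → Subsample n s × Ξ)) =>
      (q.1, q.2.1 i) := by fun_prop
  have h2 := hF.comp h1
  exact ((K.measurable_avgWeight i).comp measurable_snd).mul h2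

theorem abs_integral_stat_le_of_abs_le (hC : ∀ a, |f a| ≤ C) :
    |∫ ω, K.stat f ω.1 ω.2 ∂(K.jointLaw P)| ≤ C :=
  abs_integral_le_of_abs_le fun ω => K.abs_stat_le hC ω.1 ω.2

/-- The fluctuation of the resampled average of a function that depends on independent data. -/
theorem integral_abs_resampled_sub_mean_le (hF : Measurable (uncurry F))
    (hC : ∀ t a, |F t a| ≤ C) (hs : 0 < s) (hsn : s ≤ n) (hB : 0 < B) {v : T → ℝ}
    (hv : Integrable v τ)
    (hFv : ∀ᵐ t ∂τ, ∫ y, K.meanStat (F t) y ^ 2 ∂(Measure.pi fun _ => P) ≤ v t) :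
    ∫ q, |K.resampled (F q.1) q.2.1 q.2.2 - ∫ ω, K.stat (F q.1) ω.1 ω.2 ∂(K.jointLaw P)|
        ∂(τ.prod ((Measure.pi fun _ => P).prod (Measure.pi fun _ : Fin B => K.subLaw n))) ≤
      √(2 * (C ^ 2 / B + (s : ℝ) / n * ∫ t, v t ∂τ)) := by
  have := K.isProbabilityMeasure_subLaw hsn
  have hm : Measurable fun q : T × ((Fin n → 𝒵) × (Fin B → Subsample n s × Ξ)) =>
      K.resampled (F q.1) q.2.1 q.2.2 - ∫ ω, K.stat (F q.1) ω.1 ω.2 ∂(K.jointLaw P) :=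
    (K.measurable_resampled_prod hF).sub ((K.measurable_integral_stat hF).comp measurable_fst)
  have hb : ∀ q : T × ((Fin n → 𝒵) × (Fin B → Subsample n s × Ξ)),
      |K.resampled (F q.1) q.2.1 q.2.2 - ∫ ω, K.stat (F q.1) ω.1 ω.2 ∂(K.jointLaw P)| ≤
        C + C := fun q =>
    (abs_sub _ _).trans (add_le_add (K.abs_resampled_le (hC _) hB _ _)
      (K.abs_integral_stat_le_of_abs_le (hC _)))
  refine integral_abs_le_sqrt hm hb ?_
  have hi : Integrable (fun q : T × ((Fin n → 𝒵) × (Fin B → Subsample n s × Ξ)) =>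
      (K.resampled (F q.1) q.2.1 q.2.2 - ∫ ω, K.stat (F q.1) ω.1 ω.2 ∂(K.jointLaw P)) ^ 2)
      (τ.prod ((Measure.pi fun _ => P).prod (Measure.pi fun _ : Fin B => K.subLaw n))) :=
    integrable_of_abs_le (hm.pow_const 2) (C := (C + C) ^ 2) fun q => by
      rw [abs_pow]; exact pow_le_pow_left₀ (abs_nonneg _) (hb q) 2
  rw [integral_prod _ hi]
  have hbd : Integrable (fun t => 2 * (C ^ 2 / B + (s : ℝ) / n * v t)) τ :=
    ((integrable_const _).add (hv.const_mul _)).const_mul _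
  calc _ ≤ ∫ t, 2 * (C ^ 2 / B + (s : ℝ) / n * v t) ∂τ := by
        refine integral_mono_ae hi.integral_prod_left hbd ?_
        filter_upwards [hFv] with t ht
        have hFt : Measurable (F t) := hF.comp (measurable_const.prodMk measurable_id)
        -- Given `t`, the comparison function is the constant conditional mean, so only resampling
        -- error and first-order variance remain.
        refine (K.integral_resampled_sub_sq_le hFt (hC t) hsn hB
          (a := fun _ => ∫ ω, K.stat (F t) ω.1 ω.2 ∂(K.jointLaw P)) measurable_const
          (fun _ => K.abs_integral_stat_le_of_abs_le (hC t))).trans ?_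
        gcongr
        rw [← K.integral_meanStat hFt (hC t)]
        refine (K.integral_fullStat_sub_mean_sq_le hFt (hC t) hs hsn).trans ?_
        gcongr
    _ = _ := by
        rw [integral_const_mul, integral_add (integrable_const _) (hv.const_mul _),
          integral_const_mul]
        simp

end BaseKernel

/-! ### Decomposition of the estimation error -/

section Decomposition

variable {d p : ℕ} {W A Ξ : Type*} [MeasurableSpace W] [MeasurableSpace A] [MeasurableSpace Ξ]
  {n s B : ℕ} {M : Model d p W} {N : NuisanceEstimator d p W A n}
  {K : BaseKernel (Obs d W) Ξ s} {psiMax : ℝ} {L Lh : ℝ≥0} {x : Cube d}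

theorem measurable_thetaHat (hw : M.WellPosed) (hadm : N.Admissible M) :
    Measurable (thetaHat M N K : Draw d W A Ξ n s B → ℝ) := by
  have h := K.measurable_resampled_prod (n := n) (B := B)
    (F := fun t z => M.psi (N.aHat M t) (N.gHat M t) z) (N.measurable_psiHat hw hadm)
  have h' : Measurable fun D : Draw d W A Ξ n s B => (D.2.1, (D.1, D.2.2)) := by fun_prop
  have h'' := h.comp h'
  exact h''

/-- Puts the training data first, so that iterated integrals condition on the estimated nuisances.
-/
theorem measurePreserving_draw (hsn : s ≤ n) :
    MeasurePreserving (fun D : Draw d W A Ξ n s B => (D.2.1, (D.1, D.2.2))) (drawLaw M N K B)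
      ((N.trainLaw M).prod ((Measure.pi fun _ => M.obsLaw).prod
        (Measure.pi fun _ : Fin B => K.subLaw n))) := by
  have := K.isProbabilityMeasure_subLaw hsn
  have h1 := (measurePreserving_prodAssoc (N.trainLaw M)
    (Measure.pi fun _ : Fin n => M.obsLaw) (Measure.pi fun _ : Fin B => K.subLaw n))
  have h2 := (Measure.measurePreserving_swap (μ := Measure.pi fun _ : Fin n => M.obsLaw)
    (ν := N.trainLaw M)).prod (MeasurePreserving.id (Measure.pi fun _ : Fin B => K.subLaw n))
  have h3 := (measurePreserving_prodAssoc (Measure.pi fun _ : Fin n => M.obsLaw)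
    (N.trainLaw M) (Measure.pi fun _ : Fin B => K.subLaw n)).symm
  exact h1.comp (h2.comp h3)

/-- The estimator splits into the effect of the true debiased moment and that of the estimation of
the nuisance functions. -/
theorem ae_thetaHat_eq (hsn : s ≤ n) (hw : M.WellPosed) (hadm : N.Admissible M)
    (hb : M.BoundedMoment psiMax) :
    ∀ᵐ q ∂((N.trainLaw M).prod ((Measure.pi fun _ => M.obsLaw).prod
        (Measure.pi fun _ : Fin B => K.subLaw n))),
      thetaHat M N K (q.2.1, (q.1, q.2.2)) =
        K.resampled (fun z => clamp psiMax (M.psi M.a0 M.g0 z)) q.2.1 q.2.2 +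
          K.resampled (N.psiDiff M psiMax q.1) q.2.1 q.2.2 := by
  have := K.isProbabilityMeasure_subLaw hsn
  have h1 : ∀ᵐ v ∂((N.trainLaw M).prod M.obsLaw),
      clamp psiMax (M.psi (N.aHat M v.1) (N.gHat M v.1) v.2) =
        M.psi (N.aHat M v.1) (N.gHat M v.1) v.2 := by
    have hm := N.measurable_psiHat hw hadm
    refine (Measure.ae_prod_iff_ae_ae
      (measurableSet_eq_fun ((measurable_clamp psiMax).comp hm) hm)).2 ?_
    filter_upwards [hadm.gHat_mem, hadm.aHat_mem] with t hg ha
    exact hb.ae_obsLaw hw ha hg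
  have h2 : ∀ᵐ q ∂((N.trainLaw M).prod ((Measure.pi fun _ : Fin n => M.obsLaw).prod
        (Measure.pi fun _ : Fin B => K.subLaw n))), ∀ i : Fin n,
      clamp psiMax (M.psi (N.aHat M q.1) (N.gHat M q.1) (q.2.1 i)) =
        M.psi (N.aHat M q.1) (N.gHat M q.1) (q.2.1 i) := by
    refine ae_all_iff.2 fun i => ?_
    have hp := (MeasurePreserving.id (N.trainLaw M)).prod
      ((measurePreserving_eval (fun _ : Fin n => M.obsLaw) i).comp (measurePreserving_fst
        (μ := Measure.pi fun _ : Fin n => M.obsLaw) (ν := Measure.pi fun _ : Fin B => K.subLaw n)))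
    exact hp.quasiMeasurePreserving.ae h1
  filter_upwards [h2] with q hq
  simp only [thetaHat, BaseKernel.resampled, ← Finset.sum_add_distrib, ← mul_add]
  refine Finset.sum_congr rfl fun i _ => ?_
  rw [NuisanceEstimator.psiDiff, add_sub_cancel, hq i]

end Decomposition

theorem integral_abs_add_four_le {α : Type*} [MeasurableSpace α] {μ : Measure α}
    {X f₁ f₂ f₃ f₄ : α → ℝ} (hX : X =ᵐ[μ] fun a => f₁ a + f₂ a + f₃ a + f₄ a)
    (h₁ : Integrable f₁ μ) (h₂ : Integrable f₂ μ) (h₃ : Integrable f₃ μ) (h₄ : Integrable f₄ μ) :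
    ∫ a, |X a| ∂μ ≤
      ∫ a, |f₁ a| ∂μ + ∫ a, |f₂ a| ∂μ + ∫ a, |f₃ a| ∂μ + ∫ a, |f₄ a| ∂μ := by
  have h : ∫ a, (|f₁ a| + |f₂ a| + |f₃ a| + |f₄ a|) ∂μ =
      ∫ a, |f₁ a| ∂μ + ∫ a, |f₂ a| ∂μ + ∫ a, |f₃ a| ∂μ + ∫ a, |f₄ a| ∂μ := by
    have h₁₂ : Integrable (fun a => |f₁ a| + |f₂ a|) μ := h₁.abs.add h₂.abs
    have h₁₂₃ : Integrable (fun a => |f₁ a| + |f₂ a| + |f₃ a|) μ := h₁₂.add h₃.abs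
    rw [integral_add h₁₂₃ h₄.abs, integral_add h₁₂ h₃.abs, integral_add h₁.abs h₂.abs]
  rw [← h]
  refine integral_mono_of_nonneg (ae_of_all _ fun _ => abs_nonneg _)
    (((h₁.abs.add h₂.abs).add h₃.abs).add h₄.abs) ?_
  filter_upwards [hX] with a ha
  rw [ha]
  exact (abs_add_le _ _).trans (add_le_add_left ((abs_add_le _ _).trans
    (add_le_add_left (abs_add_le _ _) _)) _)

section Decomposition

variable {d p : ℕ} {W A Ξ : Type*} [MeasurableSpace W] [MeasurableSpace A] [MeasurableSpace Ξ]
  {n s B : ℕ} {M : Model d p W} {N : NuisanceEstimator d p W A n}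
  {K : BaseKernel (Obs d W) Ξ s} {psiMax : ℝ} {L Lh : ℝ≥0} {x : Cube d}

/-- The true debiased moment, truncated. -/
def trueMoment (M : Model d p W) (psiMax : ℝ) (z : Obs d W) : ℝ :=
  clamp psiMax (M.psi M.a0 M.g0 z)

theorem measurable_trueMoment (hw : M.WellPosed) : Measurable (trueMoment M psiMax) :=
  (measurable_clamp _).comp (Model.measurable_psi_of_mem hw hw.a0_mem hw.g0_mem)

theorem abs_trueMoment_le (hC : 0 ≤ psiMax) (z : Obs d W) : |trueMoment M psiMax z| ≤ psiMax :=
  abs_clamp_le hC _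

variable [StandardBorelSpace W] [StandardBorelSpace Ξ]

/-- The bias of the kernel. -/
theorem abs_integral_meanStat_trueMoment_sub_le [NeZero s] (hw : M.WellPosed)
    (hreg : M.IsRegression) (hriesz : M.IsRiesz) (hadm : N.Admissible M)
    (hb : M.BoundedMoment psiMax) (hsmooth : M.SmoothMoment L)
    (hH : ∀ᵐ t ∂(N.trainLaw M), K.Honest M (N.aHat M t) (N.gHat M t)) {e : ℝ}
    (hsh : K.Shrinks M.obsLaw x e) :
    |∫ y, K.meanStat (trueMoment M psiMax) y ∂(Measure.pi fun _ => M.obsLaw) - M.theta0 x| ≤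
      L * e := by
  -- Honesty concerns the pair of estimated and true moments. One good realization of the estimates
  -- is enough, since the function applied below reads only the true moment.
  obtain ⟨t, hHt, hg, ha⟩ := (hH.and (hadm.gHat_mem.and hadm.aHat_mem)).exists
  have hC := hb.nonneg hw x
  have hm0 := measurable_trueMoment (psiMax := psiMax) hw
  have hc0 := abs_trueMoment_le (M := M) hC
  have hc : M.condMean (trueMoment M psiMax) = M.condMean (M.psi M.a0 M.g0) := by
    funext y
    exact Model.condMean_clamp hb ha hg hw.a0_mem hw.g0_mem (fun v => v.2) y
  have hlip : LipschitzWith L (M.condMean (trueMoment M psiMax)) := by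
    rw [hc]; exact hsmooth _ hw.g0_mem _ hw.a0_mem
  have h1 : ∫ ω, K.stat (trueMoment M psiMax) ω.1 ω.2 ∂(K.jointLaw M.obsLaw) =
      ∫ ω, K.stat (fun z => M.condMean (trueMoment M psiMax) z.feat) ω.1 ω.2
        ∂(K.jointLaw M.obsLaw) :=
    K.integral_stat_of_honest hHt (Model.measurable_psi_of_mem hw ha hg)
      (Model.measurable_psi_of_mem hw hw.a0_mem hw.g0_mem) (φ := fun v => clamp psiMax v.2)
      ((measurable_clamp _).comp measurable_snd) (fun v => abs_clamp_le hC v.2)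
  rw [K.integral_meanStat hm0 hc0, h1, ← Model.condMean_psi_zero hw hreg hriesz hb x, ← hc]
  exact K.abs_integral_stat_feat_sub_le hsh hlip (C := psiMax) (M.abs_condMean_le hc0)

/-- The `L¹` distance of the estimation error to a sum of independent variables. -/
theorem integral_abs_thetaHat_sub_le [NeZero s] (hsn : s ≤ n) (hB : 0 < B) (hw : M.WellPosed)
    (hreg : M.IsRegression) (hriesz : M.IsRiesz) (hadm : N.Admissible M)
    (hlink : ∀ w, LipschitzWith Lh (M.link w))
    (hH : ∀ᵐ t ∂(N.trainLaw M), K.Honest M (N.aHat M t) (N.gHat M t)) {e : ℝ}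
    (hsh : K.Shrinks M.obsLaw x e) (hb : M.BoundedMoment psiMax) (hsmooth : M.SmoothMoment L)
    (hmsc : M.MeanSquareContinuous L) {r δ : ℝ}
    (hr : ∫ t, ∫ z, N.largeError M r t z ∂M.obsLaw ∂(N.trainLaw M) ≤ δ) :
    Integrable (fun D : Draw d W A Ξ n s B => thetaHat M N K D - M.theta0 x -
      K.leadingTerm M.obsLaw (trueMoment M psiMax) D.1) (drawLaw M N K B) ∧
    ∫ D : Draw d W A Ξ n s B, |thetaHat M N K D - M.theta0 x -
      K.leadingTerm M.obsLaw (trueMoment M psiMax) D.1| ∂(drawLaw M N K B) ≤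
      L * e + √(2 * (psiMax ^ 2 / B + ((s : ℝ) / n) ^ 2 * psiMax ^ 2)) +
      (Lh ^ 2 * r ^ 2 + 2 * psiMax * (s * δ)) +
      √(2 * ((2 * psiMax) ^ 2 / B +
        (s : ℝ) / n * (L * Lh ^ 2 * r ^ 2 + (2 * psiMax) ^ 2 * (s * δ)))) := by
  have := K.isProbabilityMeasure_subLaw hsn
  have hC := hb.nonneg hw x
  set μzu : Measure ((Fin n → Obs d W) × (Fin B → Subsample n s × Ξ)) :=
    (Measure.pi fun _ => M.obsLaw).prod (Measure.pi fun _ : Fin B => K.subLaw n) with hμzu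
  set f₀ := trueMoment M psiMax with hf₀
  have hm0 : Measurable f₀ := measurable_trueMoment hw
  have hc0 : ∀ z, |f₀ z| ≤ psiMax := abs_trueMoment_le hC
  set m₀ := ∫ y, K.meanStat f₀ y ∂(Measure.pi fun _ => M.obsLaw) with hm₀
  have hF : Measurable (Function.uncurry (N.psiDiff M psiMax)) :=
    N.measurable_psiDiff hw hadm psiMax
  have hFC := fun t z => N.abs_psiDiff_le (M := M) hC t z
  set mt : (Fin n → Obs d W) × A → ℝ :=
    fun t => ∫ ω, K.stat (N.psiDiff M psiMax t) ω.1 ω.2 ∂(K.jointLaw M.obsLaw) with hmt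
  have hmtm : Measurable mt := K.measurable_integral_stat hF
  have hmtC : ∀ t, |mt t| ≤ 2 * psiMax := fun t => K.abs_integral_stat_le_of_abs_le (hFC t)
  set b : (Fin n → Obs d W) × A → ℝ := fun t => ∫ z, N.largeError M r t z ∂M.obsLaw with hbdef
  have hbi : Integrable b (N.trainLaw M) :=
    (integrable_of_abs_le (μ := (N.trainLaw M).prod M.obsLaw) (N.measurable_largeError hw)
      fun q => N.abs_largeError_le_one q.1 q.2).integral_prod_left
  have hmom : ∀ᵐ t ∂(N.trainLaw M),
      |mt t| ≤ Lh ^ 2 * r ^ 2 + 2 * psiMax * (s * b t) ∧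
      ∫ y, K.meanStat (N.psiDiff M psiMax t) y ^ 2 ∂(Measure.pi fun _ => M.obsLaw) ≤
        L * Lh ^ 2 * r ^ 2 + (2 * psiMax) ^ 2 * (s * b t) := by
    filter_upwards [hH, hadm.gHat_mem, hadm.aHat_mem] with t hHt hg ha
    have h := N.moments_psiDiff_le K hw hreg hriesz hadm hb hmsc hlink hC hg ha hHt r
    rw [K.integral_meanStat (N.measurable_psiDiff_right hw hadm psiMax t) (hFC t)] at h
    exact h
  have haff : ∀ u w : ℝ, Integrable (fun t => u + w * (s * b t)) (N.trainLaw M) := fun u w =>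
    (integrable_const _).add ((hbi.const_mul _).const_mul _)
  have haffint : ∀ u w : ℝ, 0 ≤ w →
      ∫ t, (u + w * (s * b t)) ∂(N.trainLaw M) ≤ u + w * (s * δ) := fun u w hw0 => by
    rw [integral_add (integrable_const _) ((hbi.const_mul _).const_mul _), integral_const_mul,
      integral_const_mul]
    simp only [integral_const, probReal_univ, one_smul]
    gcongr
  set X₁ : ((Fin n → Obs d W) × A) × ((Fin n → Obs d W) × (Fin B → Subsample n s × Ξ)) → ℝ :=
    fun q => K.resampled f₀ q.2.1 q.2.2 - (m₀ + K.leadingTerm M.obsLaw f₀ q.2.1) with hX₁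
  set X₂ : ((Fin n → Obs d W) × A) × ((Fin n → Obs d W) × (Fin B → Subsample n s × Ξ)) → ℝ :=
    fun q => K.resampled (N.psiDiff M psiMax q.1) q.2.1 q.2.2 - mt q.1 with hX₂
  set ν := (N.trainLaw M).prod μzu with hν
  have hg1m : Measurable fun v : (Fin n → Obs d W) × (Fin B → Subsample n s × Ξ) =>
      K.resampled f₀ v.1 v.2 - (m₀ + K.leadingTerm M.obsLaw f₀ v.1) :=
    (K.measurable_resampled hm0).sub
      (((K.measurable_leadingTerm hm0).comp measurable_fst).const_add _)
  have hm₀C : |m₀| ≤ psiMax := abs_integral_le_of_abs_le fun y => K.abs_meanStat_le hc0 y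
  have hi1 : Integrable X₁ ν := by
    refine integrable_of_abs_le (hg1m.comp measurable_snd)
      (C := psiMax + (psiMax + (s : ℝ) / n * (n * (2 * psiMax)))) fun q => ?_
    refine (abs_sub _ _).trans (add_le_add (K.abs_resampled_le hc0 hB _ _) ?_)
    exact (abs_add_le _ _).trans (add_le_add hm₀C (K.abs_leadingTerm_le hc0 _))
  have hi2 : Integrable X₂ ν := by
    refine integrable_of_abs_le (C := 2 * psiMax + 2 * psiMax)
      ((K.measurable_resampled_prod hF).sub (hmtm.comp measurable_fst)) fun q => ?_
    exact (abs_sub _ _).trans (add_le_add (K.abs_resampled_le (hFC _) hB _ _) (hmtC _))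
  have hi3 : Integrable (fun q : ((Fin n → Obs d W) × A) ×
      ((Fin n → Obs d W) × (Fin B → Subsample n s × Ξ)) => mt q.1) ν :=
    integrable_of_abs_le (hmtm.comp measurable_fst) fun q => hmtC _
  have hp := measurePreserving_draw (N := N) (K := K) (B := B) (M := M) hsn
  rw [← hμzu, ← hν] at hp
  set R : ((Fin n → Obs d W) × A) × ((Fin n → Obs d W) × (Fin B → Subsample n s × Ξ)) → ℝ :=
    fun q => thetaHat M N K (q.2.1, (q.1, q.2.2)) - M.theta0 x -
      K.leadingTerm M.obsLaw f₀ q.2.1 with hR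
  have hRm : Measurable R := by
    have h1 : Measurable fun q : ((Fin n → Obs d W) × A) ×
      ((Fin n → Obs d W) × (Fin B → Subsample n s × Ξ)) => (q.2.1, (q.1, q.2.2)) := by fun_prop
    have h2 := (measurable_thetaHat (K := K) (B := B) hw hadm).comp h1
    exact (h2.sub_const _).sub ((K.measurable_leadingTerm hm0).comp
      (measurable_fst.comp measurable_snd))
  -- The four terms are the kernel bias, the projection and resampling error, the nuisance bias
  -- given the training data, and the nuisance fluctuation around it.
  have hRX : R =ᵐ[ν] fun q => (m₀ - M.theta0 x) + X₁ q + mt q.1 + X₂ q := by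
    filter_upwards [ae_thetaHat_eq (K := K) (B := B) hsn hw hadm hb] with q hq
    simp only [hR, hX₁, hX₂, hq]
    simp only [hf₀]
    unfold trueMoment
    ring
  have hRi : Integrable R ν :=
    (((((integrable_const _).add hi1).add hi3).add hi2).congr hRX.symm)
  refine ⟨hp.integrable_comp_of_integrable hRi, ?_⟩
  have htr : ∫ D : Draw d W A Ξ n s B, |thetaHat M N K D - M.theta0 x -
      K.leadingTerm M.obsLaw f₀ D.1| ∂(drawLaw M N K B) = ∫ q, |R q| ∂ν := by
    rw [← hp.map_eq, integral_map hp.measurable.aemeasurable hRm.abs.aestronglyMeasurable]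
  rw [htr]
  refine (integral_abs_add_four_le hRX (integrable_const _) hi1 hi3 hi2).trans ?_
  refine add_le_add (add_le_add (add_le_add ?_ ?_) ?_) ?_
  · simp only [integral_const, probReal_univ, one_smul]
    exact abs_integral_meanStat_trueMoment_sub_le hw hreg hriesz hadm hb hsmooth hH hsh
  · have h := K.integral_abs_resampled_sub_leadingTerm_le (P := M.obsLaw) hm0 hc0 hsn hB
    refine le_trans (le_of_eq ?_) h
    have h2 := (measurePreserving_snd (μ := N.trainLaw M) (ν := μzu)).map_eq
    rw [← hμzu, ← h2, integral_map measurable_snd.aemeasurable hg1m.abs.aestronglyMeasurable]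
  · have h2 := (measurePreserving_fst (μ := N.trainLaw M) (ν := μzu)).map_eq
    have h3 : ∫ q, |mt q.1| ∂ν = ∫ t, |mt t| ∂(N.trainLaw M) := by
      conv_rhs => rw [← h2]
      rw [integral_map measurable_fst.aemeasurable hmtm.abs.aestronglyMeasurable]
    rw [h3]
    refine le_trans (integral_mono_ae (integrable_of_abs_le hmtm hmtC).abs (haff _ _)
      (hmom.mono fun t ht => ht.1)) (haffint _ _ (by positivity))
  · refine (K.integral_abs_resampled_sub_mean_le hF hFC (Nat.pos_of_neZero s) hsn hB (haff _ _)
      (hmom.mono fun t ht => ht.2)).trans ?_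
    gcongr
    exact haffint _ _ (by positivity)

end Decomposition

/-! ### Transfer to the underlying probability space, and rescaling -/

section Draws

variable {d p : ℕ} {W A Ξ Ω : Type*} [MeasurableSpace W] [MeasurableSpace A] [MeasurableSpace Ξ]
  [MeasurableSpace Ω] {n s B : ℕ} {M : Model d p W} {N : NuisanceEstimator d p W A n}
  {K : BaseKernel (Obs d W) Ξ s} {Pr : Measure Ω}
  {D : Ω → Draw d W A Ξ n s B}

/-- The estimation error is large with small probability. -/
theorem trainLaw_real_lt_error_le (hsn : s ≤ n) (hD : HasLaw D (drawLaw M N K B) Pr)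
    (hw : M.WellPosed) {r δ : ℝ} (x : Cube d)
    (h : δ < 1 → ENNReal.ofReal (1 - δ) ≤ Pr {ω | N.error M (D ω).2.1 x ≤ r}) :
    (N.trainLaw M).real {t | r < N.error M t x} ≤ δ := by
  have := K.isProbabilityMeasure_subLaw hsn
  -- The rate says nothing for levels at least 1, where the claim is trivial.
  rcases le_or_gt 1 δ with hδ | hδ
  · exact measureReal_le_one.trans hδ
  have hs : MeasurableSet {t | N.error M t x ≤ r} :=
    measurableSet_le (N.measurable_error_left hw x) measurable_const
  have hp := (measurePreserving_fst (μ := N.trainLaw M)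
    (ν := (Measure.pi fun _ : Fin n => M.obsLaw).prod
      (Measure.pi fun _ : Fin B => K.subLaw n))).comp
    (measurePreserving_draw (N := N) (K := K) (B := B) (M := M) hsn)
  have h1 : Pr {ω | N.error M (D ω).2.1 x ≤ r} = N.trainLaw M {t | N.error M t x ≤ r} := by
    rw [← hp.measure_preimage hs.nullMeasurableSet, ← hD.map_eq,
      Measure.map_apply_of_aemeasurable hD.aemeasurable (hp.measurable hs)]
    rfl
  have h2 : 1 - δ ≤ (N.trainLaw M).real {t | N.error M t x ≤ r} := by
    rw [measureReal_def, ← ENNReal.ofReal_le_iff_le_toReal (measure_ne_top _ _), ← h1]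
    exact h hδ
  have h3 : {t | r < N.error M t x} = {t | N.error M t x ≤ r}ᶜ := by
    ext t; simp
  rw [h3, probReal_compl_eq_one_sub hs]
  linarith

/-- Integrals of functions of the first half of the data. -/
theorem integral_comp_draw_fst (hsn : s ≤ n) (hD : HasLaw D (drawLaw M N K B) Pr)
    {F : (Fin n → Obs d W) → ℂ} (hF : Measurable F) :
    ∫ ω, F (D ω).1 ∂Pr = ∫ z, F z ∂(Measure.pi fun _ => M.obsLaw) := by
  have := K.isProbabilityMeasure_subLaw hsn
  have hp : MeasurePreserving (fun q : Draw d W A Ξ n s B => q.1) (drawLaw M N K B)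
      (Measure.pi fun _ => M.obsLaw) :=
    measurePreserving_fst (ν := (N.trainLaw M).prod (Measure.pi fun _ : Fin B => K.subLaw n))
  rw [← hp.map_eq, integral_map hp.measurable.aemeasurable hF.aestronglyMeasurable, ← hD.map_eq,
    integral_map hD.aemeasurable (f := fun q => F q.1)
      (hF.comp measurable_fst).aestronglyMeasurable]

/-- For n = 0 nothing is known about the draw, but the estimator is then an empty sum. -/
theorem aemeasurable_thetaHat (hD : 0 < n → HasLaw D (drawLaw M N K B) Pr)
    (hw : M.WellPosed) (hadm : N.Admissible M) :
    AEMeasurable (fun ω => thetaHat M N K (D ω)) Pr := by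
  rcases Nat.eq_zero_or_pos n with rfl | hn
  · simp [thetaHat]
  · exact (measurable_thetaHat hw hadm).comp_aemeasurable (hD hn).aemeasurable

end Draws

/-- The size of the remainder after rescaling. -/
theorem scaled_remainder_le {κ σ w ε C b δ r Q Lh L β : ℝ} (hκ : 0 ≤ κ) (hσ : 0 ≤ σ) (hL : 0 ≤ L)
    (hw : κ * σ = w) (hC : 0 ≤ C) (hβ : β⁻¹ ≤ σ ^ 2) (hb : b ≤ δ) :
    κ * (L * ε + √(2 * (C ^ 2 / β + σ ^ 2 * C ^ 2)) + (Lh ^ 2 * r ^ 2 + 2 * C * b) +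
      √(2 * ((2 * C) ^ 2 / β + σ * (Q * r ^ 2 + (2 * C) ^ 2 * b)))) ≤
    L * (κ * |ε|) + √(2 * (2 * C ^ 2 * w ^ 2)) + (Lh ^ 2 * (κ * r ^ 2) + 2 * C * (κ * δ)) +
      √(2 * ((2 * C) ^ 2 * w ^ 2 + w * (Q * (κ * r ^ 2) + (2 * C) ^ 2 * (κ * δ)))) := by
  have hsqrt : ∀ X, κ * √X = √(κ ^ 2 * X) := fun X => by
    rw [Real.sqrt_mul (sq_nonneg κ), Real.sqrt_sq hκ]
  have hdiv : ∀ c : ℝ, 0 ≤ c → κ ^ 2 * (c / β) ≤ c * w ^ 2 := fun c hc => by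
    rw [← hw, div_eq_mul_inv]
    have := mul_le_mul_of_nonneg_left hβ (mul_nonneg (sq_nonneg κ) hc)
    linarith
  -- In the application κ is the scale, σ = s/n, w = (nη)^{-1/2} and β = B. Squared inside the
  -- roots, κ pairs with the σ² of the projection and resampling terms to give w². For the
  -- fluctuation, κ²σ splits as w · κ, leaving one κ for r² and δ.
  rw [mul_add, mul_add, mul_add, hsqrt, hsqrt]
  refine add_le_add (add_le_add (add_le_add ?_ (Real.sqrt_le_sqrt ?_)) ?_) (Real.sqrt_le_sqrt ?_)
  · have := mul_le_mul_of_nonneg_left (le_abs_self ε) (mul_nonneg hL hκ)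
    linarith
  · have h1 := hdiv (C ^ 2) (sq_nonneg C)
    have h2 : κ ^ 2 * (σ ^ 2 * C ^ 2) = C ^ 2 * w ^ 2 := by rw [← hw]; ring
    linarith
  · have := mul_le_mul_of_nonneg_left hb (mul_nonneg hC hκ)
    linarith
  · have h1 := hdiv ((2 * C) ^ 2) (sq_nonneg _)
    have h2 : κ ^ 2 * (σ * (Q * r ^ 2 + (2 * C) ^ 2 * b)) =
        w * (Q * (κ * r ^ 2) + (2 * C) ^ 2 * (κ * b)) := by rw [← hw]; ring
    have hw0 : 0 ≤ w := hw ▸ mul_nonneg hκ hσ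
    have h3 := mul_le_mul_of_nonneg_left hb (mul_nonneg (mul_nonneg hw0 (sq_nonneg (2 * C))) hκ)
    linarith

/-- The scale of the theorem times the factor s/n of `leadingTerm` is the normalization of the
central limit theorem. -/
theorem sqrt_div_mul_div {n s η : ℝ} (hn : 0 < n) (hs : 0 < s) (hη : 0 < η) :
    √(n / (s ^ 2 * η)) * (s / n) = (√(n * η))⁻¹ := by
  rw [← Real.sqrt_inv]
  refine (Real.sqrt_eq_iff_mul_self_eq (by positivity) (by positivity)).2 ?_ |>.symm
  rw [mul_mul_mul_comm, Real.mul_self_sqrt (by positivity)]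
  field_simp

end DoublyRobust

end

/-! ### The limit theorem -/

theorem theorem2
    {d : ℕ} (x : Cube d)
    -- for every sample size `n`: the spaces, the dimension `p n` of the nuisance parameters, the
    -- sub-sample size `s n`, the number `B n` of sub-samples
    {W Ξ A Ω : ℕ → Type*}
    [∀ n, MeasurableSpace (W n)] [∀ n, StandardBorelSpace (W n)]
    [∀ n, MeasurableSpace (Ξ n)] [∀ n, StandardBorelSpace (Ξ n)]
    [∀ n, MeasurableSpace (A n)] [∀ n, MeasurableSpace (Ω n)]
    (p s B : ℕ → ℕ) [∀ n, NeZero (s n)]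
    -- the model, the nuisance estimators, the base kernel at the target point `x`
    (M : ∀ n, Model d (p n) (W n))
    (N : ∀ n, NuisanceEstimator d (p n) (W n) (A n) n)
    (K : ∀ n, BaseKernel (Obs d (W n)) (Ξ n) (s n))
    -- the random draw behind the estimator
    (Pr : ∀ n, Measure (Ω n)) [∀ n, IsProbabilityMeasure (Pr n)]
    (D : ∀ n, Ω n → Draw d (W n) (A n) (Ξ n) n (s n) (B n))
    (hD : ∀ n, 0 < n → HasLaw (D n) (drawLaw (M n) (N n) (K n) (B n)) (Pr n))
    -- the setting
    (hwell : ∀ n, (M n).WellPosed)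
    (hreg : ∀ n, (M n).IsRegression)
    (hriesz : ∀ n, (M n).IsRiesz)
    (hadm : ∀ n, (N n).Admissible (M n))
    (Lh : ℝ≥0) (hlink : ∀ n w, LipschitzWith Lh ((M n).link w))
    -- honesty
    (hhonest : ∀ n, ∀ᵐ t ∂((N n).trainLaw (M n)),
      (K n).Honest (M n) ((N n).aHat (M n) t) ((N n).gHat (M n) t))
    -- kernel shrinkage
    (ε : ℕ → ℝ) (hshrink : ∀ n, (K n).Shrinks (M n).obsLaw x (ε (s n)))
    -- boundedness, smoothness, local mean-squared continuity
    (psiMax : ℝ) (hbdd : ∀ n, (M n).BoundedMoment psiMax)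
    (L : ℝ≥0) (hsmooth : ∀ n, (M n).SmoothMoment L)
    (hmsc : ∀ n, (M n).MeanSquareContinuous L)
    -- the variance `η(s)`
    (η : ℕ → ℝ) (hη : ∀ n, η n = (K n).eta (M n).obsLaw ((M n).psi (M n).a0 (M n).g0))
    -- growth conditions
    (hsn : ∀ n, 0 < n → s n ≤ n)
    (hs : Tendsto s atTop atTop)
    (hso : (fun n : ℕ => (s n : ℝ)) =o[atTop] fun n : ℕ => (n : ℝ))
    (hB : ∀ n : ℕ, 0 < n → ((n : ℝ) / (s n : ℝ)) ^ 2 ≤ (B n : ℝ))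
    (hε : Tendsto (fun n => ε (s n)) atTop (𝓝 0))
    (hnη : Tendsto (fun n : ℕ => (n : ℝ) * η n) atTop atTop)
    (hbias : Tendsto (fun n : ℕ => (n : ℝ) * ε (s n) ^ 2 / ((s n : ℝ) ^ 2 * η n)) atTop (𝓝 0))
    -- nuisance rates
    (r : ℕ → ℝ → ℝ)
    (hr : ∀ n, 0 < n → ∀ x' : Cube d, ∀ δ ∈ Set.Ioo (0 : ℝ) 1,
      ENNReal.ofReal (1 - δ) ≤ Pr n {ω | (N n).error (M n) (D n ω).2.1 x' ≤ r n δ})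
    (hδ : ∃ δ : ℕ → ℝ, (∀ n, 0 < δ n) ∧
      Tendsto (fun n : ℕ => √((n : ℝ) / ((s n : ℝ) ^ 2 * η n)) * δ n) atTop (𝓝 0) ∧
      Tendsto (fun n : ℕ => √((n : ℝ) / ((s n : ℝ) ^ 2 * η n)) * r n (δ n / n) ^ 2) atTop (𝓝 0)) :
    TendstoInDistribution
      (fun (n : ℕ) (ω : Ω n) => √((n : ℝ) / ((s n : ℝ) ^ 2 * η n)) *
        (thetaHat (M n) (N n) (K n) (D n ω) - (M n).theta0 x))
      atTop (id : ℝ → ℝ) Pr (gaussianReal 0 1) := by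
  obtain ⟨δ, hδ0, hκδ, hκr⟩ := hδ
  set κ : ℕ → ℝ := fun n => √((n : ℝ) / ((s n : ℝ) ^ 2 * η n)) with hκdef
  change TendstoInDistribution (fun n ω => κ n *
    (thetaHat (M n) (N n) (K n) (D n ω) - (M n).theta0 x)) atTop (id : ℝ → ℝ) Pr (gaussianReal 0 1)
  replace hκδ : Tendsto (fun n => κ n * δ n) atTop (𝓝 0) := hκδ
  replace hκr : Tendsto (fun n => κ n * r n (δ n / n) ^ 2) atTop (𝓝 0) := hκr
  have hC : 0 ≤ psiMax := (hbdd 0).nonneg (hwell 0) x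
  have hs0 : ∀ n, (0 : ℝ) < s n := fun n => by exact_mod_cast Nat.pos_of_neZero (s n)
  have hκ0 : ∀ n, 0 ≤ κ n := fun n => Real.sqrt_nonneg _
  have hevent : ∀ᶠ n : ℕ in atTop, 0 < n ∧ 0 < η n := by
    filter_upwards [eventually_gt_atTop 0, hnη.eventually_gt_atTop 0] with n hn hnη
    exact ⟨hn, (mul_pos_iff_of_pos_left (by exact_mod_cast hn)).1 hnη⟩
  have hB0 : ∀ n, 0 < n → 0 < B n := fun n hn => by
    have hn' : (0 : ℝ) < n := by exact_mod_cast hn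
    have := hs0 n
    have h : (0 : ℝ) < B n := lt_of_lt_of_le (by positivity) (hB n hn)
    exact_mod_cast h
  set f : ∀ n, Obs d (W n) → ℝ := fun n => trueMoment (M n) psiMax with hf
  have hfm : ∀ n, Measurable (f n) := fun n => measurable_trueMoment (hwell n)
  have hfC : ∀ n z, |f n z| ≤ psiMax := fun n => abs_trueMoment_le hC
  have hηvar : ∀ n, η n = Var[(K n).firstProj (M n).obsLaw (f n); (M n).obsLaw] := fun n => by
    rw [hη n, ← (K n).eta_eq_variance (hfm n) (hfC n)]
    refine (K n).eta_congr ?_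
    filter_upwards [(hbdd n).ae_obsLaw (hwell n) (hwell n).a0_mem (hwell n).g0_mem] with z hz
    exact hz.symm
  -- The rate is taken at level δ_n/n, so that the s points of a sub-sample together contribute s
  -- δ_n/n ≤ δ_n.
  have hrem : ∀ n, 0 < n →
      Integrable (fun D : Draw d (W n) (A n) (Ξ n) n (s n) (B n) =>
        thetaHat (M n) (N n) (K n) D - (M n).theta0 x -
          (K n).leadingTerm (M n).obsLaw (f n) D.1) (drawLaw (M n) (N n) (K n) (B n)) ∧ _ :=
    fun n hn => integral_abs_thetaHat_sub_le (hsn n hn) (hB0 n hn) (hwell n) (hreg n) (hriesz n)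
      (hadm n) (hlink n) (hhonest n) (hshrink n) (hbdd n) (hsmooth n) (hmsc n)
      (r := r n (δ n / n)) (δ := δ n / n)
      ((N n).integral_integral_largeError_le (hwell n) fun x' =>
        trainLaw_real_lt_error_le (hsn n hn) (hD n hn) (hwell n) x' fun h1 =>
          hr n hn x' _ ⟨div_pos (hδ0 n) (by exact_mod_cast hn), h1⟩)
  have hdiff : ∀ n (ω : Ω n),
      κ n * (thetaHat (M n) (N n) (K n) (D n ω) - (M n).theta0 x) -
        κ n * (K n).leadingTerm (M n).obsLaw (f n) (D n ω).1 =
      κ n * (thetaHat (M n) (N n) (K n) (D n ω) - (M n).theta0 x -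
        (K n).leadingTerm (M n).obsLaw (f n) (D n ω).1) := fun n ω => (mul_sub _ _ _).symm
  refine tendstoInDistribution_of_tendsto_integral_exp Pr _
    (fun n ω => κ n * (K n).leadingTerm (M n).obsLaw (f n) (D n ω).1) (fun n => ?_) ?_ ?_ ?_
    fun t => ?_
  · exact ((aemeasurable_thetaHat (hD n) (hwell n) (hadm n)).sub_const _).const_mul _
  · filter_upwards [hevent] with n hn
    exact ((((K n).measurable_leadingTerm (hfm n)).comp measurable_fst).comp_aemeasurable
      (hD n hn.1).aemeasurable).const_mul _
  · filter_upwards [hevent] with n hn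
    simp only [hdiff]
    refine Integrable.const_mul ?_ _
    have h := (hrem n hn.1).1
    rw [← (hD n hn.1).map_eq] at h
    exact h.comp_aemeasurable (hD n hn.1).aemeasurable
  · set w : ℕ → ℝ := fun n => (√((n : ℝ) * η n))⁻¹ with hw
    have hw0 : Tendsto w atTop (𝓝 0) :=
      tendsto_inv_atTop_zero.comp (Real.tendsto_sqrt_atTop.comp hnη)
    -- This is the square root of the sequence in `hbias`.
    have hκε : Tendsto (fun n => κ n * |ε (s n)|) atTop (𝓝 0) := by
      have h := (Real.continuous_sqrt.tendsto 0).comp hbias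
      rw [Real.sqrt_zero] at h
      refine h.congr fun n => ?_
      rw [Function.comp_apply, mul_div_right_comm, Real.sqrt_mul' _ (sq_nonneg _),
        Real.sqrt_sq_eq_abs]
    have hlim : Tendsto (fun n => L * (κ n * |ε (s n)|) + √(2 * (2 * psiMax ^ 2 * w n ^ 2)) +
        ((Lh : ℝ) ^ 2 * (κ n * r n (δ n / n) ^ 2) + 2 * psiMax * (κ n * δ n)) +
        √(2 * ((2 * psiMax) ^ 2 * w n ^ 2 + w n * (L * (Lh : ℝ) ^ 2 *
          (κ n * r n (δ n / n) ^ 2) + (2 * psiMax) ^ 2 * (κ n * δ n))))) atTop (𝓝 0) := by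
      -- The bound is a continuous function, vanishing at the origin, of the four null sequences
      -- κ|ε|, w, κr² and κδ.
      have hcont : Continuous fun v : ℝ × ℝ × ℝ × ℝ =>
          L * v.1 + √(2 * (2 * psiMax ^ 2 * v.2.1 ^ 2)) +
          ((Lh : ℝ) ^ 2 * v.2.2.1 + 2 * psiMax * v.2.2.2) +
          √(2 * ((2 * psiMax) ^ 2 * v.2.1 ^ 2 + v.2.1 * (L * (Lh : ℝ) ^ 2 * v.2.2.1 +
            (2 * psiMax) ^ 2 * v.2.2.2))) := by fun_prop
      have h := (hcont.tendsto (0, 0, 0, 0)).comp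
        (hκε.prodMk_nhds (hw0.prodMk_nhds (hκr.prodMk_nhds hκδ)))
      simpa [Function.comp_def] using h
    refine squeeze_zero' (Eventually.of_forall fun n => integral_nonneg fun ω => abs_nonneg _) ?_
      hlim
    filter_upwards [hevent] with n hn
    have hn' : (0 : ℝ) < n := by exact_mod_cast hn.1
    simp only [hdiff, abs_mul, abs_of_nonneg (hκ0 n)]
    rw [integral_const_mul]
    have h1 := (hD n hn.1).integral_comp (hrem n hn.1).1.abs.aestronglyMeasurable
    have h2 := (hrem n hn.1).2
    rw [← h1] at h2
    refine (mul_le_mul_of_nonneg_left h2 (hκ0 n)).trans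
      (scaled_remainder_le (hκ0 n) (div_nonneg (hs0 n).le hn'.le) L.2
        (sqrt_div_mul_div hn' (hs0 n) hn.2) hC ?_ ?_)
    -- The requirement 1/B ≤ (s/n)² is the inverted lower bound on the number of sub-samples.
    · rw [← inv_div, inv_pow]
      exact inv_anti₀ (by have := hs0 n; positivity) (hB n hn.1)
    · have h3 : (s n : ℝ) ≤ n := by exact_mod_cast hsn n hn.1
      calc (s n : ℝ) * (δ n / n) ≤ n * (δ n / n) :=
            mul_le_mul_of_nonneg_right h3 (div_nonneg (hδ0 n).le hn'.le)
        _ = δ n := by field_simp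
  · refine (tendsto_integral_exp_standardized_sum (fun n => (M n).obsLaw)
      (fun n => (K n).firstProj (M n).obsLaw (f n)) (fun n => (K n).measurable_firstProj (hfm n))
      (fun n => (K n).abs_firstProj_le (hfC n)) η hηvar hnη t).congr' ?_
    -- Once η > 0, the rescaled leading term is literally the standardized sum of the central limit
    -- theorem.
    filter_upwards [hevent] with n hn
    have hm : Measurable fun z : Fin n → Obs d (W n) => Complex.exp
        ((t * (κ n * (K n).leadingTerm (M n).obsLaw (f n) z) : ℝ) * Complex.I) := by
      have := (K n).measurable_leadingTerm (n := n) (P := (M n).obsLaw) (hfm n)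
      fun_prop
    refine Eq.trans ?_ (integral_comp_draw_fst (hsn n hn.1) (hD n hn.1) hm).symm
    refine integral_congr_ae (ae_of_all _ fun z => ?_)
    simp only [BaseKernel.leadingTerm]
    rw [← mul_assoc (κ n), sqrt_div_mul_div (by exact_mod_cast hn.1) (hs0 n) hn.2]
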